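/- Let $K=\mathbb F_q$ be a finite field, $k\ge 3$, and let $V$ be a $K$-vector space of dimension $n=2^k\ (\ge 8)$. Let $N\le G\le GL(V)$ with $N$ normal in $G$ and $\gcd(|G|,|V|)=1$, and let $Z\cong K^\times$ be the group of all scalar transformations of $V$. For $x\in V$ write $C_G(x)=\{g\in G: gx=x\}$, and for a subspace $U\le V$ write $N_G(U)=\{g\in G: gU=U\}$. Assume that $G$ is of symplectic type for the prime $r=2$, that is: $Z=Z(G)\le N$, the group $N/Z$ is an elementary abelian $2$-group, and $V$ is an absolutely irreducible $KN$-module. Assume that $N=R\star Z$ is the central product of $Z$ and an extraspecial $2$-group $R$ with $|R\cap Z|=2$, and that $N$ is monomial: it is not the case that both $q\equiv -1 \pmod 4$ and $R$ is a central product of (zero or more) dihedral groups of order $8$ and one quaternion group of order $8$. Let $W=\mathbb F_2^k$ with standard basis $e_1,\dots,e_k$. A basis $(u_w)_{w\in W}$ of $V$ is called *adapted* if there are subgroups $D,D_1,S$ with $N=D\rtimes S$, $D=Z\times D_1$, $D_1\cong S\cong C_2^k$ such that $S$ is the group of all maps $u_w\mapsto u_{a+w}$ $(a\in W)$; each $u_w$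 is an eigenvector of $D$; every homomorphism $D_1\to K^\times$ is the character of $D_1$ on $\langle u_w\rangle$ for exactly one $w\in W$; and $D_1$ fixes $u_0$. Given an adapted basis, we identify $w$ with $u_w$; let $V'=\langle u_w : w\in\langle e_1,e_2\rangle\rangle\le V$. Let $u_1,u_2,u_3,u_4$ be any enumeration of the four vectors $u_w$ $(w\in\langle e_1,e_2\rangle)$ whose first member is $u_{w}$ with $w=0$. The *explicit pairs* $(x_0,y_0)$ are - $x_0=u_1,\ y_0=u_2+\alpha u_3+\alpha^{-1}u_4$ with $\alpha\in K^\times$, $\alpha^8\ne 1$, if $q\ne 3,5,9$; - $x_0=u_1,\ y_0=u_1+u_3+u_4$, if $q=3$; - $x_0=u_1+u_2+2u_3,\ y_0=u_2+u_3+2u_4$, if $q=5$; - $x_0=u_1+u_3+u_4,\ y_0=u_2+u_3+\alpha u_4$ with $\alpha$ a generator of $K^\times$, if $q=9$. Call $x_0,y_0\in V'$ a *starting pair* if $y_0$ is a linear combination of exactly three basis vectors with non-zero coefficients and $N_G(V')\cap C_G(x_0)\cap C_G(y_0)$ acts trivially on $V'$. Then the following hold. 1. Adapted bases exist. If $q\ne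 3$, then for every adapted basis and every enumeration explicit pairs exist, and each of them is a starting pair. If $q=3$, then for every enumeration of $\langle e_1,e_2\rangle$ starting with $0$ there is an adapted basis for which the explicit pair is a starting pair. 2. Let $(x_0,y_0)$ be a starting pair for an adapted basis. For a monomial $g$ let $\pi(g)$ be its permutation part, so $g u_w\in K^\times u_{\pi(g)w}$ for all $w$, and let $H$ be the group of all $\pi(g)$ with $g\in C_G(x_0)\cap C_G(y_0)$ monomial. There are partitions $W=\{e_1\}\cup\{e_2\}\cup\Omega_3\cup\Omega_4$ (into disjoint, possibly empty, parts) such that only the identity of $H$ fixes every part setwise, and such that $|\Omega_3|<\frac14|W|$ if $|W|\ne 16$. For every such partition, put $x=y_0$ and $y=x_0+v$, where $$v=\sum_{w\in\Omega_4\setminus\langle e_1,e_2\rangle}u_w\quad\text{if }|W|\neq 16,\qquad v=0\,u_{e_3}+2\,u_{e_4}+\sum_{w\notin\langle e_1,e_2\rangle\cup\{e_3,e_4\}}u_w\quad\text{if }|W|=16.$$ Then $C_G(x)\cap C_G(y)=1$, that is, $\{x,y\}$ is a base of size $2$ for $G$. -/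

import Mathlib

/-- The general linear group `GL(V)`; it acts on `V` by `g • v = g v`. -/
abbrev GLin (K V : Type*) [Field K] [AddCommGroup V] [Module K V] := V ≃ₗ[K] V

section Groups

variable {K V : Type*} [Field K] [AddCommGroup V] [Module K V]

variable (K V) in
/-- The group `Z ≃ Kˣ` of all (non-zero) scalar transformations of `V`. -/
def scalarSubgroup : Subgroup (GLin K V) :=
  (DistribMulAction.toModuleAut K V : Kˣ →* GLin K V).range

/-- The centralizer `C_G(x)` of a vector `x ∈ V` in the linear group `G`. -/
def vectorCentralizer (G : Subgroup (GLin K V)) (x : V) : Subgroup (GLin K V) :=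
  G ⊓ MulAction.stabilizer (GLin K V) x

/-- `V` is an absolutely irreducible `K N`-module: the module obtained by extending the scalars
to an algebraic closure of `K` is irreducible. -/
def IsAbsolutelyIrreducible (N : Subgroup (GLin K V)) : Prop :=
  Nontrivial V ∧
    ∀ U : Submodule (AlgebraicClosure K) (TensorProduct K (AlgebraicClosure K) V),
      (∀ g ∈ N, ∀ w ∈ U, LinearMap.baseChange (AlgebraicClosure K) (g : V →ₗ[K] V) w ∈ U) →
        U = ⊥ ∨ U = ⊤

/-- `G ≤ GL(V)` is of symplectic type with respect to the prime `r` and the normal subgroups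
`Z ≤ N` of `G`, where `Z` is the group of all scalar transformations: `Z` is the centre of `G`,
the quotient `N / Z` is an elementary abelian `r`-group, and `V` is an absolutely irreducible
`K N`-module. -/
structure IsSymplecticType (r : ℕ) (G N : Subgroup (GLin K V)) : Prop where
  prime : r.Prime
  center_eq : (Subgroup.center G).map G.subtype = scalarSubgroup K V
  scalar_le : scalarSubgroup K V ≤ N
  le : N ≤ G
  normal : ∀ g ∈ G, ∀ a ∈ N, g * a * g⁻¹ ∈ N
  quotient_comm : ∀ a ∈ N, ∀ b ∈ N, a * b * a⁻¹ * b⁻¹ ∈ scalarSubgroup K V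
  quotient_pow : ∀ a ∈ N, a ^ r ∈ scalarSubgroup K V
  absIrred : IsAbsolutelyIrreducible N

/-- Extraspecial `r`-groups: `r`-groups `R` whose centre has order `r` and coincides with the
commutator subgroup, and for which `R / Z(R)` has exponent `r`. -/
structure IsExtraspecial (r : ℕ) (R : Type*) [Group R] : Prop where
  finite : Finite R
  isPGroup : IsPGroup r R
  card_center : Nat.card (Subgroup.center R) = r
  commutator_eq : commutator R = Subgroup.center R
  pow_mem_center : ∀ x : R, x ^ r ∈ Subgroup.center R

/-- `N` is the central product `R ⋆ Z` of the extraspecial `r`-group `R` and the group `Z` of all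
scalar transformations, with `R ∩ Z` of order `r`. -/
structure IsExtraspecialPart (r : ℕ) (N R : Subgroup (GLin K V)) : Prop where
  extraspecial : IsExtraspecial r R
  sup_eq : R ⊔ scalarSubgroup K V = N
  card_inf : Nat.card (R ⊓ scalarSubgroup K V : Subgroup (GLin K V)) = r

/-- `R` is a central product of `m ≥ 0` dihedral groups of order eight and one quaternion group of
order eight.  (`DihedralGroup 4` and `QuaternionGroup 2` have order eight.) -/
def IsDihedralQuaternionProduct {A : Type*} [Group A] (R : Subgroup A) : Prop :=
  ∃ (m : ℕ) (H : Fin m → Subgroup A) (Q : Subgroup A),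
    (∀ i, Nonempty (H i ≃* DihedralGroup 4)) ∧ Nonempty (Q ≃* QuaternionGroup 2) ∧
    (∀ i j, i ≠ j → ∀ a ∈ H i, ∀ b ∈ H j, a * b = b * a) ∧
    (∀ i, ∀ a ∈ H i, ∀ b ∈ Q, a * b = b * a) ∧
    (⨆ i, H i) ⊔ Q = R

/-- The group `N = R ⋆ Z` over a field with `q` elements is monomial, unless `r = 2`,
`q ≡ -1 mod 4` and `R` is a central product of dihedral groups of order eight and one quaternion
group. -/
def IsMonomialType (r q : ℕ) (R : Subgroup (GLin K V)) : Prop :=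
  ¬ (r = 2 ∧ q ≡ 3 [MOD 4] ∧ IsDihedralQuaternionProduct R)

end Groups

section Index

/-- The `𝔽₂`-vector space `W ≃ 𝔽₂ᵏ` that labels the chosen basis of `V`, in coordinates with
respect to a basis `e₁, …, e_k` of `W`. -/
abbrev WSpace (k : ℕ) := Fin k → ZMod 2

/-- The basis vector `e_j` of `W`, for `1 ≤ j ≤ k`. -/
def eVec (k j : ℕ) : WSpace k := fun i => if (i : ℕ) + 1 = j then 1 else 0

/-- The subspace `⟨e₁, e₂⟩_W`, as a finite set. -/
def plane (k : ℕ) : Finset (WSpace k) := {0, eVec k 1, eVec k 2, eVec k 1 + eVec k 2}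

/-- An enumeration `u₁, u₂, u₃, u₄` (here `τ 0, …, τ 3`) of the subspace `⟨e₁, e₂⟩_W`, with
`u₁` the zero element of `W`. -/
def IsPlaneEnumeration {k : ℕ} (τ : Fin 4 → WSpace k) : Prop :=
  τ 0 = 0 ∧ Function.Injective τ ∧ Finset.univ.image τ = plane k

/-- The subsets `Ω i` form a partition of `Ω` (empty parts are allowed) that is regular for the
permutation group `H`: only the identity of `H` fixes every part setwise. -/
def IsRegularPartition {α : Type*} [Fintype α] [DecidableEq α] {t : ℕ}
    (H : Subgroup (Equiv.Perm α)) (Ω : Fin t → Finset α) : Prop :=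
  (∀ i j, i ≠ j → Disjoint (Ω i) (Ω j)) ∧
  Finset.univ.biUnion Ω = Finset.univ ∧
  ∀ h ∈ H, (∀ i, (Ω i).image h = Ω i) → h = 1

end Index

section Frame

variable {K V : Type*} [Field K] [AddCommGroup V] [Module K V] {k : ℕ}

/-- A basis of `V` adapted to `N`.  There is a decomposition `N = D ⋊ S` with `D = Z × D₁` and
`D₁ ≃ S ≃ C₂ᵏ`; with respect to the basis, `S` consists of permutation matrices and acts regularly,
`D` consists of diagonal matrices, and the lines spanned by the basis vectors are, each exactly
once, all the irreducible representations of `D₁`, the first one being trivial.  The basis is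
labelled by `W = 𝔽₂ᵏ` in such a way that the first basis vector has label `0` and that `S` acts on
the labels by the translations of `W`. -/
def IsAdaptedBasis (N : Subgroup (GLin K V)) (u : Module.Basis (WSpace k) K V) : Prop :=
  ∃ D D₁ S : Subgroup (GLin K V),
    -- `N = D ⋊ S`
    D ≤ N ∧ (∀ a ∈ N, ∀ d ∈ D, a * d * a⁻¹ ∈ D) ∧ D ⊔ S = N ∧ D ⊓ S = ⊥ ∧
    -- `D = Z × D₁`
    scalarSubgroup K V ⊔ D₁ = D ∧ scalarSubgroup K V ⊓ D₁ = ⊥ ∧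
    -- `D₁ ≃ S ≃ C₂ᵏ`
    Nonempty (D₁ ≃* Multiplicative (WSpace k)) ∧ Nonempty (S ≃* Multiplicative (WSpace k)) ∧
    -- `S` is the group of all translations of the labels
    (∀ s ∈ S, ∃ a, ∀ w, s (u w) = u (a + w)) ∧ (∀ a, ∃ s ∈ S, ∀ w, s (u w) = u (a + w)) ∧
    -- `D` is diagonal
    (∀ d ∈ D, ∀ w, ∃ c : K, d (u w) = c • u w) ∧
    -- the basis lines afford every linear character of `D₁` exactly once
    (∀ d ∈ D₁, d (u 0) = u 0) ∧
    (∀ χ : D₁ →* Kˣ, ∃! w, ∀ d : D₁, (d : GLin K V) (u w) = χ d • u w)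

/-- The group of the permutation parts `π(g)` of those `g ∈ C` that are monomial with respect to
the basis `u`; here `g (u w) ∈ Kˣ u (π(g) w)` for all `w`. -/
def permPart {α : Type*} (u : Module.Basis α K V) (C : Subgroup (GLin K V)) :
    Subgroup (Equiv.Perm α) where
  carrier := {σ | ∃ g ∈ C, ∀ w, ∃ c : Kˣ, g (u w) = c • u (σ w)}
  one_mem' := ⟨1, C.one_mem, fun _ => ⟨1, by simp⟩⟩
  mul_mem' := by
    rintro σ ρ ⟨g, hg, hσ⟩ ⟨h, hh, hρ⟩
    refine ⟨g * h, C.mul_mem hg hh, fun w => ?_⟩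
    obtain ⟨c, hc⟩ := hρ w
    obtain ⟨d, hd⟩ := hσ (ρ w)
    refine ⟨c * d, ?_⟩
    simp only [Units.smul_def] at hc hd ⊢
    rw [LinearEquiv.mul_apply, hc, map_smul, hd, smul_smul, Equiv.Perm.mul_apply, Units.val_mul]
  inv_mem' := by
    rintro σ ⟨g, hg, hσ⟩
    refine ⟨g⁻¹, C.inv_mem hg, fun w => ?_⟩
    obtain ⟨c, hc⟩ := hσ (σ⁻¹ w)
    refine ⟨c⁻¹, ?_⟩
    have hw : σ (σ⁻¹ w) = w := by simp
    rw [hw] at hc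
    have h1 : g⁻¹ (g (u (σ⁻¹ w))) = u (σ⁻¹ w) := g.symm_apply_apply _
    simp only [Units.smul_def] at hc ⊢
    rw [hc, map_smul] at h1
    rw [← h1, smul_smul, Units.inv_mul, one_smul]

/-- The subspace `V' = ⟨u₁, u₂, u₃, u₄⟩` of `V`, where `{u₁, …, u₄} = ⟨e₁, e₂⟩_W`. -/
def planeSpan (u : Module.Basis (WSpace k) K V) : Submodule K V :=
  Submodule.span K (u '' (plane k : Set (WSpace k)))

/-- The explicit vectors `x₀, y₀` of the four-dimensional space with basis `u₁, u₂, u₃, u₄` over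
a field with `q` elements:
* `x₀ = u₁`, `y₀ = u₂ + α u₃ + α⁻¹ u₄` with `α⁸ ≠ 1`, if `q ≠ 3, 5, 9`;
* `x₀ = u₁`, `y₀ = u₁ + u₃ + u₄`, if `q = 3`;
* `x₀ = u₁ + u₂ + 2 u₃`, `y₀ = u₂ + u₃ + 2 u₄`, if `q = 5`;
* `x₀ = u₁ + u₃ + u₄`, `y₀ = u₂ + u₃ + α u₄` with `α` a generator of `Kˣ`, if `q = 9`. -/
def IsExplicitPair (K : Type*) {V : Type*} [Field K] [AddCommGroup V] [Module K V]
    (u₁ u₂ u₃ u₄ x₀ y₀ : V) : Prop :=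
  (Nat.card K ≠ 3 ∧ Nat.card K ≠ 5 ∧ Nat.card K ≠ 9 ∧
    ∃ α : Kˣ, α ^ 8 ≠ 1 ∧ x₀ = u₁ ∧ y₀ = u₂ + α • u₃ + α⁻¹ • u₄) ∨
  (Nat.card K = 3 ∧ x₀ = u₁ ∧ y₀ = u₁ + u₃ + u₄) ∨
  (Nat.card K = 5 ∧ x₀ = u₁ + u₂ + (2 : K) • u₃ ∧ y₀ = u₂ + u₃ + (2 : K) • u₄) ∨
  (Nat.card K = 9 ∧ ∃ α : Kˣ, Subgroup.zpowers α = ⊤ ∧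
    x₀ = u₁ + u₃ + u₄ ∧ y₀ = u₂ + u₃ + α • u₄)

/-- The pairs `x₀, y₀ ∈ V'` from which a base is built: `y₀` is a linear combination of exactly
three basis vectors with non-zero coefficients, and `N_G(V') ∩ C_G(x₀) ∩ C_G(y₀)` acts trivially
on `V'`. -/
structure IsStartingPair (G : Subgroup (GLin K V)) (u : Module.Basis (WSpace k) K V) (x₀ y₀ : V) :
    Prop where
  left_mem : x₀ ∈ planeSpan u
  right_mem : y₀ ∈ planeSpan u
  card_support : (u.repr y₀).support.card = 3
  trivial_on : ∀ g ∈ vectorCentralizer G x₀ ⊓ vectorCentralizer G y₀,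
    (planeSpan u).map (g : V →ₗ[K] V) = planeSpan u → ∀ w ∈ planeSpan u, g w = w

/-- `W = {e₁} ∪ {e₂} ∪ Ω₃ ∪ Ω₄` is a `π(C_G(x₀) ∩ C_G(y₀))`-regular partition of `W`, with
`|Ω₃| < |W| / 4` if `|W| ≠ 16`. -/
def IsBasePartition (G : Subgroup (GLin K V)) (u : Module.Basis (WSpace k) K V) (x₀ y₀ : V)
    (Ω₃ Ω₄ : Finset (WSpace k)) : Prop :=
  IsRegularPartition (permPart u (vectorCentralizer G x₀ ⊓ vectorCentralizer G y₀))
      ![{eVec k 1}, {eVec k 2}, Ω₃, Ω₄] ∧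
    (2 ^ k ≠ 16 → 4 * Ω₃.card < 2 ^ k)

/-- The vector `v`, which is the sum of the basis vectors in `Ω₄ \ ⟨e₁, e₂⟩_W` if `|W| ≠ 16`; if
`|W| = 16`, it is `0 e₃ + 2 e₄` plus the sum of all basis vectors outside `⟨e₁, e₂⟩_W` that
are different from `e₃, e₄`. -/
noncomputable def baseTail (u : Module.Basis (WSpace k) K V) (Ω₄ : Finset (WSpace k)) : V :=
  if 2 ^ k ≠ 16 then ∑ w ∈ Ω₄ \ plane k, u w
  else (0 : K) • u (eVec k 3) + (2 : K) • u (eVec k 4) +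
    ∑ w ∈ (Finset.univ \ plane k) \ {eVec k 3, eVec k 4}, u w

end Frame

/-! In an adapted basis `N` is exactly the group of Pauli transformations u_w ↦ l(-1)^(b·w) u_(a+w),
and a basis with this property is adapted (`IsAdaptedBasis.isPauliBasis`,
`IsPauliBasis.isAdaptedBasis`). Since `G` normalizes `N`, conjugation by an element of `G` sends
Pauli transformations to Pauli transformations, and this controls everything.

Existence. Commutators in `N` are ±1, so `N` modulo scalars is a symplectic space over 𝔽₂.
Hyperbolic pairs of commuting involutions are split off one at a time. A system of rank k acts on
the orbit of a common fixed vector as the Pauli group does. If the process stops earlier,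
irreducibility leaves a non-scalar element centralizing the system; then -1 is not a square and `R`
is a product of dihedral groups and one quaternion group, the excluded case
(`IsHyperbolic.isDihedralQuaternionProduct`).

Base. Let g in `G` fix y₀, which has three coordinates, all in V'. The diagonal Pauli
transformations that are trivial on V' fix y₀, so their conjugates under g do too, and by parity
these are again diagonal and trivial on V'. Hence g preserves V' and the span of the remaining basis
vectors, and if g also fixes x₀ + v then it fixes x₀ and v separately. The starting pair makes g
trivial on V'. In particular g fixes u_0, so it permutes the eigenlines of the diagonal group: g is
monomial, with additive permutation part and coefficients that are multiplicative up to signs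
(`exists_isMonomial`). Fixing v and the regularity of the partition kill the permutation, and a
counting argument (`IsMonomial.coeff_eq_one`) kills the coefficients.

Starting pairs. For generic q, fourth powers of coordinates distinguish the basis vectors, because
coefficients of g are fourth roots of unity. For q = 5, 9 the pair x₀, y₀ and its images under one
sign change T span V', so g is determined on V' by the conjugate of T, and a finite computation
leaves only T itself. For q = 3 the obstructions are a sign twist and a swap; if they persist in two
related bases, then a product of such elements of `G` has a vector with an orbit of length three,
against 3 ∤ |G|. -/

namespace Pauli

/-! ### Pauli transformations and adapted bases. -/

variable {K V : Type*} [Field K] [AddCommGroup V] [Module K V] {k : ℕ}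

lemma zmod_two_cases (c : ZMod 2) : c = 0 ∨ c = 1 := by
  revert c; decide

/-- The sign `(-1)^c` as a unit of `K`. -/
def sgn (K : Type*) [Field K] (c : ZMod 2) : Kˣ := (-1) ^ c.val

@[simp] lemma sgn_zero : sgn K 0 = 1 := by simp [sgn]

@[simp] lemma sgn_one : sgn K 1 = -1 := by simp [sgn, ZMod.val_one]

lemma sgn_add (a b : ZMod 2) : sgn K (a + b) = sgn K a * sgn K b := by
  have h : (1 + 1 : ZMod 2) = 0 := by decide
  rcases zmod_two_cases a with rfl | rfl <;> rcases zmod_two_cases b with rfl | rfl <;> simp [h]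

@[simp] lemma sgn_mul_self (a : ZMod 2) : sgn K a * sgn K a = 1 := by
  rcases zmod_two_cases a with rfl | rfl <;> simp

@[simp] lemma sgn_inv (a : ZMod 2) : (sgn K a)⁻¹ = sgn K a :=
  inv_eq_of_mul_eq_one_left (sgn_mul_self a)

lemma neg_one_ne_one (h2 : (2 : K) ≠ 0) : (-1 : Kˣ) ≠ 1 := by
  intro h
  have h' : (-1 : K) = 1 := by simpa using congrArg Units.val h
  apply h2
  linear_combination -h'

lemma sgn_eq_one_iff (h2 : (2 : K) ≠ 0) (a : ZMod 2) : sgn K a = 1 ↔ a = 0 := by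
  rcases zmod_two_cases a with rfl | rfl
  · simp
  · simp [neg_one_ne_one h2]

lemma sgn_injective (h2 : (2 : K) ≠ 0) : Function.Injective (sgn K) := by
  intro a b h
  have h0 : sgn K (a + b) = 1 := by rw [sgn_add, h, sgn_mul_self]
  rw [sgn_eq_one_iff h2] at h0
  exact CharTwo.add_eq_zero.1 h0

lemma add_self_eq_zero (a : WSpace k) : a + a = 0 := by
  funext i; exact CharTwo.add_self_eq_zero _

lemma add_add_cancel (a w : WSpace k) : a + (a + w) = w := by
  rw [← add_assoc, add_self_eq_zero, zero_add]

lemma eq_add_iff (a b c : WSpace k) : a = b + c ↔ b + a = c := by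
  constructor
  · rintro rfl; exact add_add_cancel _ _
  · rintro rfl; exact (add_add_cancel _ _).symm

lemma dot_injective {b b' : WSpace k} (h : ∀ w, b ⬝ᵥ w = b' ⬝ᵥ w) : b = b' := by
  funext i
  simpa using h (Pi.single i 1)

/-- `WSpace k` has exponent two, so χ takes only the values ±1, and it is determined by its values
on the standard basis. -/
lemma exists_sgn_dot (χ : WSpace k → Kˣ) (hχ : ∀ a w, χ (a + w) = χ a * χ w) :
    ∃ b : WSpace k, ∀ w, χ w = sgn K (b ⬝ᵥ w) := by
  classical
  have h0 : χ 0 = 1 := by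
    have := hχ 0 0
    rw [add_zero] at this
    exact (mul_eq_left (a := χ 0)).1 this.symm
  have hpm : ∀ w, χ w = 1 ∨ χ w = -1 := by
    intro w
    have h : χ w * χ w = 1 := by rw [← hχ, add_self_eq_zero, h0]
    have h' : (χ w : K) * χ w = 1 := by simpa using congrArg Units.val h
    rcases mul_self_eq_one_iff.1 h' with h1 | h1
    · left; ext; simpa using h1
    · right; ext; simpa using h1
  let b : WSpace k := fun i => if χ (Pi.single i 1) = 1 then 0 else 1
  refine ⟨b, ?_⟩
  let f : WSpace k →+ Additive Kˣ :=
    { toFun := fun w => Additive.ofMul (χ w)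
      map_zero' := by rw [h0]; rfl
      map_add' := fun x y => by rw [hχ]; rfl }
  let g : WSpace k →+ Additive Kˣ :=
    { toFun := fun w => Additive.ofMul (sgn K (b ⬝ᵥ w))
      map_zero' := by simp
      map_add' := fun x y => by rw [dotProduct_add, sgn_add]; rfl }
  have hfg : f = g := by
    refine AddMonoidHom.functions_ext _ f g fun i c => ?_
    rcases zmod_two_cases c with rfl | rfl
    · simp
    · change Additive.ofMul (χ _) = Additive.ofMul (sgn K (b ⬝ᵥ _))
      congr 1
      rw [dotProduct_single_one]
      by_cases h : χ (Pi.single i 1) = 1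
      · simp [b, h]
      · simpa [b, h] using (hpm (Pi.single i 1)).resolve_left h
  intro w
  exact Additive.ofMul.injective (DFunLike.congr_fun hfg w)

lemma exists_dot_ne {w w' : WSpace k} (h : w ≠ w') : ∃ b : WSpace k, b ⬝ᵥ w ≠ b ⬝ᵥ w' := by
  by_contra! hb
  exact h (dot_injective fun x => by rw [dotProduct_comm, hb, dotProduct_comm])

/-- Orthogonality of characters: translation by a vector c with b·c = 1 pairs each term with its
negative. -/
lemma sum_sgn_dot (b : WSpace k) (hb : b ≠ 0) : ∑ a : WSpace k, (sgn K (b ⬝ᵥ a) : K) = 0 := by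
  obtain ⟨c, hc⟩ := exists_dot_ne hb
  have h1 : b ⬝ᵥ c = 1 := by
    rw [dotProduct_comm b c]
    rw [dotProduct_zero] at hc
    exact (zmod_two_cases _).resolve_left hc
  refine Finset.sum_involution (fun a _ => c + a) (fun a _ => ?_) (fun a _ _ h => ?_)
    (fun _ _ => Finset.mem_univ _) (fun a _ => add_add_cancel c a)
  · rw [dotProduct_add, sgn_add, h1]; simp
  · have : c = 0 := by simpa using h
    rw [this, dotProduct_zero] at h1
    exact zero_ne_one h1

/-- The scalar transformation given by a unit. -/
abbrev scal (K V : Type*) [Field K] [AddCommGroup V] [Module K V] : Kˣ →* GLin K V :=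
  DistribMulAction.toModuleAut K V

lemma scal_apply (l : Kˣ) (v : V) : scal K V l v = l • v := rfl

lemma scal_comm (l : Kˣ) (g : GLin K V) : scal K V l * g = g * scal K V l := by
  ext v
  simp only [LinearEquiv.mul_apply, scal_apply, Units.smul_def, map_smul]

lemma scal_injective [Nontrivial V] : Function.Injective (scal K V) := by
  intro a b h
  obtain ⟨v, hv⟩ := exists_ne (0 : V)
  have := congrArg (fun g : GLin K V => g v) h
  simp only [scal_apply, Units.smul_def] at this
  exact Units.ext (smul_left_injective K hv this)

/-- The Pauli transformation `u_w ↦ l (-1)^(b·w) u_{a+w}`. -/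
noncomputable def pauli (u : Module.Basis (WSpace k) K V) (l : Kˣ) (a b : WSpace k) : GLin K V :=
  -- The sign is attached to the target vector, whose label is a + w; evaluating it at a + (a + w) =
  -- w gives (-1)^(b·w).
  scal K V l * u.equiv (u.unitsSMul fun w => sgn K (b ⬝ᵥ (a + w))) (Equiv.addLeft a)

lemma pauli_apply (u : Module.Basis (WSpace k) K V) (l : Kˣ) (a b w : WSpace k) :
    pauli u l a b (u w) = (l * sgn K (b ⬝ᵥ w)) • u (a + w) := by
  rw [pauli, LinearEquiv.mul_apply, Module.Basis.equiv_apply, Module.Basis.unitsSMul_apply,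
    scal_apply, Equiv.coe_addLeft, add_add_cancel, smul_smul]

lemma basis_ext (u : Module.Basis (WSpace k) K V) {g h : GLin K V}
    (H : ∀ w, g (u w) = h (u w)) : g = h := by
  have := u.ext' H
  exact this

lemma pauli_mul (u : Module.Basis (WSpace k) K V) (l l' : Kˣ) (a b a' b' : WSpace k) :
    pauli u l a b * pauli u l' a' b' =
      pauli u (l * l' * sgn K (b ⬝ᵥ a')) (a + a') (b + b') := by
  apply basis_ext u
  intro w
  rw [LinearEquiv.mul_apply, pauli_apply, pauli_apply, Units.smul_def, map_smul, pauli_apply,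
    ← Units.smul_def, smul_smul, dotProduct_add, sgn_add, add_dotProduct, sgn_add, add_assoc]
  congr 1
  ext
  push_cast
  ring

lemma pauli_one (u : Module.Basis (WSpace k) K V) : pauli u 1 0 0 = 1 := by
  apply basis_ext u
  intro w
  simp [pauli_apply]

lemma pauli_scal (u : Module.Basis (WSpace k) K V) (l : Kˣ) : pauli u l 0 0 = scal K V l := by
  apply basis_ext u
  intro w
  simp [pauli_apply]

lemma pauli_inj (h2 : (2 : K) ≠ 0) (u : Module.Basis (WSpace k) K V) {l l' : Kˣ}
    {a b a' b' : WSpace k} (h : pauli u l a b = pauli u l' a' b') : l = l' ∧ a = a' ∧ b = b' := by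
  have key : ∀ w, (l * sgn K (b ⬝ᵥ w)) • u (a + w) = (l' * sgn K (b' ⬝ᵥ w)) • u (a' + w) := by
    intro w; rw [← pauli_apply, h, pauli_apply]
  have ha : a = a' := by
    have h0 := congrArg (fun v => u.repr v (a + 0)) (key 0)
    by_contra hne
    simp only [Units.smul_def, map_smul, Module.Basis.repr_self, Finsupp.smul_apply, add_zero,
      Finsupp.single_eq_same, Finsupp.single_apply, Ne.symm hne, if_false] at h0
    simp at h0
  subst ha
  have hl : ∀ w, l * sgn K (b ⬝ᵥ w) = l' * sgn K (b' ⬝ᵥ w) := by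
    intro w
    have := key w
    simp only [Units.smul_def] at this
    exact Units.ext (smul_left_injective K (u.ne_zero _) this)
  have h0 : l = l' := by simpa using hl 0
  subst h0
  exact ⟨rfl, rfl, dot_injective fun w => sgn_injective h2 (mul_left_cancel (hl w))⟩

lemma pauli_inv (u : Module.Basis (WSpace k) K V) (l : Kˣ) (a b : WSpace k) :
    (pauli u l a b)⁻¹ = pauli u (l⁻¹ * sgn K (b ⬝ᵥ a)) a b := by
  rw [inv_eq_iff_mul_eq_one, pauli_mul, add_self_eq_zero, add_self_eq_zero, ← pauli_one u,
    ← mul_assoc, mul_inv_cancel, one_mul, sgn_mul_self]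

/-- The group of all Pauli transformations. -/
def pauliGroup (u : Module.Basis (WSpace k) K V) : Subgroup (GLin K V) where
  carrier := {g | ∃ l a b, g = pauli u l a b}
  one_mem' := ⟨1, 0, 0, (pauli_one u).symm⟩
  mul_mem' := by
    rintro _ _ ⟨l, a, b, rfl⟩ ⟨l', a', b', rfl⟩
    exact ⟨_, _, _, pauli_mul ..⟩
  inv_mem' := by
    rintro _ ⟨l, a, b, rfl⟩
    exact ⟨_, _, _, pauli_inv ..⟩

/-- The group of all diagonal Pauli transformations. -/
def diagGroup (u : Module.Basis (WSpace k) K V) : Subgroup (GLin K V) where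
  carrier := {g | ∃ l b, g = pauli u l 0 b}
  one_mem' := ⟨1, 0, (pauli_one u).symm⟩
  mul_mem' := by
    rintro _ _ ⟨l, b, rfl⟩ ⟨l', b', rfl⟩
    exact ⟨_, _, by rw [pauli_mul, add_zero]⟩
  inv_mem' := by
    rintro _ ⟨l, b, rfl⟩
    exact ⟨_, _, pauli_inv ..⟩

/-- `N` consists exactly of the Pauli transformations with respect to the basis `u`. -/
def IsPauliBasis (N : Subgroup (GLin K V)) (u : Module.Basis (WSpace k) K V) : Prop :=
  ∀ g, g ∈ N ↔ ∃ l a b, g = pauli u l a b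

/-- The diagonal Pauli transformations with first entry one. -/
noncomputable def diagHom (u : Module.Basis (WSpace k) K V) :
    Multiplicative (WSpace k) →* GLin K V where
  toFun b := pauli u 1 0 b.toAdd
  map_one' := pauli_one u
  map_mul' x y := by rw [pauli_mul]; simp

/-- The permutation matrices of the translations. -/
noncomputable def shiftHom (u : Module.Basis (WSpace k) K V) :
    Multiplicative (WSpace k) →* GLin K V where
  toFun a := pauli u 1 a.toAdd 0
  map_one' := pauli_one u
  map_mul' x y := by rw [pauli_mul]; simp

lemma diagHom_injective (h2 : (2 : K) ≠ 0) (u : Module.Basis (WSpace k) K V) :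
    Function.Injective (diagHom u) := fun _ _ h =>
  Multiplicative.toAdd.injective (pauli_inj h2 u h).2.2

lemma shiftHom_injective (h2 : (2 : K) ≠ 0) (u : Module.Basis (WSpace k) K V) :
    Function.Injective (shiftHom u) := fun _ _ h =>
  Multiplicative.toAdd.injective (pauli_inj h2 u h).2.1

/-- `D` consists of the diagonal Pauli transformations, `D₁` of those fixing u_0, `S` of the
translations. Characters of `D₁` have the form b ↦ (-1)^(b·w), with w unique by nondegeneracy of the
dot product. -/
lemma IsPauliBasis.isAdaptedBasis (h2 : (2 : K) ≠ 0) {N : Subgroup (GLin K V)}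
    {u : Module.Basis (WSpace k) K V} (hu : IsPauliBasis N u) : IsAdaptedBasis N u := by
  have hcomm : ∀ l c : Kˣ, ∀ a b d : WSpace k,
      pauli u l a b * pauli u c 0 d = pauli u (c * sgn K (d ⬝ᵥ a)) 0 d * pauli u l a b := by
    intro l c a b d
    rw [pauli_mul, pauli_mul]
    congr 1
    · rw [dotProduct_zero, sgn_zero, mul_one, mul_assoc c, mul_comm (sgn K _) l,
        mul_assoc, mul_assoc, sgn_mul_self, mul_one, mul_comm]
    · rw [add_zero, zero_add]
    · exact add_comm _ _
  have hmemD : ∀ g, g ∈ scalarSubgroup K V ⊔ (diagHom u).range ↔ ∃ l b, g = pauli u l 0 b := by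
    intro g
    constructor
    · intro hg
      have hle : scalarSubgroup K V ⊔ (diagHom u).range ≤ diagGroup u := by
        refine sup_le ?_ ?_
        · rintro _ ⟨l, rfl⟩
          exact ⟨l, 0, (pauli_scal u l).symm⟩
        · rintro _ ⟨b, rfl⟩
          exact ⟨1, b.toAdd, rfl⟩
      exact hle hg
    · rintro ⟨l, b, rfl⟩
      have : pauli u l 0 b = scal K V l * diagHom u (Multiplicative.ofAdd b) := by
        rw [← pauli_scal u]
        change _ = _ * pauli u 1 0 b
        rw [pauli_mul]; simp
      rw [this]
      exact Subgroup.mul_mem_sup ⟨l, rfl⟩ ⟨_, rfl⟩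
  refine ⟨scalarSubgroup K V ⊔ (diagHom u).range, (diagHom u).range, (shiftHom u).range,
    ?_, ?_, ?_, ?_, rfl, ?_, ?_, ?_, ?_, ?_, ?_, ?_, ?_⟩
  · intro g hg
    obtain ⟨l, b, rfl⟩ := (hmemD g).1 hg
    exact (hu _).2 ⟨_, _, _, rfl⟩
  · intro a ha d hd
    obtain ⟨l, c, b, rfl⟩ := (hu a).1 ha
    obtain ⟨l', b', rfl⟩ := (hmemD d).1 hd
    rw [hcomm, mul_assoc, mul_inv_cancel, mul_one]
    exact (hmemD _).2 ⟨_, _, rfl⟩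
  · apply le_antisymm
    · apply sup_le
      · intro g hg
        obtain ⟨l, b, rfl⟩ := (hmemD g).1 hg
        exact (hu _).2 ⟨_, _, _, rfl⟩
      · rintro _ ⟨a, rfl⟩
        exact (hu _).2 ⟨_, _, _, rfl⟩
    · intro g hg
      obtain ⟨l, a, b, rfl⟩ := (hu g).1 hg
      have : pauli u l a b = pauli u (l * sgn K (b ⬝ᵥ a)) 0 b * pauli u 1 a 0 := by
        rw [pauli_mul, mul_one, mul_assoc, sgn_mul_self, mul_one, zero_add, add_zero]
      rw [this]
      exact Subgroup.mul_mem_sup ((hmemD _).2 ⟨_, _, rfl⟩) ⟨Multiplicative.ofAdd a, rfl⟩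
  · rw [eq_bot_iff]
    rintro g ⟨hg, ⟨a, rfl⟩⟩
    obtain ⟨l, b, h⟩ := (hmemD _).1 hg
    obtain ⟨-, h', -⟩ := pauli_inj h2 u (show pauli u 1 a.toAdd 0 = _ from h)
    have : a = 1 := Multiplicative.toAdd.injective h'
    rw [this, map_one]
    exact Subgroup.mem_bot.2 rfl
  · rw [eq_bot_iff]
    rintro g ⟨⟨l, rfl⟩, ⟨b, h⟩⟩
    obtain ⟨h', -, -⟩ := pauli_inj h2 u
      (show pauli u 1 0 b.toAdd = pauli u l 0 0 from h.trans (pauli_scal u l).symm)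
    rw [← h', map_one]
    exact Subgroup.mem_bot.2 rfl
  · exact ⟨((diagHom u).ofInjective (diagHom_injective h2 u)).symm⟩
  · exact ⟨((shiftHom u).ofInjective (shiftHom_injective h2 u)).symm⟩
  · rintro _ ⟨a, rfl⟩
    refine ⟨a.toAdd, fun w => ?_⟩
    change pauli u 1 a.toAdd 0 (u w) = _
    simp [pauli_apply]
  · intro a
    refine ⟨_, ⟨Multiplicative.ofAdd a, rfl⟩, fun w => ?_⟩
    change pauli u 1 a 0 (u w) = _
    simp [pauli_apply]
  · intro d hd w
    obtain ⟨l, b, rfl⟩ := (hmemD d).1 hd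
    exact ⟨(l * sgn K (b ⬝ᵥ w) : Kˣ), by rw [pauli_apply, zero_add]; rfl⟩
  · rintro _ ⟨b, rfl⟩
    change pauli u 1 0 b.toAdd (u 0) = _
    simp [pauli_apply]
  · intro χ
    have hr : ∀ b : WSpace k, diagHom u (Multiplicative.ofAdd b) ∈ (diagHom u).range :=
      fun b => ⟨_, rfl⟩
    obtain ⟨w, hw⟩ := exists_sgn_dot (fun b => χ ⟨diagHom u (Multiplicative.ofAdd b), hr b⟩)
      (fun a b => by
        rw [← map_mul]
        congr 1
        ext1
        simp)
    have happ : ∀ b v : WSpace k, diagHom u (Multiplicative.ofAdd b) (u v) =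
        sgn K (b ⬝ᵥ v) • u v := by
      intro b v
      change pauli u 1 0 b (u v) = _
      rw [pauli_apply, one_mul, zero_add]
    refine ⟨w, ?_, ?_⟩
    · rintro ⟨_, ⟨b, rfl⟩⟩
      have := hw b.toAdd
      simp only [ofAdd_toAdd] at this
      rw [this]
      change diagHom u (Multiplicative.ofAdd b.toAdd) (u w) = _
      rw [happ, dotProduct_comm]
    · intro v hv
      refine dot_injective fun b => ?_
      have h1 := hv ⟨_, hr b⟩
      rw [hw b] at h1
      change diagHom u (Multiplicative.ofAdd b) (u v) = _ at h1
      rw [happ] at h1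
      simp only [Units.smul_def] at h1
      have h3 := sgn_injective h2 (Units.ext (smul_left_injective K (u.ne_zero _) h1))
      rw [dotProduct_comm v, h3]

/-- The point is that the diagonal entries of an element of `D₁` form a character of the label
space, because its commutators with translations are scalar. -/
lemma IsAdaptedBasis.isPauliBasis {N : Subgroup (GLin K V)}
    (hZ : scalarSubgroup K V ≤ N)
    (hN : ∀ a ∈ N, ∀ b ∈ N, a * b * a⁻¹ * b⁻¹ ∈ scalarSubgroup K V)
    {u : Module.Basis (WSpace k) K V} (hu : IsAdaptedBasis N u) : IsPauliBasis N u := by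
  obtain ⟨D, D₁, S, hDN, hDn, hDS, -, hZD, -, ⟨eD⟩, -, hS, hS', hdiag, hfix, -⟩ := hu
  have hD₁D : D₁ ≤ D := hZD ▸ le_sup_right
  have hSN : S ≤ N := hDS ▸ le_sup_right
  have hSpauli : ∀ s ∈ S, ∃ a, s = pauli u 1 a 0 := by
    intro s hs
    obtain ⟨a, ha⟩ := hS s hs
    exact ⟨a, basis_ext u fun w => by simp [ha, pauli_apply]⟩
  have hDpauli : ∀ d ∈ D₁, ∃ b, d = pauli u 1 0 b := by
    intro d hd
    choose c hc using hdiag d (hD₁D hd)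
    have hc0 : ∀ w, c w ≠ 0 := by
      intro w h
      have h1 := hc w
      rw [h, zero_smul] at h1
      exact u.ne_zero w (d.map_eq_zero_iff.1 h1)
    have hone : c 0 = 1 := by
      have h1 := hc 0
      rw [hfix d hd] at h1
      exact (smul_left_injective K (u.ne_zero 0) (by simpa using h1.symm))
    -- Commuting d past a translation multiplies all entries by the same scalar l; comparison at the
    -- label 0, where the entry is 1, determines l.
    have hmul : ∀ a w, c (a + w) = c a * c w := by
      intro a
      obtain ⟨s, hs, hsu⟩ := hS' a
      obtain ⟨l, hl⟩ := hN s (hSN hs) d (hDN (hD₁D hd))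
      have h1 : s * d = scal K V l * (d * s) := by
        rw [show scal K V l = s * d * s⁻¹ * d⁻¹ from hl]; group
      have h3 : ∀ w, c w = l * c (a + w) := by
        intro w
        have h4 := congrArg (fun g : GLin K V => g (u w)) h1
        simp only [LinearEquiv.mul_apply, hc, hsu, map_smul, scal_apply, Units.smul_def,
          smul_smul] at h4
        rw [mul_comm (c (a + w))] at h4
        exact smul_left_injective K (u.ne_zero _) h4
      intro w
      have h5 := h3 0
      rw [hone, add_zero] at h5
      rw [h3 w, ← mul_assoc, mul_comm (c a), ← h5, one_mul]
    obtain ⟨b, hb⟩ := exists_sgn_dot (fun w => Units.mk0 (c w) (hc0 w))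
      (fun a w => Units.ext (by simp [hmul]))
    refine ⟨b, basis_ext u fun w => ?_⟩
    rw [hc, pauli_apply, one_mul, zero_add, ← hb]
    rfl
  -- Sending d to its sign vector b is injective on `D₁`, and both sides have 2^k elements, so every
  -- b occurs.
  have hall : ∀ b, pauli u 1 0 b ∈ D₁ := by
    choose β hβ using hDpauli
    let f : D₁ → WSpace k := fun d => β d.1 d.2
    have hf : Function.Injective f := by
      intro d d' h
      ext1
      rw [hβ d.1 d.2, hβ d'.1 d'.2]
      exact congrArg _ h
    have hfin : Finite D₁ := Finite.of_equiv _ eD.symm.toEquiv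
    have hcard : Nat.card D₁ = Nat.card (WSpace k) := Nat.card_congr eD.toEquiv
    have hsurj : Function.Surjective f :=
      (Nat.bijective_iff_injective_and_card f).2 ⟨hf, hcard⟩ |>.2
    intro b
    obtain ⟨d, hd⟩ := hsurj b
    rw [← hd, ← hβ d.1 d.2]
    exact d.2
  intro g
  constructor
  · intro hg
    have hle : N ≤ pauliGroup u := by
      rw [← hDS, ← hZD]
      refine sup_le (sup_le ?_ ?_) ?_
      · rintro _ ⟨l, rfl⟩
        exact ⟨l, 0, 0, (pauli_scal u l).symm⟩
      · intro x hx
        obtain ⟨b, rfl⟩ := hDpauli x hx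
        exact ⟨1, 0, b, rfl⟩
      · intro x hx
        obtain ⟨a, rfl⟩ := hSpauli x hx
        exact ⟨1, a, 0, rfl⟩
    exact hle hg
  · rintro ⟨l, a, b, rfl⟩
    have hs : pauli u 1 a 0 ∈ N := by
      obtain ⟨s, hs, hsu⟩ := hS' a
      have : pauli u 1 a 0 = s := basis_ext u fun w => by simp [hsu, pauli_apply]
      rw [this]
      exact hSN hs
    have h1 : pauli u l a b = scal K V (l * sgn K (b ⬝ᵥ a)) * pauli u 1 0 b * pauli u 1 a 0 := by
      rw [← pauli_scal u, pauli_mul, pauli_mul]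
      simp [mul_assoc]
    rw [h1]
    exact N.mul_mem (N.mul_mem (hZ ⟨_, rfl⟩) (hDN (hD₁D (hall b)))) hs

end Pauli

/-! ### The plane of labels and the subspaces it defines. -/

namespace Pauli

variable {K V : Type*} [Field K] [AddCommGroup V] [Module K V] {k : ℕ}

section Index

lemma eVec_succ (i : Fin k) : eVec k (i + 1) = Pi.single i 1 := by
  funext j
  simp [eVec, Pi.single_apply, Fin.ext_iff]

lemma exists_fin_succ {j : ℕ} (h1 : 1 ≤ j) (hj : j ≤ k) : ∃ i : Fin k, (i : ℕ) + 1 = j :=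
  ⟨⟨j - 1, by omega⟩, by simp; omega⟩

lemma eVec_dot {i : ℕ} (h1 : 1 ≤ i) (hi : i ≤ k) (j : ℕ) :
    eVec k i ⬝ᵥ eVec k j = if i = j then 1 else 0 := by
  obtain ⟨n, rfl⟩ := exists_fin_succ h1 hi
  rw [eVec_succ, single_one_dotProduct, eVec]

lemma eVec_ne_zero {i : ℕ} (h1 : 1 ≤ i) (hi : i ≤ k) : eVec k i ≠ 0 := by
  intro h
  have := eVec_dot h1 hi i
  rw [h] at this
  simp at this

lemma eVec_injective {i j : ℕ} (h1 : 1 ≤ i) (hi : i ≤ k) (h : eVec k i = eVec k j) : i = j := by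
  by_contra hne
  have h3 := eVec_dot h1 hi j
  rw [← h, eVec_dot h1 hi i] at h3
  simp [hne] at h3

lemma mem_plane_iff (hk : 2 ≤ k) (w : WSpace k) :
    w ∈ plane k ↔ ∀ i : Fin k, 2 ≤ (i : ℕ) → w i = 0 := by
  constructor
  · intro hw i hi
    have h1 : eVec k 1 i = 0 := by simp [eVec]; omega
    have h2 : eVec k 2 i = 0 := by simp [eVec]; omega
    simp only [plane, Finset.mem_insert, Finset.mem_singleton] at hw
    rcases hw with rfl | rfl | rfl | rfl <;> simp [h1, h2]
  · intro h
    have key : w = (if w ⟨0, by omega⟩ = 0 then 0 else eVec k 1) +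
        (if w ⟨1, by omega⟩ = 0 then 0 else eVec k 2) := by
      funext i
      by_cases hi : 2 ≤ (i : ℕ)
      · rw [h i hi]
        have h1 : eVec k 1 i = 0 := by simp [eVec]; omega
        have h2 : eVec k 2 i = 0 := by simp [eVec]; omega
        split_ifs <;> simp [h1, h2]
      · have h01 : i = ⟨0, by omega⟩ ∨ i = ⟨1, by omega⟩ := by
          simp only [Fin.ext_iff]; omega
        have hone : (1 : ZMod 2) ≠ 0 := one_ne_zero
        rcases h01 with hi' | hi'
        · have hw := zmod_two_cases (w i)
          rw [← hi', Pi.add_apply]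
          split_ifs with h1 h2 h2 <;> simp_all [eVec]
        · have hw := zmod_two_cases (w i)
          rw [← hi', Pi.add_apply]
          split_ifs with h1 h2 h2 <;> simp_all [eVec]
    rw [key]
    simp only [plane, Finset.mem_insert, Finset.mem_singleton]
    split_ifs <;> simp

lemma zero_mem_plane : (0 : WSpace k) ∈ plane k := by simp [plane]

lemma eVec_one_mem_plane : eVec k 1 ∈ plane k := by simp [plane]

lemma eVec_two_mem_plane : eVec k 2 ∈ plane k := by simp [plane]

lemma add_mem_plane (hk : 2 ≤ k) {a w : WSpace k} (ha : a ∈ plane k) (hw : w ∈ plane k) :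
    a + w ∈ plane k := by
  rw [mem_plane_iff hk] at *
  intro i hi
  simp [ha i hi, hw i hi]

lemma eVec_one_ne_two (hk : 2 ≤ k) : eVec k 1 ≠ eVec k 2 := fun h => by
  simpa using eVec_injective (by omega) (by omega) h

lemma card_plane (hk : 2 ≤ k) : (plane k).card = 4 := by
  have h1 : eVec k 1 ≠ 0 := eVec_ne_zero (by omega) (by omega)
  have h2 : eVec k 2 ≠ 0 := eVec_ne_zero (by omega) (by omega)
  have h12 := eVec_one_ne_two hk
  have h3 : eVec k 1 + eVec k 2 ≠ 0 := fun h => h12 (by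
    rw [eq_comm, eq_add_iff, add_zero] at h
    exact h)
  rw [plane, Finset.card_insert_of_notMem, Finset.card_insert_of_notMem,
    Finset.card_insert_of_notMem, Finset.card_singleton]
  · simpa using h1
  · simp [h12, h2]
  · simp [h1.symm, h2.symm, h3.symm]

lemma exists_dot_of_notMem_plane (hk : 2 ≤ k) {w : WSpace k} (hw : w ∉ plane k) :
    ∃ b : WSpace k, b ⬝ᵥ w = 1 ∧ ∀ x ∈ plane k, b ⬝ᵥ x = 0 := by
  rw [mem_plane_iff hk] at hw
  push Not at hw
  obtain ⟨i, hi, hwi⟩ := hw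
  refine ⟨Pi.single i 1, ?_, fun x hx => ?_⟩
  · rw [single_one_dotProduct]
    exact (zmod_two_cases _).resolve_left hwi
  · rw [single_one_dotProduct]
    exact (mem_plane_iff hk x).1 hx i hi

/-- A non-zero translation is an involution without fixed points, so any set it preserves has even
cardinality. -/
lemma eq_zero_of_add_invariant {s : Finset (WSpace k)} (hs : Odd s.card) {a : WSpace k}
    (h : ∀ w ∈ s, a + w ∈ s) : a = 0 := by
  by_contra ha
  have h0 : ∑ w ∈ s, (1 : ZMod 2) = 0 :=
    Finset.sum_involution (fun w _ => a + w) (fun _ _ => by decide)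
      (fun w _ _ hw => ha (by simpa using hw)) (fun w hw => h w hw)
      (fun w _ => add_add_cancel a w)
  rw [Finset.sum_const, nsmul_one, ZMod.natCast_eq_zero_iff] at h0
  exact (Nat.not_even_iff_odd.2 hs) (even_iff_two_dvd.2 h0)

end Index

lemma mem_planeSpan_iff (u : Module.Basis (WSpace k) K V) (v : V) :
    v ∈ planeSpan u ↔ ∀ w, w ∉ plane k → u.repr v w = 0 := by
  rw [planeSpan, Module.Basis.mem_span_image]
  constructor
  · intro h w hw
    by_contra h'
    exact hw (h (Finsupp.mem_support_iff.2 h'))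
  · intro h w hw
    by_contra h'
    exact (Finsupp.mem_support_iff.1 hw) (h w h')

/-- The span of the basis vectors outside the plane. -/
def offSpan (u : Module.Basis (WSpace k) K V) : Submodule K V :=
  Submodule.span K (u '' {w | w ∉ plane k})

lemma mem_offSpan_iff (u : Module.Basis (WSpace k) K V) (v : V) :
    v ∈ offSpan u ↔ ∀ w ∈ plane k, u.repr v w = 0 := by
  rw [offSpan, Module.Basis.mem_span_image]
  constructor
  · intro h w hw
    by_contra h'
    exact (h (Finsupp.mem_support_iff.2 h')) hw
  · intro h w hw h'
    exact (Finsupp.mem_support_iff.1 hw) (h w h')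

lemma eq_of_mem_planeSpan_of_mem_offSpan (u : Module.Basis (WSpace k) K V) {a b c d : V}
    (ha : a ∈ planeSpan u) (hb : b ∈ planeSpan u) (hc : c ∈ offSpan u) (hd : d ∈ offSpan u)
    (h : a + c = b + d) : a = b ∧ c = d := by
  have hab : a = b := by
    apply u.ext_elem
    intro w
    by_cases hw : w ∈ plane k
    · have h1 := congrArg (fun v => u.repr v w) h
      simpa [(mem_offSpan_iff u c).1 hc w hw, (mem_offSpan_iff u d).1 hd w hw] using h1
    · rw [(mem_planeSpan_iff u a).1 ha w hw, (mem_planeSpan_iff u b).1 hb w hw]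
  exact ⟨hab, by simpa [hab] using h⟩

lemma basis_mem_planeSpan (u : Module.Basis (WSpace k) K V) {w : WSpace k} (hw : w ∈ plane k) :
    u w ∈ planeSpan u := Submodule.subset_span ⟨w, hw, rfl⟩

lemma repr_apply_of_monomial (u : Module.Basis (WSpace k) K V) {g : GLin K V}
    {p : WSpace k → WSpace k} (hp : Function.Injective p) {c : WSpace k → Kˣ}
    (h : ∀ w, g (u w) = c w • u (p w)) (v : V) (w : WSpace k) :
    u.repr (g v) (p w) = c w * u.repr v w := by
  have : (u.coord (p w)) ∘ₗ (g : V →ₗ[K] V) = (c w : K) • u.coord w := by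
    refine u.ext fun x => ?_
    simp only [LinearMap.comp_apply, LinearEquiv.coe_coe, h, Units.smul_def, map_smul,
      LinearMap.smul_apply, Module.Basis.coord_apply, Module.Basis.repr_self, smul_eq_mul,
      Finsupp.single_apply, hp.eq_iff]
    split_ifs with hx
    · rw [hx]
    · simp
  exact LinearMap.congr_fun this v

lemma repr_pauli (u : Module.Basis (WSpace k) K V) (l : Kˣ) (a b : WSpace k) (v : V)
    (w : WSpace k) :
    u.repr (pauli u l a b v) (a + w) = (l * sgn K (b ⬝ᵥ w) : Kˣ) * u.repr v w :=
  repr_apply_of_monomial u (add_right_injective a) (pauli_apply u l a b) v w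

lemma repr_pauli_zero (u : Module.Basis (WSpace k) K V) (l : Kˣ) (b : WSpace k) (v : V)
    (w : WSpace k) :
    u.repr (pauli u l 0 b v) w = (l * sgn K (b ⬝ᵥ w) : Kˣ) * u.repr v w := by
  simpa using repr_pauli u l 0 b v w

lemma eq_zero_of_fixed_neg (h2 : (2 : K) ≠ 0) {c : K} (h : c = ((-1 : Kˣ) : K) * c) : c = 0 := by
  have : 2 * c = 0 := by
    rw [two_mul]
    nth_rewrite 1 [h]
    simp
  exact (mul_eq_zero.1 this).resolve_left h2

/-- The Pauli transformations fixing a vector supported on three points of the plane are diagonal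
and act trivially on the plane. -/
lemma pauli_fixed_three (hk : 2 ≤ k) (u : Module.Basis (WSpace k) K V) {y₀ : V}
    (hy : y₀ ∈ planeSpan u) (hc : (u.repr y₀).support.card = 3) {l : Kˣ} {a b : WSpace k}
    (h : pauli u l a b y₀ = y₀) : a = 0 ∧ ∀ w ∈ plane k, l * sgn K (b ⬝ᵥ w) = 1 := by
  have hr : ∀ w, u.repr y₀ (a + w) = (l * sgn K (b ⬝ᵥ w) : Kˣ) * u.repr y₀ w := by
    intro w
    rw [← repr_pauli, h]
  have ha : a = 0 := by
    refine eq_zero_of_add_invariant (s := (u.repr y₀).support) (by rw [hc]; decide) ?_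
    intro w hw
    rw [Finsupp.mem_support_iff] at hw ⊢
    rw [hr]
    exact mul_ne_zero (Units.ne_zero _) hw
  subst ha
  refine ⟨rfl, ?_⟩
  have hs : ∀ w ∈ (u.repr y₀).support, l * sgn K (b ⬝ᵥ w) = 1 := by
    intro w hw
    have h1 := hr w
    rw [zero_add] at h1
    exact Units.ext ((mul_eq_right₀ (Finsupp.mem_support_iff.1 hw)).1 h1.symm)
  have hsub : (u.repr y₀).support ⊆ plane k := by
    intro w hw
    by_contra h'
    exact (Finsupp.mem_support_iff.1 hw) ((mem_planeSpan_iff u y₀).1 hy w h')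
  intro w hw
  by_cases hws : w ∈ (u.repr y₀).support
  · exact hs w hws
  have heq : (u.repr y₀).support = (plane k).erase w := by
    apply Finset.eq_of_subset_of_card_le
    · intro x hx
      exact Finset.mem_erase.2 ⟨fun h' => hws (h' ▸ hx), hsub hx⟩
    · rw [Finset.card_erase_of_mem hw, card_plane hk, hc]
  -- Only the point w missing from the support remains. The three other points are x + w with x
  -- non-zero in the plane; comparing their equations forces the sign of e₂ to be 1, and then the
  -- value at w is 1.
  have hmem : ∀ x ∈ plane k, x ≠ 0 → l * sgn K (b ⬝ᵥ (x + w)) = 1 := by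
    intro x hx hx0
    apply hs
    rw [heq]
    exact Finset.mem_erase.2 ⟨by simpa using hx0, add_mem_plane hk hx hw⟩
  have h1 := hmem _ eVec_one_mem_plane (eVec_ne_zero (by omega) (by omega))
  have h2 := hmem _ eVec_two_mem_plane (eVec_ne_zero (by omega) (by omega))
  have h3 := hmem (eVec k 1 + eVec k 2) (by simp [plane]) (fun h => eVec_one_ne_two hk (by
    rw [eq_comm, eq_add_iff, add_zero] at h
    exact h))
  rw [dotProduct_add, sgn_add] at h1 h2 h3
  rw [dotProduct_add, sgn_add] at h3
  have h4 : sgn K (b ⬝ᵥ eVec k 2) = 1 := by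
    calc sgn K (b ⬝ᵥ eVec k 2) = sgn K (b ⬝ᵥ eVec k 2) * (l * (sgn K (b ⬝ᵥ eVec k 1) *
          sgn K (b ⬝ᵥ w))) := by rw [h1, mul_one]
      _ = l * (sgn K (b ⬝ᵥ eVec k 1) * sgn K (b ⬝ᵥ eVec k 2) * sgn K (b ⬝ᵥ w)) := by
        ext; push_cast; ring
      _ = 1 := h3
  rwa [h4, one_mul] at h2

variable {G N : Subgroup (GLin K V)}

lemma exists_conj_pauli (hN : ∀ g ∈ G, ∀ a ∈ N, g * a * g⁻¹ ∈ N)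
    {u : Module.Basis (WSpace k) K V} (hu : IsPauliBasis N u) {g : GLin K V} (hg : g ∈ G)
    (l : Kˣ) (a b : WSpace k) : ∃ l' a' b', g * pauli u l a b = pauli u l' a' b' * g := by
  obtain ⟨l', a', b', h⟩ := (hu _).1 (hN g hg _ ((hu (pauli u l a b)).2 ⟨l, a, b, rfl⟩))
  exact ⟨l', a', b', by rw [← h]; group⟩

/-! ### Elements of `G` fixing a vector with three coordinates in the plane. -/

section Fixed

variable (hk : 2 ≤ k) (h2 : (2 : K) ≠ 0) (hN : ∀ g ∈ G, ∀ a ∈ N, g * a * g⁻¹ ∈ N)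
  {u : Module.Basis (WSpace k) K V} (hu : IsPauliBasis N u) {y₀ : V}
  (hy : y₀ ∈ planeSpan u) (hc : (u.repr y₀).support.card = 3)

include hk hN hu hy hc in
-- A diagonal sign change trivial on the plane fixes y₀, hence so does its conjugate under g;
-- `pauli_fixed_three` then applies to the conjugate.
lemma exists_conj_pauli_of_fixed {g : GLin K V} (hg : g ∈ G)
    (hgy : g y₀ = y₀) {b : WSpace k} (hb : ∀ x ∈ plane k, b ⬝ᵥ x = 0) :
    ∃ l b', g * pauli u 1 0 b = pauli u l 0 b' * g ∧ ∀ w ∈ plane k, l * sgn K (b' ⬝ᵥ w) = 1 := by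
  obtain ⟨l, a, b', h⟩ := exists_conj_pauli hN hu hg 1 0 b
  have hd : pauli u 1 0 b y₀ = y₀ := by
    apply u.ext_elem
    intro w
    rw [repr_pauli_zero]
    by_cases hw : w ∈ plane k
    · rw [hb w hw]; simp
    · rw [(mem_planeSpan_iff u y₀).1 hy w hw, mul_zero]
  have h1 : pauli u l a b' y₀ = y₀ := by
    have := congrArg (fun f : GLin K V => f y₀) h
    simp only [LinearEquiv.mul_apply, hd, hgy] at this
    exact this.symm
  obtain ⟨rfl, h3⟩ := pauli_fixed_three hk u hy hc h1
  exact ⟨l, b', h, h3⟩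

include hk h2 hN hu hy hc in
-- V' is the common fixed space of the diagonal sign changes that are trivial on it, and conjugation
-- by g⁻¹ sends these to transformations fixing V' pointwise. A coordinate of g v outside the plane
-- is therefore equal to its own negative.
lemma map_planeSpan_le {g : GLin K V} (hg : g ∈ G) (hgy : g y₀ = y₀) :
    ∀ v ∈ planeSpan u, g v ∈ planeSpan u := by
  intro v hv
  rw [mem_planeSpan_iff]
  intro w hw
  obtain ⟨b, hbw, hb⟩ := exists_dot_of_notMem_plane hk hw
  have hgi : g⁻¹ y₀ = y₀ := by
    nth_rewrite 1 [← hgy]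
    exact g.symm_apply_apply y₀
  obtain ⟨l, b', h, h3⟩ := exists_conj_pauli_of_fixed hk hN hu hy hc (G.inv_mem hg) hgi hb
  have hfix : pauli u l 0 b' v = v := by
    apply u.ext_elem
    intro x
    rw [repr_pauli_zero]
    by_cases hx : x ∈ plane k
    · rw [h3 x hx]; simp
    · rw [(mem_planeSpan_iff u v).1 hv x hx, mul_zero]
  have h4 : pauli u 1 0 b * g = g * pauli u l 0 b' := by
    calc pauli u 1 0 b * g = g * (g⁻¹ * pauli u 1 0 b) * g := by group
      _ = g * pauli u l 0 b' := by rw [h]; group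
  have h5 := congrArg (fun f : GLin K V => u.repr (f v) w) h4
  simp only [LinearEquiv.mul_apply, hfix, repr_pauli_zero, hbw, one_mul, sgn_one] at h5
  exact eq_zero_of_fixed_neg h2 h5.symm

include hk h2 hN hu hy hc in
-- For x outside the plane some diagonal sign change trivial on the plane negates u_x. Its conjugate
-- negates g u_x but leaves all plane coordinates unchanged, so these vanish.
lemma map_offSpan_le {g : GLin K V} (hg : g ∈ G) (hgy : g y₀ = y₀) :
    ∀ v ∈ offSpan u, g v ∈ offSpan u := by
  have : offSpan u ≤ (offSpan u).comap (g : V →ₗ[K] V) := by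
    rw [offSpan, Submodule.span_le]
    rintro _ ⟨x, hx, rfl⟩
    change g (u x) ∈ offSpan u
    rw [mem_offSpan_iff]
    intro w hw
    obtain ⟨b, hbx, hb⟩ := exists_dot_of_notMem_plane hk hx
    obtain ⟨l, b', h, h3⟩ := exists_conj_pauli_of_fixed hk hN hu hy hc hg hgy hb
    have h5 := congrArg (fun f : GLin K V => u.repr (f (u x)) w) h
    simp only [LinearEquiv.mul_apply, pauli_apply, repr_pauli_zero, hbx, h3 w hw, one_mul, sgn_one,
      zero_add, Units.smul_def, map_smul, Finsupp.smul_apply, smul_eq_mul, Units.val_one] at h5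
    exact eq_zero_of_fixed_neg h2 h5.symm
  exact this

include hk h2 hN hu hy hc in
lemma map_planeSpan_eq {g : GLin K V} (hg : g ∈ G) (hgy : g y₀ = y₀) :
    (planeSpan u).map (g : V →ₗ[K] V) = planeSpan u := by
  apply le_antisymm
  · rintro _ ⟨v, hv, rfl⟩
    exact map_planeSpan_le hk h2 hN hu hy hc hg hgy v hv
  · intro v hv
    have hgi : g⁻¹ y₀ = y₀ := by
      nth_rewrite 1 [← hgy]
      exact g.symm_apply_apply y₀
    exact ⟨_, map_planeSpan_le hk h2 hN hu hy hc (G.inv_mem hg) hgi v hv, g.apply_symm_apply v⟩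

end Fixed

/-! ### Monomial elements of the normalizer. -/

/-- Monomial transformations normalizing the Pauli group: the permutation part is additive and the
coefficients are multiplicative up to characters. -/
structure IsMonomial (u : Module.Basis (WSpace k) K V) (g : GLin K V)
    (π : Equiv.Perm (WSpace k)) (c : WSpace k → Kˣ) : Prop where
  apply : ∀ w, g (u w) = c w • u (π w)
  map_add : ∀ a w, π (a + w) = π a + π w
  coeff_add : ∀ a, ∃ b : WSpace k, ∀ w, c (a + w) = c a * c w * sgn K (b ⬝ᵥ w)
  coeff_zero : c 0 = 1

lemma IsMonomial.map_zero {u : Module.Basis (WSpace k) K V} {g : GLin K V}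
    {π : Equiv.Perm (WSpace k)} {c : WSpace k → Kˣ} (h : IsMonomial u g π c) : π 0 = 0 := by
  have := h.map_add 0 0
  rw [add_zero] at this
  exact left_eq_add.1 this

lemma IsMonomial.repr_apply {u : Module.Basis (WSpace k) K V} {g : GLin K V}
    {π : Equiv.Perm (WSpace k)} {c : WSpace k → Kˣ} (h : IsMonomial u g π c) (v : V)
    (w : WSpace k) : u.repr (g v) (π w) = c w * u.repr v w :=
  repr_apply_of_monomial u π.injective h.apply v w

lemma smul_basis_inj (u : Module.Basis (WSpace k) K V) {c c' : Kˣ} {w w' : WSpace k}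
    (h : c • u w = c' • u w') : c = c' ∧ w = w' := by
  have hw : w = w' := by
    by_contra hne
    have h0 := congrArg (fun v => u.repr v w) h
    simp [Units.smul_def, Ne.symm hne] at h0
  subst hw
  simp only [Units.smul_def] at h
  exact ⟨Units.ext (smul_left_injective K (u.ne_zero _) h), rfl⟩

/-- As g fixes u_0, conjugation by g⁻¹ sends the diagonal sign changes fixing u_0 to diagonal sign
changes fixing u_0. So g permutes their common eigenlines, which are the coordinate lines.
Conjugating translations gives the additivity of the permutation and the rule for the coefficients.
-/
lemma exists_isMonomial (hN : ∀ g ∈ G, ∀ a ∈ N, g * a * g⁻¹ ∈ N)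
    (h2 : (2 : K) ≠ 0)
    {u : Module.Basis (WSpace k) K V} (hu : IsPauliBasis N u) {g : GLin K V} (hg : g ∈ G)
    (h0 : g (u 0) = u 0) : ∃ π c, IsMonomial u g π c := by
  have hgi : g⁻¹ (u 0) = u 0 := by
    nth_rewrite 1 [← h0]
    exact g.symm_apply_apply _
  have hconj : ∀ b, ∃ b', pauli u 1 0 b * g = g * pauli u 1 0 b' := by
    intro b
    obtain ⟨l, a, b', h⟩ := exists_conj_pauli hN hu (G.inv_mem hg) 1 0 b
    have h1 := congrArg (fun f : GLin K V => f (u 0)) h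
    simp only [LinearEquiv.mul_apply, hgi, pauli_apply, dotProduct_zero, sgn_zero, mul_one,
      add_zero, one_smul] at h1
    obtain ⟨hl, ha⟩ := smul_basis_inj u (c := 1) ((one_smul _ _).trans h1)
    refine ⟨b', ?_⟩
    calc pauli u 1 0 b * g = g * (g⁻¹ * pauli u 1 0 b) * g := by group
      _ = _ := by rw [h, ← hl, ← ha]; group
  have hex : ∀ w, ∃ x, ∃ c : Kˣ, g (u w) = c • u x := by
    intro w
    have hne : g (u w) ≠ 0 := fun h => u.ne_zero w (g.map_eq_zero_iff.1 h)
    have : ∃ x, u.repr (g (u w)) x ≠ 0 := by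
      by_contra! h
      exact hne (u.ext_elem fun x => by rw [h x]; simp)
    obtain ⟨x, hx⟩ := this
    refine ⟨x, Units.mk0 _ hx, u.ext_elem fun y => ?_⟩
    simp only [Units.smul_def, Units.val_mk0, map_smul, Module.Basis.repr_self,
      Finsupp.smul_apply, Finsupp.single_apply, smul_eq_mul]
    by_cases hxy : x = y
    · simp [hxy]
    · rw [if_neg hxy, mul_zero]
      obtain ⟨b, hb⟩ := exists_dot_ne hxy
      obtain ⟨b', hb'⟩ := hconj b
      -- The vector g u_w is an eigenvector of every diagonal sign change, so two labels in its
      -- support cannot be separated by any b.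
      by_contra hy
      have hz : ∀ z, u.repr (g (u w)) z ≠ 0 → sgn K (b ⬝ᵥ z) = sgn K (b' ⬝ᵥ w) := by
        intro z hz
        have h1 := congrArg (fun f : GLin K V => u.repr (f (u w)) z) hb'
        simp only [LinearEquiv.mul_apply, repr_pauli_zero, pauli_apply, one_mul, zero_add,
          Units.smul_def, map_smul, Finsupp.smul_apply, smul_eq_mul] at h1
        exact Units.ext (mul_right_cancel₀ hz h1)
      exact hb (sgn_injective h2 ((hz x hx).trans (hz y hy).symm))
  choose p c hpc using hex
  have hp : Function.Injective p := by
    intro w w' h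
    have h1 : g ((c w)⁻¹ • u w) = g ((c w')⁻¹ • u w') := by
      simp only [Units.smul_def, map_smul]
      rw [hpc, hpc, h, ← Units.smul_def, ← Units.smul_def, inv_smul_smul, inv_smul_smul]
    exact (smul_basis_inj u (g.injective h1)).2
  let π : Equiv.Perm (WSpace k) :=
    Equiv.ofBijective p (Finite.injective_iff_bijective.1 hp)
  have hc0 : c 0 = 1 ∧ p 0 = 0 := by
    have := hpc 0
    rw [h0] at this
    obtain ⟨h3, h4⟩ := smul_basis_inj u (c := 1) ((one_smul _ _).trans this)
    exact ⟨h3.symm, h4.symm⟩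
  have key : ∀ a, ∃ b : WSpace k, ∀ w, p (a + w) = p a + p w ∧
      c (a + w) = c a * c w * sgn K (b ⬝ᵥ p w) := by
    intro a
    obtain ⟨l, a', b, h⟩ := exists_conj_pauli hN hu hg 1 a 0
    have h1 : ∀ w, c (a + w) • u (p (a + w)) =
        (c w * (l * sgn K (b ⬝ᵥ p w))) • u (a' + p w) := by
      intro w
      have h1 := congrArg (fun f : GLin K V => f (u w)) h
      simp only [LinearEquiv.mul_apply, hpc, pauli_apply, zero_dotProduct, sgn_zero, mul_one,
        one_smul] at h1
      rw [h1]
      rw [Units.smul_def (c w), map_smul, pauli_apply, ← Units.smul_def, smul_smul]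
    have h4 := smul_basis_inj u (h1 0)
    simp only [add_zero, hc0.1, hc0.2, dotProduct_zero, sgn_zero, mul_one, one_mul] at h4
    refine ⟨b, fun w => ?_⟩
    obtain ⟨h5, h6⟩ := smul_basis_inj u (h1 w)
    rw [h5, h6, h4.1, h4.2]
    refine ⟨rfl, ?_⟩
    rw [mul_left_comm, mul_assoc]
  refine ⟨π, c, hpc, fun a w => ?_, fun a => ?_, hc0.1⟩
  · exact ((key a).choose_spec w).1
  · obtain ⟨b, hb⟩ := key a
    obtain ⟨b', hb'⟩ := exists_sgn_dot (K := K) (fun w => sgn K (b ⬝ᵥ p w)) (fun x w => by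
      rw [((key x).choose_spec w).1, dotProduct_add, sgn_add])
    exact ⟨b', fun w => by rw [(hb w).2, hb']⟩

/-- If c a ≠ 1, the relation c (a + w) = c a · c w · (-1)^(b·w) shows that the set `A`, where both c
w and c (a + w) equal 1, lies in the affine hyperplane b·w = 1 and so contains at most half of all
labels. Its complement lies in B ∪ (a + B), which contains fewer than half. -/
lemma IsMonomial.coeff_eq_one {u : Module.Basis (WSpace k) K V} {g : GLin K V}
    {π : Equiv.Perm (WSpace k)} {c : WSpace k → Kˣ} (h : IsMonomial u g π c)
    {B : Finset (WSpace k)} (hB : ∀ w, w ∉ B → c w = 1) (hcard : 4 * B.card < 2 ^ k)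
    (a : WSpace k) : c a = 1 := by
  classical
  by_contra ha
  obtain ⟨b, hb⟩ := h.coeff_add a
  let A : Finset (WSpace k) := Finset.univ.filter fun w => c w = 1 ∧ c (a + w) = 1
  have hA : ∀ w ∈ A, b ⬝ᵥ w = 1 := by
    intro w hw
    obtain ⟨h1, h3⟩ := (Finset.mem_filter.1 hw).2
    refine (zmod_two_cases _).resolve_left fun h0 => ha ?_
    have := hb w
    rw [h1, h3, h0, sgn_zero, mul_one, mul_one] at this
    exact this.symm
  have hle : A.card ≤ Aᶜ.card := by
    rcases A.eq_empty_or_nonempty with hA0 | ⟨w₀, hw₀⟩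
    · simp [hA0]
    · refine Finset.card_le_card_of_injOn (fun w => w₀ + w) (fun w hw => ?_)
        (fun _ _ _ _ h' => add_left_cancel h')
      simp only [Finset.coe_compl, Set.mem_compl_iff, Finset.mem_coe]
      intro hmem
      have h1 := hA _ hmem
      rw [dotProduct_add, hA _ hw₀, hA _ hw] at h1
      revert h1; decide
  have hcomp : Aᶜ ⊆ B ∪ B.image (fun w => a + w) := by
    intro w hw
    rw [Finset.mem_union, Finset.mem_image]
    by_contra! hw'
    refine (Finset.mem_compl.1 hw) (Finset.mem_filter.2 ⟨Finset.mem_univ _, hB _ hw'.1, hB _ ?_⟩)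
    intro h'
    exact hw'.2 _ h' (add_add_cancel a w)
  have h1 := (Finset.card_le_card hcomp).trans (Finset.card_union_le _ _)
  have h3 : (B.image (fun w => a + w)).card ≤ B.card := Finset.card_image_le
  have h4 := Finset.card_add_card_compl A
  have h5 : Fintype.card (WSpace k) = 2 ^ k := by simp [ZMod.card]
  omega

lemma perm_eq_one {π : Equiv.Perm (WSpace k)} (hadd : ∀ a w, π (a + w) = π a + π w)
    (h : ∀ j, 1 ≤ j → j ≤ k → π (eVec k j) = eVec k j) : π = 1 := by
  have h0 : π 0 = 0 := by
    have := hadd 0 0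
    rw [add_zero] at this
    exact left_eq_add.1 this
  let f : WSpace k →+ WSpace k := ⟨⟨π, h0⟩, hadd⟩
  have hf : f = AddMonoidHom.id _ := by
    refine AddMonoidHom.functions_ext _ f _ fun i c => ?_
    rcases zmod_two_cases c with rfl | rfl
    · simp
    · rw [← eVec_succ]
      exact h _ (by omega) (by omega)
  ext1 w
  exact DFunLike.congr_fun hf w

end Pauli

/-! ### A small regular partition of the labels. -/

namespace Pauli

variable {K V : Type*} [Field K] [AddCommGroup V] [Module K V] {k : ℕ}

section Partition

/-- The vectors linking `e_j` to its predecessors. -/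
def linkVec (k j : ℕ) : WSpace k := if j = 3 then eVec k 2 else eVec k (j - 1) + eVec k 2

/-- A small set of vectors whose stabilizer among the linear maps fixing `e₁, e₂` is trivial. -/
def rigidSet (k : ℕ) : Finset (WSpace k) :=
  (Finset.Icc 3 k).image (eVec k) ∪ (Finset.Ico 3 k).image (fun j => eVec k j + eVec k 1) ∪
    (Finset.Ico 3 k).image (fun j => eVec k j + linkVec k j)

lemma mem_rigidSet {w : WSpace k} : w ∈ rigidSet k ↔ (∃ j, 3 ≤ j ∧ j ≤ k ∧ eVec k j = w) ∨
    (∃ j, 3 ≤ j ∧ j < k ∧ eVec k j + eVec k 1 = w) ∨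
    (∃ j, 3 ≤ j ∧ j < k ∧ eVec k j + linkVec k j = w) := by
  simp [rigidSet, and_assoc]

/-- The three families have at most 3k - 8 members in all. For k = 4 this bound gives 16 < 16, which
fails; hence the separate treatment of |W| = 16. -/
lemma four_mul_card_rigidSet (hk : 3 ≤ k) (hk4 : k ≠ 4) : 4 * (rigidSet k).card < 2 ^ k := by
  have h1 : (rigidSet k).card ≤ (k - 2) + (k - 3) + (k - 3) := by
    refine (Finset.card_union_le _ _).trans
      (add_le_add ((Finset.card_union_le _ _).trans (add_le_add ?_ ?_)) ?_)
    · exact Finset.card_image_le.trans (by simp)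
    · exact Finset.card_image_le.trans (by simp)
    · exact Finset.card_image_le.trans (by simp)
  -- With k = n + 5 the number 3(n + 2) + 1 is 3k - 8.
  have h3 : ∀ n, 4 * (3 * (n + 2) + 1) < 2 ^ (n + 5) := by
    intro n
    induction n with
    | zero => norm_num
    | succ n ih => rw [show n + 1 + 5 = (n + 5) + 1 by ring, pow_succ]; omega
  obtain rfl | h5 : k = 3 ∨ 5 ≤ k := by omega
  · omega
  · have := h3 (k - 5)
    rw [show k - 5 + 5 = k by omega] at this
    omega

lemma eVec_one_dot_linkVec (hk : 3 ≤ k) {j : ℕ} (hj : 3 ≤ j) : eVec k 1 ⬝ᵥ linkVec k j = 0 := by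
  rw [linkVec]
  split_ifs
  · rw [eVec_dot (by omega) (by omega), if_neg (by omega)]
  · rw [dotProduct_add, eVec_dot (by omega) (by omega), eVec_dot (by omega) (by omega),
      if_neg (by omega), if_neg (by omega), add_zero]

lemma eVec_two_dot_linkVec (hk : 3 ≤ k) {j : ℕ} (hj : 3 ≤ j) : eVec k 2 ⬝ᵥ linkVec k j = 1 := by
  rw [linkVec]
  split_ifs
  · rw [eVec_dot (by omega) (by omega), if_pos rfl]
  · rw [dotProduct_add, eVec_dot (by omega) (by omega), eVec_dot (by omega) (by omega),
      if_neg (by omega), if_pos rfl, zero_add]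

lemma eVec_dot_linkVec {i j : ℕ} (hi : 3 ≤ i) (hik : i ≤ k) (hj : 3 ≤ j) :
    eVec k i ⬝ᵥ linkVec k j = if i + 1 = j then 1 else 0 := by
  rw [linkVec]
  split_ifs with h1 h2 h2
  · omega
  · rw [eVec_dot (by omega) (by omega), if_neg (by omega)]
  · rw [dotProduct_add, eVec_dot (by omega) (by omega), eVec_dot (by omega) (by omega),
      if_pos (by omega), if_neg (by omega), add_zero]
  · rw [dotProduct_add, eVec_dot (by omega) (by omega), eVec_dot (by omega) (by omega),
      if_neg (by omega), if_neg (by omega), add_zero]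

/-- The second family alone has e₁-coordinate one, so pairs differing by e₁ mark the vectors e_i
with i < k. The vector e_k is deliberately left without a partner. -/
lemma eq_eVec_of_add_mem (hk : 3 ≤ k) {x : WSpace k} (hx : x ∈ rigidSet k)
    (hx1 : x + eVec k 1 ∈ rigidSet k) :
    ∃ i, 3 ≤ i ∧ i < k ∧ (x = eVec k i ∨ x = eVec k i + eVec k 1) := by
  by_cases hd : eVec k 1 ⬝ᵥ x = 0
  · have hd1 : eVec k 1 ⬝ᵥ (x + eVec k 1) = 1 := by
      rw [dotProduct_add, hd, eVec_dot (by omega) (by omega), if_pos rfl, zero_add]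
    rcases mem_rigidSet.1 hx1 with ⟨j, hj, hjk, h⟩ | ⟨j, hj, hjk, h⟩ | ⟨j, hj, hjk, h⟩
    · rw [← h, eVec_dot (by omega) (by omega), if_neg (by omega)] at hd1
      simp at hd1
    · exact ⟨j, hj, hjk, Or.inl (add_right_cancel h).symm⟩
    · rw [← h, dotProduct_add, eVec_one_dot_linkVec hk hj, eVec_dot (by omega) (by omega),
        if_neg (by omega)] at hd1
      simp at hd1
  · rcases mem_rigidSet.1 hx with ⟨j, hj, hjk, rfl⟩ | ⟨j, hj, hjk, rfl⟩ | ⟨j, hj, hjk, rfl⟩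
    · rw [eVec_dot (by omega) (by omega), if_neg (by omega)] at hd
      simp at hd
    · exact ⟨j, hj, hjk, Or.inr rfl⟩
    · rw [dotProduct_add, eVec_one_dot_linkVec hk hj, eVec_dot (by omega) (by omega),
        if_neg (by omega)] at hd
      simp at hd

/-- The e₂-coordinate is one only in the third family, so the vector is e_m + `linkVec k m` for some
m. Beyond e₁, e₂ the links form a chain e_3, e_4 + e_3, e_5 + e_4, …, and e_i plus the link of a
smaller index is not in it. -/
lemma le_of_add_link_mem (hk : 3 ≤ k) {i j : ℕ} (hi : 3 ≤ i) (hik : i < k) (hj : 3 ≤ j)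
    (h : eVec k i + linkVec k j ∈ rigidSet k) : i ≤ j := by
  have hd2 : eVec k 2 ⬝ᵥ (eVec k i + linkVec k j) = 1 := by
    rw [dotProduct_add, eVec_two_dot_linkVec hk hj, eVec_dot (by omega) (by omega),
      if_neg (by omega), zero_add]
  rcases mem_rigidSet.1 h with ⟨m, hm, hmk, h'⟩ | ⟨m, hm, hmk, h'⟩ | ⟨m, hm, hmk, h'⟩
  · rw [← h', eVec_dot (by omega) (by omega), if_neg (by omega)] at hd2
    simp at hd2
  · rw [← h', dotProduct_add, eVec_dot (by omega) (by omega), eVec_dot (by omega) (by omega),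
      if_neg (by omega), if_neg (by omega)] at hd2
    simp at hd2
  · have key : ∀ n, 3 ≤ n → n ≤ k → ((if n = m then 1 else 0) + (if n + 1 = m then 1 else 0) :
        ZMod 2) = (if n = i then 1 else 0) + (if n + 1 = j then 1 else 0) := by
      intro n hn hnk
      have := congrArg (fun v => eVec k n ⬝ᵥ v) h'
      simpa only [dotProduct_add, eVec_dot_linkVec hn hnk hm, eVec_dot_linkVec hn hnk hj,
        eVec_dot (show 1 ≤ n by omega) hnk] using this
    by_contra hij
    have k1 := key i hi (by omega)
    rw [if_pos (rfl : i = i), if_neg (show ¬ i + 1 = j by omega)] at k1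
    have hm' : m = i ∨ m = i + 1 := by
      by_contra! hne
      rw [if_neg (Ne.symm hne.1), if_neg (Ne.symm hne.2)] at k1
      simp at k1
    by_cases h3 : m = 3
    · omega
    have k2 := key (m - 1) (by omega) (by omega)
    rw [if_neg (show ¬ m - 1 = m by omega), if_pos (show m - 1 + 1 = m by omega),
      if_neg (show ¬ m - 1 + 1 = j by omega)] at k2
    have k3 : m - 1 = i := by
      by_contra hne
      rw [if_neg hne] at k2
      simp at k2
    have k4 := key m (by omega) (by omega)
    rw [if_pos (rfl : m = m), if_neg (show ¬ m + 1 = m by omega), if_neg (show ¬ m = i by omega),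
      if_neg (show ¬ m + 1 = j by omega)] at k4
    simp at k4

/-- Induction along the chain: once the link of e_j is known to be fixed, the image e_i of e_j
satisfies i ≤ j, and i < j is impossible because those e_i are already fixed. -/
lemma perm_eq_one_of_rigidSet (hk : 3 ≤ k) {π : Equiv.Perm (WSpace k)}
    (hadd : ∀ a w, π (a + w) = π a + π w) (h1 : π (eVec k 1) = eVec k 1)
    (h2 : π (eVec k 2) = eVec k 2) (hΩ : ∀ w ∈ rigidSet k, π w ∈ rigidSet k) : π = 1 := by
  have hlt : ∀ j, 3 ≤ j → j < k → π (eVec k j) = eVec k j := by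
    intro j
    induction j using Nat.strong_induction_on with
    | _ j ih =>
      intro hj hjk
      have hlink : π (linkVec k j) = linkVec k j := by
        rw [linkVec]
        split_ifs with h3
        · exact h2
        · rw [hadd, h2, ih (j - 1) (by omega) (by omega) (by omega)]
      have hm1 := hΩ _ (mem_rigidSet.2 (Or.inl ⟨j, hj, hjk.le, rfl⟩))
      have hm2 := hΩ _ (mem_rigidSet.2 (Or.inr (Or.inl ⟨j, hj, hjk, rfl⟩)))
      have hm3 := hΩ _ (mem_rigidSet.2 (Or.inr (Or.inr ⟨j, hj, hjk, rfl⟩)))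
      rw [hadd, h1] at hm2
      rw [hadd, hlink] at hm3
      obtain ⟨i, hi, hik, hx | hx⟩ := eq_eVec_of_add_mem hk hm1 hm2
      · rw [hx] at hm3
        rcases (le_of_add_link_mem hk hi hik hj hm3).lt_or_eq with hlt | rfl
        · have h4 := ih i hlt hi hik
          have h5 := π.injective (hx.trans h4.symm)
          exact absurd (eVec_injective (by omega) (by omega) h5) (by omega)
        · exact hx
      -- No member of `rigidSet` has both its e₁- and its e₂-coordinate equal to one.
      · exfalso
        rw [hx] at hm3
        have hd1 : eVec k 1 ⬝ᵥ (eVec k i + eVec k 1 + linkVec k j) = 1 := by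
          rw [dotProduct_add, dotProduct_add, eVec_one_dot_linkVec hk hj,
            eVec_dot (by omega) (by omega), eVec_dot (by omega) (by omega), if_neg (by omega),
            if_pos rfl, zero_add, add_zero]
        have hd2 : eVec k 2 ⬝ᵥ (eVec k i + eVec k 1 + linkVec k j) = 1 := by
          rw [dotProduct_add, dotProduct_add, eVec_two_dot_linkVec hk hj,
            eVec_dot (by omega) (by omega), eVec_dot (by omega) (by omega), if_neg (by omega),
            if_neg (by omega), zero_add, zero_add]
        rcases mem_rigidSet.1 hm3 with ⟨m, hm, hmk, h'⟩ | ⟨m, hm, hmk, h'⟩ | ⟨m, hm, hmk, h'⟩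
        · rw [← h', eVec_dot (by omega) (by omega), if_neg (by omega)] at hd2
          simp at hd2
        · rw [← h', dotProduct_add, eVec_dot (by omega) (by omega),
            eVec_dot (by omega) (by omega), if_neg (by omega), if_neg (by omega)] at hd2
          simp at hd2
        · rw [← h', dotProduct_add, eVec_one_dot_linkVec hk hm, eVec_dot (by omega) (by omega),
            if_neg (by omega)] at hd1
          simp at hd1
  -- Every member of `rigidSet` other than e_k lies in the span of the vectors already fixed, so by
  -- injectivity e_k can only go to itself.
  have hlast : π (eVec k k) = eVec k k := by
    have hfix : ∀ j, 1 ≤ j → j < k → π (eVec k j) = eVec k j := by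
      intro j hj hjk
      obtain rfl | rfl | h3 : j = 1 ∨ j = 2 ∨ 3 ≤ j := by omega
      · exact h1
      · exact h2
      · exact hlt j h3 hjk
    have hfix' : ∀ x, π (eVec k k) = x → π x = x → x = eVec k k := fun x hx hx' =>
      π.injective (hx'.trans hx.symm)
    rcases mem_rigidSet.1 (hΩ _ (mem_rigidSet.2 (Or.inl ⟨k, hk, le_rfl, rfl⟩))) with
      ⟨m, hm, hmk, h'⟩ | ⟨m, hm, hmk, h'⟩ | ⟨m, hm, hmk, h'⟩
    · rcases hmk.lt_or_eq with hlt' | rfl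
      · rw [← h']
        exact hfix' _ h'.symm (hfix m (by omega) hlt')
      · exact h'.symm
    · rw [← h']
      exact hfix' _ h'.symm (by rw [hadd, hfix m (by omega) hmk, h1])
    · rw [← h']
      refine hfix' _ h'.symm ?_
      rw [hadd, hfix m (by omega) hmk, linkVec]
      split_ifs
      · rw [h2]
      · rw [hadd, h2, hfix (m - 1) (by omega) (by omega)]
  refine perm_eq_one hadd fun j hj hjk => ?_
  obtain rfl | rfl | rfl | ⟨h3, h4⟩ : j = 1 ∨ j = 2 ∨ j = k ∨ (3 ≤ j ∧ j < k) := by omega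
  · exact h1
  · exact h2
  · exact hlast
  · exact hlt j h3 h4

end Partition

/-! ### From a starting pair to a base. -/

section Base

variable {G N : Subgroup (GLin K V)}

lemma mem_vectorCentralizer {g : GLin K V} {x : V} :
    g ∈ vectorCentralizer G x ↔ g ∈ G ∧ g x = x := Iff.rfl

lemma mem_inf_vectorCentralizer {g : GLin K V} {x y : V} :
    g ∈ vectorCentralizer G x ⊓ vectorCentralizer G y ↔ g ∈ G ∧ g x = x ∧ g y = y := by
  rw [Subgroup.mem_inf, mem_vectorCentralizer, mem_vectorCentralizer]
  tauto

lemma trivial_on_planeSpan (hk : 2 ≤ k) (h2 : (2 : K) ≠ 0)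
    (hN : ∀ g ∈ G, ∀ a ∈ N, g * a * g⁻¹ ∈ N) {u : Module.Basis (WSpace k) K V}
    (hu : IsPauliBasis N u) {x₀ y₀ : V} (hxy : IsStartingPair G u x₀ y₀) {g : GLin K V}
    (hg : g ∈ vectorCentralizer G x₀ ⊓ vectorCentralizer G y₀) {w : WSpace k}
    (hw : w ∈ plane k) : g (u w) = u w := by
  obtain ⟨hgG, -, hgy⟩ := mem_inf_vectorCentralizer.1 hg
  exact hxy.trivial_on g hg
    (map_planeSpan_eq hk h2 hN hu hxy.right_mem hxy.card_support hgG hgy) _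
    (basis_mem_planeSpan u hw)

lemma exists_isMonomial_of_starting (hk : 2 ≤ k) (h2 : (2 : K) ≠ 0)
    (hN : ∀ g ∈ G, ∀ a ∈ N, g * a * g⁻¹ ∈ N) {u : Module.Basis (WSpace k) K V}
    (hu : IsPauliBasis N u) {x₀ y₀ : V} (hxy : IsStartingPair G u x₀ y₀) {g : GLin K V}
    (hg : g ∈ vectorCentralizer G x₀ ⊓ vectorCentralizer G y₀) :
    ∃ π c, IsMonomial u g π c ∧ ∀ w ∈ plane k, π w = w ∧ c w = 1 := by
  have htriv := fun w (hw : w ∈ plane k) => trivial_on_planeSpan hk h2 hN hu hxy hg hw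
  obtain ⟨π, c, hm⟩ := exists_isMonomial hN h2 hu (mem_inf_vectorCentralizer.1 hg).1
    (htriv 0 zero_mem_plane)
  refine ⟨π, c, hm, fun w hw => ?_⟩
  have h1 := htriv w hw
  rw [hm.apply] at h1
  obtain ⟨h3, h4⟩ := smul_basis_inj u (c' := 1) (h1.trans (one_smul _ _).symm)
  exact ⟨h4, h3⟩

/-- Take Ω₃ = `rigidSet k` and let Ω₄ be the rest. The permutations in question come from elements
trivial on V', so they are additive and fix e₁ and e₂. -/
lemma exists_basePartition (hk : 3 ≤ k) (h2 : (2 : K) ≠ 0)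
    (hN : ∀ g ∈ G, ∀ a ∈ N, g * a * g⁻¹ ∈ N) {u : Module.Basis (WSpace k) K V}
    (hu : IsPauliBasis N u) {x₀ y₀ : V} (hxy : IsStartingPair G u x₀ y₀) :
    ∃ Ω₃ Ω₄ : Finset (WSpace k), IsBasePartition G u x₀ y₀ Ω₃ Ω₄ := by
  classical
  have hne1 : eVec k 1 ∉ rigidSet k := by
    intro h
    have hd : ∀ i, 1 ≤ i → i ≤ k → eVec k i ⬝ᵥ eVec k 1 = if i = 1 then 1 else 0 :=
      fun i h1 h3 => eVec_dot h1 h3 1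
    rcases mem_rigidSet.1 h with ⟨m, hm, hmk, h'⟩ | ⟨m, hm, hmk, h'⟩ | ⟨m, hm, hmk, h'⟩
    · exact absurd (eVec_injective (by omega) hmk h') (by omega)
    · rw [add_eq_right] at h'
      exact eVec_ne_zero (by omega) (by omega) h'
    · have h3 := congrArg (fun v => eVec k 2 ⬝ᵥ v) h'
      simp only [dotProduct_add, eVec_two_dot_linkVec hk hm,
        eVec_dot (show 1 ≤ 2 by omega) (show 2 ≤ k by omega)] at h3
      rw [if_neg (by omega), if_neg (by omega)] at h3
      simp at h3
  have hne2 : eVec k 2 ∉ rigidSet k := by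
    intro h
    rcases mem_rigidSet.1 h with ⟨m, hm, hmk, h'⟩ | ⟨m, hm, hmk, h'⟩ | ⟨m, hm, hmk, h'⟩
    · exact absurd (eVec_injective (by omega) hmk h') (by omega)
    · have h3 := congrArg (fun v => eVec k 2 ⬝ᵥ v) h'
      simp only [dotProduct_add, eVec_dot (show 1 ≤ 2 by omega) (show 2 ≤ k by omega)] at h3
      rw [if_neg (by omega), if_neg (by omega)] at h3
      simp at h3
    · have h3 := congrArg (fun v => eVec k m ⬝ᵥ v) h'
      simp only [dotProduct_add, eVec_dot_linkVec hm hmk.le hm,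
        eVec_dot (show 1 ≤ m by omega) hmk.le] at h3
      simp [show m ≠ 2 by omega] at h3
  have hne12 := eVec_one_ne_two (k := k) (by omega)
  refine ⟨rigidSet k, ((rigidSet k ∪ {eVec k 1, eVec k 2})ᶜ), ⟨?_, ?_, ?_⟩, ?_⟩
  · have hd : ∀ i j : Fin 4, i < j → Disjoint
        ((![{eVec k 1}, {eVec k 2}, rigidSet k, (rigidSet k ∪ {eVec k 1, eVec k 2})ᶜ] :
          Fin 4 → Finset (WSpace k)) i)
        ((![{eVec k 1}, {eVec k 2}, rigidSet k, (rigidSet k ∪ {eVec k 1, eVec k 2})ᶜ] :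
          Fin 4 → Finset (WSpace k)) j) := by
      intro i j hij
      fin_cases i <;> fin_cases j <;> simp_all
      rw [Finset.disjoint_left]
      intro x hx
      simp [hx]
    intro i j hij
    rcases lt_or_gt_of_ne hij with h | h
    · exact hd i j h
    · exact (hd j i h).symm
  · ext w
    simp only [Finset.mem_biUnion, Finset.mem_univ, true_and, iff_true]
    by_cases h1 : w = eVec k 1
    · exact ⟨0, by simp [h1]⟩
    by_cases h3 : w = eVec k 2
    · exact ⟨1, by simp [h3]⟩
    by_cases h4 : w ∈ rigidSet k
    · exact ⟨2, by simpa using h4⟩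
    · exact ⟨3, by simp [h1, h3, h4]⟩
  · rintro σ ⟨g, hg, hσ⟩ himg
    obtain ⟨π, c, hm, hplane⟩ := exists_isMonomial_of_starting (by omega) h2 hN hu hxy hg
    have hσπ : σ = π := by
      ext1 w
      obtain ⟨d, hd⟩ := hσ w
      rw [hm.apply] at hd
      exact (smul_basis_inj u hd).2.symm
    subst hσπ
    refine perm_eq_one_of_rigidSet hk hm.map_add (hplane _ eVec_one_mem_plane).1
      (hplane _ eVec_two_mem_plane).1 fun w hw => ?_
    have h3 : (rigidSet k).image σ = rigidSet k := himg 2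
    rw [← h3]
    exact Finset.mem_image_of_mem _ hw
  · intro h16
    refine four_mul_card_rigidSet hk ?_
    rintro rfl
    norm_num at h16

lemma repr_sum_basis (u : Module.Basis (WSpace k) K V) (s : Finset (WSpace k)) (w : WSpace k) :
    u.repr (∑ x ∈ s, u x) w = if w ∈ s then 1 else 0 := by
  classical
  rw [map_sum, Finsupp.finsetSum_apply]
  simp [Finsupp.single_apply]

lemma IsMonomial.eq_one {u : Module.Basis (WSpace k) K V} {g : GLin K V}
    {c : WSpace k → Kˣ} (h : IsMonomial u g 1 c) (hc : ∀ w, c w = 1) : g = 1 := by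
  apply basis_ext u
  intro w
  rw [h.apply, hc, one_smul]
  rfl

lemma eVec_notMem_plane (hk : 2 ≤ k) {j : ℕ} (hj : 3 ≤ j) (hjk : j ≤ k) :
    eVec k j ∉ plane k := by
  rw [mem_plane_iff hk]
  push Not
  obtain ⟨i, rfl⟩ := exists_fin_succ (k := k) (by omega) hjk
  exact ⟨i, by omega, by simp [eVec]⟩

lemma baseTail_mem_offSpan (hk : 2 ≤ k) (u : Module.Basis (WSpace k) K V)
    (Ω₄ : Finset (WSpace k)) : baseTail u Ω₄ ∈ offSpan u := by
  have hsub : ∀ w ∉ plane k, u w ∈ offSpan u := fun w hw => Submodule.subset_span ⟨w, hw, rfl⟩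
  rw [baseTail]
  split_ifs with h16
  · refine Submodule.sum_mem _ fun w hw => hsub w (Finset.mem_sdiff.1 hw).2
  · have hk4 : k = 4 := by
      rw [not_not] at h16
      exact Nat.pow_right_injective le_rfl (h16.trans (by norm_num : 16 = 2 ^ 4))
    refine Submodule.add_mem _ (Submodule.add_mem _ (Submodule.smul_mem _ _ (hsub _ ?_))
      (Submodule.smul_mem _ _ (hsub _ ?_))) (Submodule.sum_mem _ fun w hw => hsub w ?_)
    · exact eVec_notMem_plane hk (by omega) (by omega)
    · exact eVec_notMem_plane hk (by omega) (by omega)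
    · exact (Finset.mem_sdiff.1 (Finset.mem_sdiff.1 hw).1).2

/-- Fixing y₀ makes g respect V' and its coordinate complement, so fixing x₀ + v means fixing x₀ and
v. What remains is to read off from v that the monomial g is trivial. -/
lemma centralizer_base_eq_bot (hk : 3 ≤ k) (h2 : (2 : K) ≠ 0)
    (hN : ∀ g ∈ G, ∀ a ∈ N, g * a * g⁻¹ ∈ N) {u : Module.Basis (WSpace k) K V}
    (hu : IsPauliBasis N u) {x₀ y₀ : V} (hxy : IsStartingPair G u x₀ y₀)
    {Ω₃ Ω₄ : Finset (WSpace k)} (hΩ : IsBasePartition G u x₀ y₀ Ω₃ Ω₄) :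
    vectorCentralizer G y₀ ⊓ vectorCentralizer G (x₀ + baseTail u Ω₄) = ⊥ := by
  classical
  rw [eq_bot_iff]
  intro g hg
  rw [Subgroup.mem_bot]
  obtain ⟨hgG, hgy, hgx⟩ := mem_inf_vectorCentralizer.1 hg
  have htail := baseTail_mem_offSpan (by omega) u Ω₄
  rw [map_add] at hgx
  obtain ⟨hgx₀, hgt⟩ := eq_of_mem_planeSpan_of_mem_offSpan u
    (map_planeSpan_le (by omega) h2 hN hu hxy.right_mem hxy.card_support hgG hgy _ hxy.left_mem)
    hxy.left_mem
    (map_offSpan_le (by omega) h2 hN hu hxy.right_mem hxy.card_support hgG hgy _ htail) htail hgx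
  have hg' : g ∈ vectorCentralizer G x₀ ⊓ vectorCentralizer G y₀ :=
    mem_inf_vectorCentralizer.2 ⟨hgG, hgx₀, hgy⟩
  obtain ⟨π, c, hm, hplane⟩ := exists_isMonomial_of_starting (by omega) h2 hN hu hxy hg'
  have hrepr : ∀ w, u.repr (baseTail u Ω₄) (π w) = c w * u.repr (baseTail u Ω₄) w := by
    intro w
    rw [← hm.repr_apply, hgt]
  have hπplane : ∀ w, π w ∈ plane k ↔ w ∈ plane k := by
    intro w
    constructor
    · intro h
      rwa [π.injective (hplane _ h).1] at h
    · intro h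
      rwa [(hplane w h).1]
  by_cases h16 : 2 ^ k ≠ 16
  · have hv : ∀ w, u.repr (baseTail u Ω₄) w = if w ∈ Ω₄ \ plane k then 1 else 0 := by
      intro w
      rw [baseTail, if_pos h16, repr_sum_basis]
    obtain ⟨hdisj, hcover, hreg⟩ := hΩ.1
    -- The support of v is Ω₄ outside the plane, and plane labels are fixed. Thus Ω₄ is preserved,
    -- and Ω₃ as well, being what is left apart from e₁ and e₂.
    have hΩ₄ : ∀ w, w ∈ Ω₄ → π w ∈ Ω₄ := by
      intro w hw
      by_cases hwp : w ∈ plane k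
      · rwa [(hplane w hwp).1]
      · have h1 := hrepr w
        rw [hv w, if_pos (Finset.mem_sdiff.2 ⟨hw, hwp⟩), mul_one, hv] at h1
        by_contra hne
        rw [if_neg (fun h => hne (Finset.mem_sdiff.1 h).1)] at h1
        exact Units.ne_zero _ h1.symm
    have himg4 : Ω₄.image π = Ω₄ :=
      Finset.eq_of_subset_of_card_le (fun x hx => by
        obtain ⟨w, hw, rfl⟩ := Finset.mem_image.1 hx
        exact hΩ₄ w hw) (by rw [Finset.card_image_of_injective _ π.injective])
    have hcov : ∀ w, w = eVec k 1 ∨ w = eVec k 2 ∨ w ∈ Ω₃ ∨ w ∈ Ω₄ := by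
      intro w
      have h1 : w ∈ Finset.univ.biUnion ![{eVec k 1}, {eVec k 2}, Ω₃, Ω₄] := by
        rw [hcover]; exact Finset.mem_univ _
      obtain ⟨i, -, hi⟩ := Finset.mem_biUnion.1 h1
      fin_cases i <;> simp_all
    have hd : ∀ i j, i ≠ j → ∀ w, w ∈ (![{eVec k 1}, {eVec k 2}, Ω₃, Ω₄] :
        Fin 4 → Finset (WSpace k)) i → w ∉ (![{eVec k 1}, {eVec k 2}, Ω₃, Ω₄] :
        Fin 4 → Finset (WSpace k)) j := fun i j hij w hw =>
        Finset.disjoint_left.1 (hdisj i j hij) hw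
    have hΩ₃ : ∀ w, w ∈ Ω₃ → π w ∈ Ω₃ := by
      intro w hw
      rcases hcov (π w) with h | h | h | h
      · rw [← (hplane _ eVec_one_mem_plane).1] at h
        exact absurd (by simp [π.injective h]) (hd 2 0 (by decide) w hw)
      · rw [← (hplane _ eVec_two_mem_plane).1] at h
        exact absurd (by simp [π.injective h]) (hd 2 1 (by decide) w hw)
      · exact h
      · rw [← himg4] at h
        obtain ⟨w', hw', h'⟩ := Finset.mem_image.1 h
        rw [π.injective h'] at hw'
        exact absurd hw' (hd 2 3 (by decide) w hw)
    have himg3 : Ω₃.image π = Ω₃ :=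
      Finset.eq_of_subset_of_card_le (fun x hx => by
        obtain ⟨w, hw, rfl⟩ := Finset.mem_image.1 hx
        exact hΩ₃ w hw) (by rw [Finset.card_image_of_injective _ π.injective])
    have hπ : π = 1 := by
      refine hreg π ⟨g, hg', fun w => ⟨c w, hm.apply w⟩⟩ fun i => ?_
      fin_cases i
      · simp [(hplane _ eVec_one_mem_plane).1]
      · simp [(hplane _ eVec_two_mem_plane).1]
      · exact himg3
      · exact himg4
    subst hπ
    refine hm.eq_one fun w => hm.coeff_eq_one (B := Ω₃) (fun x hx => ?_) (hΩ.2 h16) w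
    by_cases hxp : x ∈ plane k
    · exact (hplane x hxp).2
    · have hx4 : x ∈ Ω₄ := by
        rcases hcov x with h | h | h | h
        · exact absurd (h ▸ eVec_one_mem_plane) hxp
        · exact absurd (h ▸ eVec_two_mem_plane) hxp
        · exact absurd h hx
        · exact h
      have h1 := hrepr x
      rw [Equiv.Perm.one_apply, hv, if_pos (Finset.mem_sdiff.2 ⟨hx4, hxp⟩), mul_one] at h1
      exact Units.ext h1.symm
  · have hk4 : k = 4 := by
      rw [not_not] at h16
      exact Nat.pow_right_injective le_rfl (h16.trans (by norm_num : 16 = 2 ^ 4))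
    have h3p : eVec k 3 ∉ plane k := eVec_notMem_plane (by omega) (by omega) (by omega)
    have h4p : eVec k 4 ∉ plane k := eVec_notMem_plane (by omega) (by omega) (by omega)
    have h34 : eVec k 3 ≠ eVec k 4 := fun h => by
      simpa using eVec_injective (by omega) (by omega) h
    have hv : ∀ w, u.repr (baseTail u Ω₄) w = if w ∈ plane k then 0 else
        if w = eVec k 3 then 0 else if w = eVec k 4 then 2 else 1 := by
      intro w
      rw [baseTail, if_neg h16, zero_smul, zero_add, map_add, Finsupp.add_apply, repr_sum_basis,
        map_smul, Finsupp.smul_apply, Module.Basis.repr_self, Finsupp.single_apply]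
      by_cases hw : w ∈ plane k
      · have h4 : eVec k 4 ≠ w := fun h => h4p (h ▸ hw)
        simp [hw, h4]
      · by_cases hw3 : w = eVec k 3
        · simp [hw3, h3p, Ne.symm h34]
        · by_cases hw4 : w = eVec k 4
          · simp [hw4, h4p, Ne.symm h34]
          · simp [hw, hw3, hw4, Ne.symm hw4]
    -- Outside the plane and off these three labels, v has coordinate 1 at w and 0 or 1 at π w, and
    -- 0 would make the coefficient vanish. So the coefficient is 1 there, and 4 · 3 < 16. The
    -- coefficients must be settled before the value 2 can identify e₄.
    have hc1 : ∀ a, c a = 1 := by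
      refine hm.coeff_eq_one (B := {eVec k 3, eVec k 4, π.symm (eVec k 4)}) (fun w hw => ?_) ?_
      · simp only [Finset.mem_insert, Finset.mem_singleton, not_or] at hw
        by_cases hwp : w ∈ plane k
        · exact (hplane w hwp).2
        · have h1 := hrepr w
          rw [hv w, if_neg hwp, if_neg hw.1, if_neg hw.2.1, mul_one, hv,
            if_neg (mt (hπplane w).1 hwp)] at h1
          rw [if_neg (show ¬ π w = eVec k 4 from fun h => hw.2.2 (by rw [← h]; simp))] at h1
          split_ifs at h1
          · exact absurd h1.symm (Units.ne_zero _)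
          · exact Units.ext h1.symm
      · have h1 : ({eVec k 3, eVec k 4, π.symm (eVec k 4)} : Finset (WSpace k)).card ≤ 3 :=
          Finset.card_le_three
        rw [not_not] at h16
        omega
    have hπ3 : π (eVec k 3) = eVec k 3 := by
      have h1 := hrepr (eVec k 3)
      rw [hv (eVec k 3), if_neg h3p, if_pos rfl, mul_zero, hv,
        if_neg (mt (hπplane _).1 h3p)] at h1
      by_contra hne
      rw [if_neg hne] at h1
      split_ifs at h1
      · exact h2 h1
      · exact one_ne_zero h1
    have hπ4 : π (eVec k 4) = eVec k 4 := by
      have h1 := hrepr (eVec k 4)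
      rw [hv (eVec k 4), if_neg h4p, if_neg (Ne.symm h34), if_pos rfl, hv,
        if_neg (mt (hπplane _).1 h4p), hc1, Units.val_one, one_mul] at h1
      by_contra hne
      rw [if_neg hne] at h1
      split_ifs at h1
      · exact h2 h1.symm
      · exact one_ne_zero (α := K) (by linear_combination -h1)
    have hπ : π = 1 := by
      refine perm_eq_one hm.map_add fun j hj hjk => ?_
      obtain rfl | rfl | rfl | rfl : j = 1 ∨ j = 2 ∨ j = 3 ∨ j = 4 := by omega
      · exact (hplane _ eVec_one_mem_plane).1
      · exact (hplane _ eVec_two_mem_plane).1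
      · exact hπ3
      · exact hπ4
    subst hπ
    exact hm.eq_one hc1

end Base

end Pauli

/-! ### Recognizing dihedral and quaternion groups of order eight. -/

namespace Pauli

section Groups

variable {A : Type*} [Group A]

lemma pow_val_add {ρ : A} (h4 : ρ ^ 4 = 1) (i j : ZMod 4) :
    ρ ^ (i + j).val = ρ ^ i.val * ρ ^ j.val := by
  rw [ZMod.val_add, ← pow_eq_pow_mod _ h4, pow_add]

lemma pow_val_neg {ρ : A} (h4 : ρ ^ 4 = 1) (i : ZMod 4) : ρ ^ (-i).val = (ρ ^ i.val)⁻¹ := by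
  rw [eq_inv_iff_mul_eq_one, ← pow_val_add h4]
  simp

lemma pow_val_sub {ρ : A} (h4 : ρ ^ 4 = 1) (i j : ZMod 4) :
    ρ ^ (j - i).val = (ρ ^ i.val)⁻¹ * ρ ^ j.val := by
  rw [sub_eq_neg_add, pow_val_add h4, pow_val_neg h4]

lemma mul_pow_of_conj {ρ s : A} (hsρ : s * ρ * s⁻¹ = ρ⁻¹) (n : ℕ) :
    ρ ^ n * s = s * (ρ ^ n)⁻¹ := by
  have h : s * ρ ^ n * s⁻¹ = (ρ ^ n)⁻¹ := by rw [← conj_pow, hsρ, inv_pow]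
  have h' : s * (ρ ^ n)⁻¹ * s⁻¹ = ρ ^ n := by
    have h0 := congrArg (·⁻¹) h
    simpa [mul_assoc] using h0
  calc ρ ^ n * s = s * (ρ ^ n)⁻¹ * s⁻¹ * s := by rw [h']
    _ = _ := by group

lemma pow_val_eq_one {ρ : A} (h4 : ρ ^ 4 = 1) (h2 : ρ ^ 2 ≠ 1) {i : ZMod 4}
    (h : ρ ^ i.val = 1) : i = 0 := by
  have ho : orderOf ρ = 2 ^ (1 + 1) :=
    orderOf_eq_prime_pow (p := 2) (by simpa using h2) (by simpa using h4)
  have hd := orderOf_dvd_of_pow_eq_one h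
  rw [ho] at hd
  have hlt := ZMod.val_lt i
  rw [← ZMod.val_eq_zero]
  exact Nat.eq_zero_of_dvd_of_lt hd hlt

/-- Otherwise s would be a power of ρ and commute with it, giving ρ = ρ⁻¹. This yields injectivity
of the maps out of the dihedral and quaternion groups. -/
lemma reflection_ne_pow {ρ s : A} (h2 : ρ ^ 2 ≠ 1) (hsρ : s * ρ * s⁻¹ = ρ⁻¹) (n : ℕ) :
    s * ρ ^ n ≠ 1 := by
  intro h
  apply h2
  have hs : s = (ρ ^ n)⁻¹ := eq_inv_of_mul_eq_one_left h
  have hc : s * ρ * s⁻¹ = ρ := by rw [hs, ← zpow_natCast]; group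
  rw [hc] at hsρ
  rw [sq, ← eq_inv_iff_mul_eq_one, ← hsρ]

lemma nonempty_equiv_dihedral {ρ s : A} (h4 : ρ ^ 4 = 1) (h2 : ρ ^ 2 ≠ 1) (hs : s * s = 1)
    (hsρ : s * ρ * s⁻¹ = ρ⁻¹) :
    Nonempty (Subgroup.closure {ρ, s} ≃* DihedralGroup 4) := by
  let f : DihedralGroup 4 →* A :=
    MonoidHom.mk' (fun g => match g with
      | .r i => ρ ^ i.val
      | .sr i => s * ρ ^ i.val) (by
      rintro (i | i) (j | j)
      · exact pow_val_add h4 i j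
      · change s * ρ ^ (j - i).val = ρ ^ i.val * (s * ρ ^ j.val)
        rw [pow_val_sub h4, ← mul_assoc (ρ ^ i.val), mul_pow_of_conj hsρ, mul_assoc]
      · change s * ρ ^ (i + j).val = s * ρ ^ i.val * ρ ^ j.val
        rw [pow_val_add h4, mul_assoc]
      · change ρ ^ (j - i).val = s * ρ ^ i.val * (s * ρ ^ j.val)
        rw [pow_val_sub h4, mul_assoc s, ← mul_assoc (ρ ^ i.val), mul_pow_of_conj hsρ,
          ← mul_assoc, ← mul_assoc, hs, one_mul])
  have hf : Function.Injective f := by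
    rw [injective_iff_map_eq_one]
    rintro (i | i) h
    · rw [pow_val_eq_one h4 h2 h]; rfl
    · exact absurd h (reflection_ne_pow h2 hsρ _)
  have hr : f.range = Subgroup.closure {ρ, s} := by
    have hρ : ρ ∈ Subgroup.closure {ρ, s} := Subgroup.subset_closure (by simp)
    have hs' : s ∈ Subgroup.closure {ρ, s} := Subgroup.subset_closure (by simp)
    apply le_antisymm
    · rintro _ ⟨i | i, rfl⟩
      · exact Subgroup.pow_mem _ hρ _
      · exact Subgroup.mul_mem _ hs' (Subgroup.pow_mem _ hρ _)
    · rw [Subgroup.closure_le]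
      rintro x (rfl | rfl)
      · exact ⟨.r 1, pow_one x⟩
      · exact ⟨.sr 0, by change x * ρ ^ 0 = x; simp⟩
  rw [← hr]
  exact ⟨(f.ofInjective hf).symm⟩

lemma nonempty_equiv_quaternion {ρ s : A} (h4 : ρ ^ 4 = 1) (h2 : ρ ^ 2 ≠ 1) (hs : s * s = ρ ^ 2)
    (hsρ : s * ρ * s⁻¹ = ρ⁻¹) :
    Nonempty (Subgroup.closure {ρ, s} ≃* QuaternionGroup 2) := by
  let f : QuaternionGroup 2 →* A :=
    MonoidHom.mk' (fun g => match g with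
      -- `QuaternionGroup 2` is indexed by `ZMod (2 * 2)`; the ascription identifies this with `ZMod
      -- 4`.
      | .a i => ρ ^ (show ZMod 4 from i).val
      | .xa i => s * ρ ^ (show ZMod 4 from i).val) (by
      rintro (i | i) (j | j)
      · exact pow_val_add h4 i j
      · change s * ρ ^ (show ZMod 4 from j - i).val =
          ρ ^ (show ZMod 4 from i).val * (s * ρ ^ (show ZMod 4 from j).val)
        rw [← mul_assoc (ρ ^ _), mul_pow_of_conj hsρ, mul_assoc]
        exact congrArg _ (pow_val_sub h4 _ _)
      · change s * ρ ^ (show ZMod 4 from i + j).val =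
          s * ρ ^ (show ZMod 4 from i).val * ρ ^ (show ZMod 4 from j).val
        rw [mul_assoc]
        exact congrArg _ (pow_val_add h4 _ _)
      · change ρ ^ (show ZMod 4 from 2 + j - i).val =
          s * ρ ^ (show ZMod 4 from i).val * (s * ρ ^ (show ZMod 4 from j).val)
        rw [mul_assoc s, ← mul_assoc (ρ ^ _), mul_pow_of_conj hsρ,
          ← mul_assoc, ← mul_assoc, hs]
        have h5 : ρ ^ (show ZMod 4 from 2 + j - i).val = (ρ ^ (show ZMod 4 from i).val)⁻¹ *
            ρ ^ (show ZMod 4 from 2 + j).val := pow_val_sub h4 _ _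
        have h6 : ρ ^ (show ZMod 4 from 2 + j).val = ρ ^ (2 : ZMod 4).val *
            ρ ^ (show ZMod 4 from j).val := pow_val_add h4 _ _
        have h7 : (2 : ZMod 4).val = 2 := rfl
        rw [h5, h6, h7, ← mul_assoc]
        congr 1
        exact (((Commute.refl ρ).pow_pow _ _).inv_left).eq)
  have hf : Function.Injective f := by
    rw [injective_iff_map_eq_one]
    rintro (i | i) h
    · have h0 : (show ZMod 4 from i) = 0 := pow_val_eq_one h4 h2 h
      exact congrArg QuaternionGroup.a h0
    · exact absurd h (reflection_ne_pow h2 hsρ _)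
  have hr : f.range = Subgroup.closure {ρ, s} := by
    have hρ : ρ ∈ Subgroup.closure {ρ, s} := Subgroup.subset_closure (by simp)
    have hs' : s ∈ Subgroup.closure {ρ, s} := Subgroup.subset_closure (by simp)
    apply le_antisymm
    · rintro _ ⟨i | i, rfl⟩
      · exact Subgroup.pow_mem _ hρ _
      · exact Subgroup.mul_mem _ hs' (Subgroup.pow_mem _ hρ _)
    · rw [Subgroup.closure_le]
      rintro x (rfl | rfl)
      · exact ⟨.a 1, pow_one x⟩
      · exact ⟨.xa 0, by change x * ρ ^ 0 = x; simp⟩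
  rw [← hr]
  exact ⟨(f.ofInjective hf).symm⟩

lemma commute_closure {S T : Set A} (h : ∀ x ∈ S, ∀ y ∈ T, x * y = y * x) :
    ∀ a ∈ Subgroup.closure S, ∀ b ∈ Subgroup.closure T, a * b = b * a := by
  have h1 : Subgroup.closure S ≤ Subgroup.centralizer T := by
    rw [Subgroup.closure_le]
    intro x hx
    rw [SetLike.mem_coe, Subgroup.mem_centralizer_iff]
    intro y hy
    exact (h x hx y hy).symm
  have h3 : Subgroup.closure T ≤ Subgroup.centralizer (Subgroup.closure S : Set A) := by
    rw [Subgroup.closure_le]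
    intro y hy
    rw [SetLike.mem_coe, Subgroup.mem_centralizer_iff]
    intro x hx
    exact ((Subgroup.mem_centralizer_iff.1 (h1 hx)) y hy).symm
  intro a ha b hb
  exact (Subgroup.mem_centralizer_iff.1 (h3 hb)) a ha

end Groups

/-! ### Extraspecial groups and scalars. -/

section Extraspecial

variable {K V : Type*} [Field K] [AddCommGroup V] [Module K V] {N R : Subgroup (GLin K V)}

instance scalarSubgroup_normal : (scalarSubgroup K V).Normal := by
  constructor
  rintro _ ⟨l, rfl⟩ g
  refine ⟨l, ?_⟩
  change scal K V l = g * scal K V l * g⁻¹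
  rw [← scal_comm]; group

lemma scal_sq_eq_one [Nontrivial V] {l : Kˣ} (h : scal K V l ^ 2 = 1) : l = 1 ∨ l = -1 := by
  rw [← map_pow, ← map_one (scal K V)] at h
  have h1 := scal_injective h
  rw [sq] at h1
  have h3 : (l : K) * l = 1 := by simpa using congrArg Units.val h1
  rcases mul_self_eq_one_iff.1 h3 with h4 | h4
  · left; ext; simpa using h4
  · right; ext; simpa using h4

lemma eq_of_mem_inf [Nontrivial V] (hR : IsExtraspecialPart 2 N R) {l : Kˣ}
    (h : scal K V l ∈ R) : l = 1 ∨ l = -1 := by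
  apply scal_sq_eq_one (V := V)
  have h1 := pow_card_eq_one' (x := (⟨scal K V l, h, ⟨l, rfl⟩⟩ :
    (R ⊓ scalarSubgroup K V : Subgroup (GLin K V))))
  rw [hR.card_inf] at h1
  exact congrArg Subtype.val h1

lemma neg_one_ne_one_and_mem [Nontrivial V] (hR : IsExtraspecialPart 2 N R) :
    (-1 : Kˣ) ≠ 1 ∧ scal K V (-1) ∈ R := by
  have h1 : Nontrivial (R ⊓ scalarSubgroup K V : Subgroup (GLin K V)) := by
    have := Nat.finite_of_card_ne_zero (α := (R ⊓ scalarSubgroup K V : Subgroup (GLin K V)))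
      (by rw [hR.card_inf]; decide)
    rw [← Finite.one_lt_card_iff_nontrivial, hR.card_inf]
    decide
  obtain ⟨⟨_, hgR, ⟨l, rfl⟩⟩, hne⟩ := exists_ne (1 : (R ⊓ scalarSubgroup K V :
    Subgroup (GLin K V)))
  have hl : l ≠ 1 := by
    rintro rfl
    apply hne
    ext1
    exact map_one _
  have hl' := (eq_of_mem_inf hR (l := l) hgR).resolve_left hl
  subst hl'
  exact ⟨hl, hgR⟩

/-- The non-trivial element of R ∩ Z is a scalar with square 1, hence -1, so -1 ≠ 1 in K. -/
lemma two_ne_zero_of_extraspecial [Nontrivial V] (hR : IsExtraspecialPart 2 N R) :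
    (2 : K) ≠ 0 := by
  intro h
  apply (neg_one_ne_one_and_mem hR).1
  ext
  simp only [Units.val_neg, Units.val_one]
  linear_combination -h

lemma exists_mul_of_mem (hR : IsExtraspecialPart 2 N R) {n : GLin K V} (hn : n ∈ N) :
    ∃ l, scal K V l * n ∈ R := by
  rw [← hR.sup_eq, Subgroup.mem_sup_of_normal_right] at hn
  obtain ⟨r, hr, _, ⟨l, rfl⟩, rfl⟩ := hn
  refine ⟨l⁻¹, ?_⟩
  change scal K V l⁻¹ * (r * scal K V l) ∈ R
  rw [← scal_comm, map_inv, inv_mul_cancel_left]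
  exact hr

/-- R ∩ Z is contained in the centre of R, and both have order two. -/
lemma scalar_of_center [Nontrivial V] (hR : IsExtraspecialPart 2 N R) {r : GLin K V}
    (hr : r ∈ R) (h : ∀ s ∈ R, r * s = s * r) : ∃ l, r = scal K V l := by
  have hle : R ⊓ scalarSubgroup K V ≤ (Subgroup.center R).map R.subtype := by
    rintro _ ⟨hgR, ⟨l, rfl⟩⟩
    refine ⟨⟨_, hgR⟩, ?_, rfl⟩
    rw [SetLike.mem_coe, Subgroup.mem_center_iff]
    intro g
    ext1
    exact (scal_comm l g.1).symm
  have hcard : Nat.card ((Subgroup.center R).map R.subtype) = 2 := by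
    rw [← hR.extraspecial.card_center]
    exact (Nat.card_congr ((Subgroup.center R).equivMapOfInjective _
      R.subtype_injective).toEquiv).symm
  have hfin : Finite ((Subgroup.center R).map R.subtype) :=
    Nat.finite_of_card_ne_zero (by rw [hcard]; decide)
  have heq := Subgroup.eq_of_le_of_card_ge hle (by rw [hcard, hR.card_inf])
  have hmem : r ∈ (Subgroup.center R).map R.subtype := by
    refine ⟨⟨r, hr⟩, ?_, rfl⟩
    rw [SetLike.mem_coe, Subgroup.mem_center_iff]
    intro g
    ext1
    exact (h g.1 g.2).symm
  rw [← heq] at hmem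
  obtain ⟨l, hl⟩ := hmem.2
  exact ⟨l, hl.symm⟩

lemma scalar_of_commute [Nontrivial V] (hR : IsExtraspecialPart 2 N R) {n : GLin K V}
    (hn : n ∈ N) (h : ∀ s ∈ N, n * s = s * n) : ∃ l, n = scal K V l := by
  obtain ⟨l, hl⟩ := exists_mul_of_mem hR hn
  obtain ⟨l', hl'⟩ := scalar_of_center hR hl (fun s hs => by
    have hsN : s ∈ N := hR.sup_eq ▸ (le_sup_left : R ≤ R ⊔ scalarSubgroup K V) hs
    rw [mul_assoc, h s hsN, ← mul_assoc, scal_comm, mul_assoc])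
  refine ⟨l⁻¹ * l', ?_⟩
  rw [map_mul, ← hl', map_inv, inv_mul_cancel_left]

/-- After scaling into R the square is central in R, hence a scalar in R, hence ±1. -/
lemma exists_sq_eq [Nontrivial V] (hR : IsExtraspecialPart 2 N R) {n : GLin K V}
    (hn : n ∈ N) :
    ∃ l, scal K V l * n ∈ R ∧ ((scal K V l * n) * (scal K V l * n) = 1 ∨
      (scal K V l * n) * (scal K V l * n) = scal K V (-1)) := by
  obtain ⟨l, hl⟩ := exists_mul_of_mem hR hn
  refine ⟨l, hl, ?_⟩
  rw [← sq]
  have h1 := hR.extraspecial.pow_mem_center ⟨_, hl⟩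
  obtain ⟨l', hl'⟩ := scalar_of_center hR (R.pow_mem hl 2) (fun s hs =>
    (congrArg Subtype.val (Subgroup.mem_center_iff.1 h1 ⟨s, hs⟩)).symm)
  have hmem : scal K V l' ∈ R := hl' ▸ R.pow_mem hl 2
  rw [hl']
  rcases eq_of_mem_inf hR hmem with rfl | rfl
  · left; exact map_one _
  · right; rfl

/-- The commutator of a and b is a scalar l, and since a² is a scalar, commuting it with b gives l²
= 1. -/
lemma commute_or_anticommute [Nontrivial V]
    (hcomm : ∀ a ∈ N, ∀ b ∈ N, a * b * a⁻¹ * b⁻¹ ∈ scalarSubgroup K V)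
    (hpow : ∀ a ∈ N, a ^ 2 ∈ scalarSubgroup K V) {a b : GLin K V} (ha : a ∈ N) (hb : b ∈ N) :
    a * b = b * a ∨ a * b = scal K V (-1) * (b * a) := by
  obtain ⟨l, hl⟩ := hcomm a ha b hb
  obtain ⟨m, hm⟩ := hpow a ha
  change scal K V l = _ at hl
  change scal K V m = _ at hm
  have h1 : a * b = scal K V l * (b * a) := by rw [hl]; group
  have h3 : scal K V l ^ 2 = 1 := by
    have h4 : a ^ 2 * b = scal K V l ^ 2 * (b * a ^ 2) := by
      rw [sq a, mul_assoc, h1, ← mul_assoc a, ← scal_comm, mul_assoc, ← mul_assoc a, h1, sq (scal K V l)]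
      simp only [mul_assoc]
    rw [← hm, scal_comm] at h4
    exact (mul_eq_right.1 h4.symm)
  rcases scal_sq_eq_one h3 with rfl | rfl
  · left; rw [h1, map_one, one_mul]
  · right; exact h1

end Extraspecial

end Pauli

/-! ### Hyperbolic systems. -/

namespace Pauli

variable {K V : Type*} [Field K] [AddCommGroup V] [Module K V] {N R : Subgroup (GLin K V)}

lemma IsAbsolutelyIrreducible.eq_bot_or_top (hN : IsAbsolutelyIrreducible N) (U : Submodule K V)
    (hU : ∀ g ∈ N, ∀ v ∈ U, g v ∈ U) : U = ⊥ ∨ U = ⊤ := by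
  have h := hN.2 (U.baseChange (AlgebraicClosure K)) (fun g hg w hw => by
    rw [Submodule.baseChange_eq_span] at hw ⊢
    induction hw using Submodule.span_induction with
    | mem x hx =>
      obtain ⟨v, hv, rfl⟩ := hx
      refine Submodule.subset_span ⟨g v, hU g hg v hv, ?_⟩
      simp
    | zero => simp
    | add x y _ _ hx hy => rw [map_add]; exact Submodule.add_mem _ hx hy
    | smul a x _ hx => rw [map_smul]; exact Submodule.smul_mem _ _ hx)
  rcases h with h | h
  · left
    apply Submodule.baseChange_injective (A := AlgebraicClosure K)
    rw [h, Submodule.baseChange_bot]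
  · right
    apply Submodule.baseChange_injective (A := AlgebraicClosure K)
    rw [h, Submodule.baseChange_top]

/-- A hyperbolic system of rank `m` in `N`: two elementary abelian groups indexed by `𝔽₂ᵐ` whose
commutators are given by the dot product. -/
structure IsHyperbolic {m : ℕ} (N : Subgroup (GLin K V)) (X Z : WSpace m → GLin K V) : Prop where
  mem_left : ∀ a, X a ∈ N
  mem_right : ∀ b, Z b ∈ N
  left_add : ∀ a a', X (a + a') = X a * X a'
  right_add : ∀ b b', Z (b + b') = Z b * Z b'
  comm : ∀ b a, Z b * X a = scal K V (sgn K (b ⬝ᵥ a)) * (X a * Z b)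

section Hyperbolic

variable {m : ℕ} {X Z : WSpace m → GLin K V} (h : IsHyperbolic N X Z)

include h

lemma IsHyperbolic.left_zero : X 0 = 1 := by
  have := h.left_add 0 0
  rw [add_zero] at this
  exact left_eq_mul.1 this

lemma IsHyperbolic.right_zero : Z 0 = 1 := by
  have := h.right_add 0 0
  rw [add_zero] at this
  exact left_eq_mul.1 this

lemma IsHyperbolic.left_mul_self (a : WSpace m) : X a * X a = 1 := by
  rw [← h.left_add, add_self_eq_zero, h.left_zero]

lemma IsHyperbolic.right_mul_self (b : WSpace m) : Z b * Z b = 1 := by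
  rw [← h.right_add, add_self_eq_zero, h.right_zero]

lemma IsHyperbolic.left_comm (a a' : WSpace m) : X a * X a' = X a' * X a := by
  rw [← h.left_add, add_comm, h.left_add]

lemma IsHyperbolic.right_comm (b b' : WSpace m) : Z b * Z b' = Z b' * Z b := by
  rw [← h.right_add, add_comm, h.right_add]

lemma IsHyperbolic.comm_apply (b a : WSpace m) (v : V) :
    Z b (X a v) = sgn K (b ⬝ᵥ a) • X a (Z b v) :=
  congrArg (fun g : GLin K V => g v) (h.comm b a)

/-- Every vector ∑_b Z_b w is fixed by all Z_b. These cannot all vanish, since conjugating the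
operator ∑_b Z_b by the X_a and summing gives 2^m times the identity. -/
lemma IsHyperbolic.exists_fixed [Nontrivial V] (h2 : (2 : K) ≠ 0) :
    ∃ v : V, v ≠ 0 ∧ ∀ b, Z b v = v := by
  classical
  obtain ⟨v, hv⟩ := exists_ne (0 : V)
  have hfix : ∀ w : V, ∀ b, Z b (∑ b', Z b' w) = ∑ b', Z b' w := by
    intro w b
    rw [map_sum, ← Equiv.sum_comp (Equiv.addLeft b)]
    refine Finset.sum_congr rfl fun b' _ => ?_
    rw [Equiv.coe_addLeft, h.right_add, ← LinearEquiv.mul_apply, ← mul_assoc, h.right_mul_self,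
      one_mul]
  by_contra! hcon
  have hzero : ∀ a, ∑ b, Z b (X a v) = 0 := by
    intro a
    by_contra hne
    obtain ⟨b, hb⟩ := hcon _ hne
    exact hb (hfix _ b)
  have hsum : ∑ a, X a (∑ b, Z b (X a v)) = (2 ^ m : K) • v := by
    have h1 : ∀ a b, X a (Z b (X a v)) = (sgn K (b ⬝ᵥ a) : K) • Z b v := by
      intro a b
      rw [h.comm_apply, Units.smul_def, map_smul, ← LinearEquiv.mul_apply, h.left_mul_self]
      rfl
    simp only [map_sum, h1]
    rw [Finset.sum_comm]
    simp only [← Finset.sum_smul]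
    rw [Finset.sum_eq_single 0 (fun b _ hb => by rw [sum_sgn_dot b hb, zero_smul]) (by simp)]
    simp [h.right_zero, ZMod.card]
  simp only [hzero, map_zero, Finset.sum_const_zero] at hsum
  exact (smul_ne_zero (pow_ne_zero m h2) hv) hsum.symm

lemma IsHyperbolic.right_apply_orbit {v : V} (hv : ∀ b, Z b v = v) (b w : WSpace m) :
    Z b (X w v) = sgn K (b ⬝ᵥ w) • X w v := by
  rw [h.comm_apply, hv]

/-- The vectors X_w v are common eigenvectors of the Z_b with distinct characters; the weighted sum
over b projects to the one labelled w₀. -/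
lemma IsHyperbolic.linearIndependent (h2 : (2 : K) ≠ 0) {v : V} (hv0 : v ≠ 0)
    (hv : ∀ b, Z b v = v) : LinearIndependent K fun w => X w v := by
  classical
  rw [Fintype.linearIndependent_iff]
  intro c hc w₀
  have h1 : ∑ b, (sgn K (b ⬝ᵥ w₀) : K) • Z b (∑ w, c w • X w v) =
      (2 ^ m * c w₀ : K) • X w₀ v := by
    simp only [map_sum, map_smul, h.right_apply_orbit hv, Finset.smul_sum, Units.smul_def,
      smul_smul]
    rw [Finset.sum_comm]
    simp only [← Finset.sum_smul]
    have h3 : ∀ w, ∑ b : WSpace m, (sgn K (b ⬝ᵥ w₀) : K) * (c w * sgn K (b ⬝ᵥ w)) =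
        c w * ∑ b : WSpace m, (sgn K ((w₀ + w) ⬝ᵥ b) : K) := by
      intro w
      rw [Finset.mul_sum]
      refine Finset.sum_congr rfl fun b _ => ?_
      rw [dotProduct_comm (w₀ + w), dotProduct_add, sgn_add]
      push_cast
      ring
    rw [Finset.sum_eq_single w₀ (fun w _ hw => ?_) (by simp)]
    · rw [h3, add_self_eq_zero]
      simp [ZMod.card, mul_comm]
    · rw [h3, sum_sgn_dot, mul_zero, zero_smul]
      intro h0
      exact hw ((add_add_cancel w₀ w).symm.trans (by rw [h0, add_zero]))
  simp only [hc, map_zero, smul_zero, Finset.sum_const_zero] at h1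
  have hX : X w₀ v ≠ 0 := fun h0 => hv0 ((X w₀).map_eq_zero_iff.1 h0)
  have h4 := (smul_eq_zero.1 h1.symm).resolve_right hX
  exact (mul_eq_zero.1 h4).resolve_left (pow_ne_zero m h2)

/-- Every element of `N` can be moved into the centralizer of a hyperbolic system. -/
lemma IsHyperbolic.exists_commuting [Nontrivial V]
    (hpm : ∀ a ∈ N, ∀ b ∈ N, a * b = b * a ∨ a * b = scal K V (-1) * (b * a))
    {n : GLin K V} (hn : n ∈ N) :
    ∃ a b, (∀ a', X a * Z b * n * X a' = X a' * (X a * Z b * n)) ∧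
      ∀ b', X a * Z b * n * Z b' = Z b' * (X a * Z b * n) := by
  have hex : ∀ (Y : WSpace m → GLin K V), (∀ a, Y a ∈ N) → (∀ a a', Y (a + a') = Y a * Y a') →
      ∃ b : WSpace m, ∀ a, n * Y a = scal K V (sgn K (b ⬝ᵥ a)) * (Y a * n) := by
    intro Y hY hYadd
    have h1 : ∀ a, ∃ μ, n * Y a = scal K V μ * (Y a * n) := by
      intro a
      rcases hpm n hn (Y a) (hY a) with h1 | h1
      · exact ⟨1, by rw [h1, map_one, one_mul]⟩
      · exact ⟨-1, h1⟩
    choose μ hμ using h1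
    obtain ⟨b, hb⟩ := exists_sgn_dot μ (fun a w => by
      apply scal_injective (K := K) (V := V)
      have h3 : scal K V (μ (a + w)) * (Y (a + w) * n) =
          scal K V (μ a * μ w) * (Y (a + w) * n) := by
        rw [← hμ, hYadd, ← mul_assoc, hμ, mul_assoc, mul_assoc, hμ, ← mul_assoc (Y a),
          ← scal_comm, map_mul]
        simp only [mul_assoc]
      exact mul_right_cancel h3)
    exact ⟨b, fun a => by rw [hμ, hb]⟩
  -- The roles cross over: Z_b corrects the commutation of n with the X's, and X_a its commutation
  -- with the Z's.
  obtain ⟨b, hb⟩ := hex X h.mem_left h.left_add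
  obtain ⟨a, ha⟩ := hex Z h.mem_right h.right_add
  refine ⟨a, b, fun a' => ?_, fun b' => ?_⟩
  · calc X a * Z b * n * X a' = X a * Z b * (n * X a') := by simp only [mul_assoc]
      _ = X a * Z b * scal K V (sgn K (b ⬝ᵥ a')) * (X a' * n) := by
        rw [hb]; simp only [mul_assoc]
      _ = scal K V (sgn K (b ⬝ᵥ a')) * (X a * (Z b * X a')) * n := by
        rw [← scal_comm]; simp only [mul_assoc]
      _ = scal K V (sgn K (b ⬝ᵥ a')) * (X a * scal K V (sgn K (b ⬝ᵥ a'))) * (X a' * Z b) * n := by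
        rw [h.comm]; simp only [mul_assoc]
      _ = scal K V (sgn K (b ⬝ᵥ a') * sgn K (b ⬝ᵥ a')) * (X a * X a') * Z b * n := by
        rw [← scal_comm, map_mul]; simp only [mul_assoc]
      _ = X a' * (X a * Z b * n) := by
        rw [sgn_mul_self, map_one, one_mul, h.left_comm]; simp only [mul_assoc]
  · have h3 : X a * Z b' = scal K V (sgn K (a ⬝ᵥ b')) * (Z b' * X a) := by
      rw [h.comm, ← mul_assoc, ← map_mul, dotProduct_comm, sgn_mul_self, map_one, one_mul]
    calc X a * Z b * n * Z b' = X a * Z b * (n * Z b') := by simp only [mul_assoc]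
      _ = X a * Z b * scal K V (sgn K (a ⬝ᵥ b')) * (Z b' * n) := by
        rw [ha]; simp only [mul_assoc]
      _ = scal K V (sgn K (a ⬝ᵥ b')) * (X a * (Z b * Z b')) * n := by
        rw [← scal_comm]; simp only [mul_assoc]
      _ = scal K V (sgn K (a ⬝ᵥ b')) * (X a * Z b') * Z b * n := by
        rw [h.right_comm]; simp only [mul_assoc]
      _ = scal K V (sgn K (a ⬝ᵥ b') * sgn K (a ⬝ᵥ b')) * (Z b' * X a) * Z b * n := by
        rw [h3, map_mul]; simp only [mul_assoc]
      _ = Z b' * (X a * Z b * n) := by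
        rw [sgn_mul_self, map_one, one_mul]; simp only [mul_assoc]

lemma IsHyperbolic.eq_of_commuting {n n' : GLin K V} {a b : WSpace m}
    (hn : X a * Z b * n = n') : n = Z b * (X a * n') := by
  rw [← hn]
  simp only [← mul_assoc]
  rw [mul_assoc (Z b), h.left_mul_self, mul_one, h.right_mul_self, one_mul]

/-- A hyperbolic system of full rank gives a basis in which `N` is the Pauli group. -/
lemma IsHyperbolic.exists_isPauliBasis [Nontrivial V] (h2 : (2 : K) ≠ 0)
    (hZ : scalarSubgroup K V ≤ N)
    (hpm : ∀ a ∈ N, ∀ b ∈ N, a * b = b * a ∨ a * b = scal K V (-1) * (b * a))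
    (hdim : Module.finrank K V = 2 ^ m) :
    ∃ u : Module.Basis (WSpace m) K V, IsPauliBasis N u := by
  obtain ⟨v, hv0, hv⟩ := h.exists_fixed h2
  have hli := h.linearIndependent h2 hv0 hv
  have hcard : Fintype.card (WSpace m) = Module.finrank K V := by
    rw [hdim]; simp [ZMod.card]
  let u := basisOfLinearIndependentOfCardEqFinrank hli hcard
  have hu : ∀ w, u w = X w v := fun w => by
    simp [u]
  have hpX : ∀ a, pauli u 1 a 0 = X a := fun a => basis_ext u fun w => by
    rw [pauli_apply, hu, hu, h.left_add]
    simp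
  have hpZ : ∀ b, pauli u 1 0 b = Z b := fun b => basis_ext u fun w => by
    rw [pauli_apply, one_mul, zero_add, hu, h.right_apply_orbit hv]
  refine ⟨u, fun g => ⟨fun hg => ?_, ?_⟩⟩
  · obtain ⟨a, b, hX', hZ'⟩ := h.exists_commuting hpm hg
    set n := X a * Z b * g with hn
    -- The trivial character of the Z_b occurs only on the line of v, so n preserves this line;
    -- commuting with the X_w, it is the same scalar on the whole basis.
    have hfix : ∀ b', Z b' (n v) = n v := by
      intro b'
      rw [← LinearEquiv.mul_apply, ← hZ', LinearEquiv.mul_apply, hv]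
    have hco : n v = u.repr (n v) 0 • v := by
      apply u.ext_elem
      intro w
      have hv' : v = u 0 := by rw [hu, h.left_zero]; rfl
      rw [map_smul, Finsupp.smul_apply]
      nth_rewrite 3 [hv']
      rw [Module.Basis.repr_self, smul_eq_mul]
      by_cases hw : w = 0
      · simp [hw]
      · rw [Finsupp.single_eq_of_ne hw, mul_zero]
        obtain ⟨b', hb'⟩ := exists_dot_ne hw
        rw [dotProduct_zero] at hb'
        have h3 := congrArg (fun x => u.repr x w) (hfix b')
        simp only [← hpZ, repr_pauli_zero, one_mul, (zmod_two_cases _).resolve_left hb',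
          sgn_one] at h3
        exact eq_zero_of_fixed_neg h2 h3.symm
    have hne : u.repr (n v) 0 ≠ 0 := by
      intro h0
      rw [h0, zero_smul] at hco
      exact hv0 (n.map_eq_zero_iff.1 hco)
    obtain ⟨l, hl⟩ : ∃ l : Kˣ, n v = (l : K) • v := ⟨Units.mk0 _ hne, hco⟩
    have hscal : n = scal K V l := by
      apply basis_ext u
      intro w
      rw [hu, ← LinearEquiv.mul_apply, hX', LinearEquiv.mul_apply, hl, map_smul]
      rfl
    have h4 := h.eq_of_commuting hn.symm
    have hmem : g ∈ pauliGroup u := by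
      rw [h4, hscal, ← hpX, ← hpZ, ← pauli_scal u]
      exact Subgroup.mul_mem _ ⟨_, _, _, rfl⟩ (Subgroup.mul_mem _ ⟨_, _, _, rfl⟩ ⟨_, _, _, rfl⟩)
    exact hmem
  · rintro ⟨l, a, b, rfl⟩
    have h3 : pauli u l a b = scal K V (l * sgn K (b ⬝ᵥ a)) * Z b * X a := by
      rw [← hpX, ← hpZ, ← pauli_scal u, pauli_mul, pauli_mul]
      simp [mul_assoc]
    rw [h3]
    exact N.mul_mem (N.mul_mem (hZ ⟨_, rfl⟩) (h.mem_right b)) (h.mem_left a)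

/-- A hyperbolic system of non-maximal rank is centralized by a non-scalar element. -/
lemma IsHyperbolic.exists_nonscalar [Nontrivial V] (h2 : (2 : K) ≠ 0)
    (hirr : IsAbsolutelyIrreducible N)
    (hpm : ∀ a ∈ N, ∀ b ∈ N, a * b = b * a ∨ a * b = scal K V (-1) * (b * a))
    (hdim : 2 ^ m < Module.finrank K V) :
    ∃ c ∈ N, (∀ a, c * X a = X a * c) ∧ (∀ b, c * Z b = Z b * c) ∧
      ∀ l, c ≠ scal K V l := by
  -- If only scalars centralize the system, every element of `N` is a scalar times some Z_b X_a.
  -- Then the span of the X_w v is invariant, of dimension at most 2^m, against irreducibility.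
  by_contra! hcon
  obtain ⟨v, hv0, hv⟩ := h.exists_fixed h2
  let U : Submodule K V := Submodule.span K (Set.range fun w => X w v)
  have hU : ∀ g ∈ N, ∀ x ∈ U, g x ∈ U := by
    intro g hg
    obtain ⟨a, b, hX', hZ'⟩ := h.exists_commuting hpm hg
    obtain ⟨l, hl⟩ := hcon (X a * Z b * g)
      (N.mul_mem (N.mul_mem (h.mem_left a) (h.mem_right b)) hg) hX' hZ'
    have hg' := h.eq_of_commuting hl
    have hle : U ≤ U.comap (g : V →ₗ[K] V) := by
      rw [Submodule.span_le]
      rintro _ ⟨w, rfl⟩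
      change g (X w v) ∈ U
      have h1 : g (X w v) = (sgn K (b ⬝ᵥ (a + w)) * l) • X (a + w) v := by
        rw [hg', ← scal_comm l (X a)]
        simp only [LinearEquiv.mul_apply]
        rw [← LinearEquiv.mul_apply (X a), ← h.left_add, scal_apply, Units.smul_def, map_smul,
          h.right_apply_orbit hv, ← Units.smul_def, smul_smul, mul_comm]
      rw [h1]
      exact U.smul_mem _ (Submodule.subset_span ⟨_, rfl⟩)
    exact fun x hx => hle hx
  have hfin : Module.finrank K U ≤ 2 ^ m := by
    refine (finrank_range_le_card (R := K) fun w => X w v).trans ?_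
    simp [ZMod.card]
  rcases IsAbsolutelyIrreducible.eq_bot_or_top hirr U hU with h0 | h0
  · have : X 0 v ∈ U := Submodule.subset_span ⟨0, rfl⟩
    rw [h0, Submodule.mem_bot, h.left_zero] at this
    exact hv0 this
  · rw [h0, finrank_top] at hfin
    omega

/-- Extension of a hyperbolic system by a hyperbolic pair. -/
lemma IsHyperbolic.extend {c d : GLin K V} (hc : c ∈ N) (hd : d ∈ N)
    (hcX : ∀ a, c * X a = X a * c) (hcZ : ∀ b, c * Z b = Z b * c)
    (hdX : ∀ a, d * X a = X a * d) (hdZ : ∀ b, d * Z b = Z b * d)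
    (hcc : c * c = 1) (hdd : d * d = 1) (hdc : d * c = scal K V (-1) * (c * d)) :
    ∃ X' Z' : WSpace (m + 1) → GLin K V, IsHyperbolic N X' Z' := by
  have hpow : ∀ {e : GLin K V}, e * e = 1 → ∀ i j : ZMod 2,
      e ^ (i + j).val = e ^ i.val * e ^ j.val := by
    intro e he i j
    rw [ZMod.val_add, ← pow_eq_pow_mod _ (by rw [sq, he]), pow_add]
  have hcomm : ∀ i j : ZMod 2, d ^ i.val * c ^ j.val =
      scal K V (sgn K (i * j)) * (c ^ j.val * d ^ i.val) := by
    intro i j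
    rcases zmod_two_cases i with rfl | rfl <;> rcases zmod_two_cases j with rfl | rfl <;>
      simp only [mul_zero, mul_one, ZMod.val_zero, ZMod.val_one, pow_zero, pow_one,
        sgn_zero, sgn_one, map_one, one_mul, hdc]
  have hcp : ∀ {e : GLin K V} {Y : WSpace m → GLin K V}, (∀ a, e * Y a = Y a * e) → ∀ n a,
      e ^ n * Y a = Y a * e ^ n := fun he n a => ((show Commute _ _ from he a).pow_left n).eq
  refine ⟨fun a => X (fun i => a i.castSucc) * c ^ (a (Fin.last m)).val,
    fun b => Z (fun i => b i.castSucc) * d ^ (b (Fin.last m)).val, ?_, ?_, ?_, ?_, ?_⟩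
  · exact fun a => N.mul_mem (h.mem_left _) (N.pow_mem hc _)
  · exact fun b => N.mul_mem (h.mem_right _) (N.pow_mem hd _)
  · intro a a'
    change X ((fun i => a i.castSucc) + fun i => a' i.castSucc) *
      c ^ (a (Fin.last m) + a' (Fin.last m)).val = _
    rw [h.left_add, hpow hcc, mul_assoc, mul_assoc, ← mul_assoc (X fun i => a' i.castSucc),
      ← hcp hcX]
    simp only [mul_assoc]
  · intro b b'
    change Z ((fun i => b i.castSucc) + fun i => b' i.castSucc) *
      d ^ (b (Fin.last m) + b' (Fin.last m)).val = _
    rw [h.right_add, hpow hdd, mul_assoc, mul_assoc, ← mul_assoc (Z fun i => b' i.castSucc),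
      ← hcp hdZ]
    simp only [mul_assoc]
  · intro b a
    have hdot : b ⬝ᵥ a = (fun i : Fin m => b i.castSucc) ⬝ᵥ (fun i => a i.castSucc) +
        b (Fin.last m) * a (Fin.last m) := by
      simp only [dotProduct]
      rw [Fin.sum_univ_castSucc]
    change Z (fun i => b i.castSucc) * d ^ (b (Fin.last m)).val *
      (X (fun i => a i.castSucc) * c ^ (a (Fin.last m)).val) = scal K V (sgn K (b ⬝ᵥ a)) *
      (X (fun i => a i.castSucc) * c ^ (a (Fin.last m)).val *
        (Z (fun i => b i.castSucc) * d ^ (b (Fin.last m)).val))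
    rw [hdot, sgn_add, map_mul]
    generalize (fun i : Fin m => b i.castSucc) = β
    generalize (fun i : Fin m => a i.castSucc) = α
    generalize b (Fin.last m) = i
    generalize a (Fin.last m) = j
    calc Z β * d ^ i.val * (X α * c ^ j.val) = Z β * (d ^ i.val * X α) * c ^ j.val := by
          simp only [mul_assoc]
      _ = Z β * X α * (d ^ i.val * c ^ j.val) := by rw [hcp hdX]; simp only [mul_assoc]
      _ = scal K V (sgn K (β ⬝ᵥ α)) * (X α * Z β * scal K V (sgn K (i * j)) *
          (c ^ j.val * d ^ i.val)) := by rw [hcomm, h.comm]; simp only [mul_assoc]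
      _ = scal K V (sgn K (β ⬝ᵥ α)) * scal K V (sgn K (i * j)) *
          (X α * (Z β * c ^ j.val) * d ^ i.val) := by rw [← scal_comm]; simp only [mul_assoc]
      _ = _ := by rw [← hcp hcZ]; simp only [mul_assoc]

end Hyperbolic

end Pauli

/-! ### Maximal hyperbolic systems and existence of a Pauli basis. -/

namespace Pauli

variable {K V : Type*} [Field K] [AddCommGroup V] [Module K V] {N R : Subgroup (GLin K V)}

lemma scal_neg_one_mul_self : scal K V (-1) * scal K V (-1) = 1 := by
  rw [← map_mul, neg_mul_neg, one_mul, map_one]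

lemma neg_mul_comm_of {c d : GLin K V} (h : d * c = scal K V (-1) * (c * d)) :
    c * d = scal K V (-1) * (d * c) := by
  rw [h, ← mul_assoc, scal_neg_one_mul_self, one_mul]

/-- The elements of `N` commuting with a hyperbolic system. -/
def hypCentralizer {m : ℕ} (N : Subgroup (GLin K V)) (X Z : WSpace m → GLin K V) :
    Subgroup (GLin K V) :=
  N ⊓ Subgroup.centralizer (Set.range X ∪ Set.range Z)

lemma mem_hypCentralizer {m : ℕ} {X Z : WSpace m → GLin K V} {n : GLin K V} :
    n ∈ hypCentralizer N X Z ↔ n ∈ N ∧ (∀ a, n * X a = X a * n) ∧ ∀ b, n * Z b = Z b * n := by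
  rw [hypCentralizer, Subgroup.mem_inf, Subgroup.mem_centralizer_iff]
  refine and_congr_right fun _ => ⟨fun h => ⟨fun a => (h _ (Or.inl ⟨a, rfl⟩)).symm,
    fun b => (h _ (Or.inr ⟨b, rfl⟩)).symm⟩, ?_⟩
  rintro ⟨h1, h2⟩ _ (⟨a, rfl⟩ | ⟨b, rfl⟩)
  · exact (h1 a).symm
  · exact (h2 b).symm

/-- A multiple l n in R also has square ±1, so l² = ±1. As -1 is not a square, l = ±1, and both of
these scalars lie in R. -/
lemma mem_of_mul_self [Nontrivial V] (hR : IsExtraspecialPart 2 N R)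
    (hsq : ∀ i : Kˣ, i * i ≠ -1) {n : GLin K V} (hn : n ∈ N)
    (h : n * n = 1 ∨ n * n = scal K V (-1)) : n ∈ R := by
  obtain ⟨l, hl, hll⟩ := exists_sq_eq hR hn
  have h1 : scal K V (l * l) * (n * n) = scal K V l * n * (scal K V l * n) := by
    calc scal K V (l * l) * (n * n) = scal K V l * (scal K V l * n) * n := by
          rw [map_mul]; simp only [mul_assoc]
      _ = _ := by rw [scal_comm]; simp only [mul_assoc]
  have h3 : ∃ ε : Kˣ, (ε = 1 ∨ ε = -1) ∧ scal K V (l * l) = scal K V ε := by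
    rcases h with h | h <;> rcases hll with h' | h' <;> rw [h, h'] at h1
    · exact ⟨1, Or.inl rfl, by rw [← h1.trans (map_one _).symm, mul_one]⟩
    · exact ⟨-1, Or.inr rfl, by rw [← h1, mul_one]⟩
    · exact ⟨-1, Or.inr rfl, (eq_inv_of_mul_eq_one_left h1).trans
        (inv_eq_of_mul_eq_one_left scal_neg_one_mul_self)⟩
    · exact ⟨1, Or.inl rfl, by rw [map_one]; exact mul_eq_right.1 h1⟩
  obtain ⟨ε, hε, h4⟩ := h3
  have h5 := scal_injective h4
  have hl1 : scal K V l ∈ R := by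
    have hl2 : l * l = 1 := hε.elim (fun h => h5.trans h) (fun h => absurd (h5.trans h) (hsq l))
    have h6 : (l : K) * l = 1 := by simpa using congrArg Units.val hl2
    rcases mul_self_eq_one_iff.1 h6 with h7 | h7
    · have : l = 1 := by ext; simpa using h7
      rw [this, map_one]
      exact R.one_mem
    · have : l = -1 := by ext; simpa using h7
      rw [this]
      exact (neg_one_ne_one_and_mem hR).2
  exact (R.mul_mem_cancel_left hl1).1 hl

section Step

variable {m : ℕ} {X Z : WSpace m → GLin K V} (h : IsHyperbolic N X Z)

include h

/-- A non-scalar e fails to commute with some n in `N`. Moving n into the centralizer multiplies it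
by elements that commute with e, so it still fails to commute. -/
lemma IsHyperbolic.exists_anticommuting [Nontrivial V]
    (hpm : ∀ a ∈ N, ∀ b ∈ N, a * b = b * a ∨ a * b = scal K V (-1) * (b * a))
    (hcent : ∀ n ∈ N, (∀ s ∈ N, n * s = s * n) → ∃ l, n = scal K V l)
    {e : GLin K V} (he : e ∈ hypCentralizer N X Z) (hne : ∀ l, e ≠ scal K V l) :
    ∃ f ∈ hypCentralizer N X Z, f * e = scal K V (-1) * (e * f) := by
  obtain ⟨heN, heX, heZ⟩ := mem_hypCentralizer.1 he
  have : ∃ n ∈ N, e * n ≠ n * e := by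
    by_contra! hcon
    obtain ⟨l, hl⟩ := hcent e heN hcon
    exact hne l hl
  obtain ⟨n, hn, hen⟩ := this
  obtain ⟨a, b, hX, hZ⟩ := h.exists_commuting hpm hn
  have hmem : X a * Z b * n ∈ N := N.mul_mem (N.mul_mem (h.mem_left a) (h.mem_right b)) hn
  refine ⟨X a * Z b * n, mem_hypCentralizer.2 ⟨hmem, hX, hZ⟩, ?_⟩
  refine (hpm _ hmem e heN).resolve_left fun hc => hen ?_
  have h1 : X a * Z b * (n * e) = X a * Z b * (e * n) := by
    calc X a * Z b * (n * e) = e * (X a * Z b * n) := by rw [← mul_assoc, hc]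
      _ = e * X a * Z b * n := by simp only [mul_assoc]
      _ = X a * (e * Z b) * n := by rw [heX]; simp only [mul_assoc]
      _ = _ := by rw [heZ]; simp only [mul_assoc]
  exact (mul_left_cancel h1).symm

/-- If a hyperbolic system cannot be extended, then no element of a non-commuting pair in its
centralizer is an involution. -/
lemma IsHyperbolic.false_of_involution [Nontrivial V] (hR : IsExtraspecialPart 2 N R)
    (hZN : scalarSubgroup K V ≤ N)
    (hno : ¬ ∃ X' Z' : WSpace (m + 1) → GLin K V, IsHyperbolic N X' Z') {c d : GLin K V}
    (hc : c ∈ hypCentralizer N X Z) (hd : d ∈ hypCentralizer N X Z)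
    (hdc : d * c = scal K V (-1) * (c * d)) (hcc : c * c = 1) : False := by
  have hpair : ∀ d ∈ hypCentralizer N X Z, d * c = scal K V (-1) * (c * d) → d * d = 1 → False := by
    intro d hd hdc hdd
    obtain ⟨h1, h2, h3⟩ := mem_hypCentralizer.1 hc
    obtain ⟨h4, h5, h6⟩ := mem_hypCentralizer.1 hd
    exact hno (h.extend h1 h4 h2 h3 h5 h6 hcc hdd hdc)
  obtain ⟨l, -, hl⟩ := exists_sq_eq hR (mem_hypCentralizer.1 hd).1
  have hlmem : scal K V l ∈ hypCentralizer N X Z :=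
    mem_hypCentralizer.2 ⟨hZN ⟨l, rfl⟩, fun a => scal_comm _ _, fun b => scal_comm _ _⟩
  set e := scal K V l * d with he
  have hemem : e ∈ hypCentralizer N X Z := Subgroup.mul_mem _ hlmem hd
  have hec : e * c = scal K V (-1) * (c * e) := by
    rw [he, mul_assoc, hdc, ← mul_assoc c, ← scal_comm l c, ← mul_assoc, scal_comm l]
    simp only [mul_assoc]
  rcases hl with hl | hl
  · exact hpair e hemem hec hl
  -- If e² = -1, then (c e)² = -c² e² = 1, and c e still anticommutes with c.
  · refine hpair (c * e) (Subgroup.mul_mem _ hc hemem) ?_ ?_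
    · rw [mul_assoc, hec, ← mul_assoc, ← scal_comm, mul_assoc]
    · calc c * e * (c * e) = c * (e * c) * e := by simp only [mul_assoc]
        _ = scal K V (-1) * (c * c) * (e * e) := by
          rw [hec, ← mul_assoc c, ← scal_comm]; simp only [mul_assoc]
        _ = 1 := by rw [hcc, hl, mul_one, scal_neg_one_mul_self]

/-- By `false_of_involution` every member of an anticommuting pair in the centralizer can be scaled
to have square -1 and never to have square 1. Two such elements c, d generate a quaternion group,
and the members X_i, Z_i of the system generate the dihedral factors. -/
lemma IsHyperbolic.isDihedralQuaternionProduct [Nontrivial V] (hR : IsExtraspecialPart 2 N R)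
    (hZN : scalarSubgroup K V ≤ N)
    (hpm : ∀ a ∈ N, ∀ b ∈ N, a * b = b * a ∨ a * b = scal K V (-1) * (b * a))
    (hno : ¬ ∃ X' Z' : WSpace (m + 1) → GLin K V, IsHyperbolic N X' Z') {e : GLin K V}
    (he : e ∈ hypCentralizer N X Z) (hne : ∀ l, e ≠ scal K V l) :
    (∀ i : Kˣ, i * i ≠ -1) ∧ IsDihedralQuaternionProduct R := by
  have hcent : ∀ n ∈ N, (∀ s ∈ N, n * s = s * n) → ∃ l, n = scal K V l :=
    fun n hn => scalar_of_commute hR hn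
  have hinv : ∀ {c d : GLin K V}, c ∈ hypCentralizer N X Z → d ∈ hypCentralizer N X Z →
      d * c = scal K V (-1) * (c * d) → c * c = 1 → False :=
    fun hc hd hdc hcc => h.false_of_involution hR hZN hno hc hd hdc hcc
  have hscal : ∀ l, scal K V l ∈ hypCentralizer N X Z := fun l =>
    mem_hypCentralizer.2 ⟨hZN ⟨l, rfl⟩, fun a => scal_comm _ _, fun b => scal_comm _ _⟩
  have hanti : ∀ (l : Kˣ) {c d : GLin K V}, d * c = scal K V (-1) * (c * d) →
      d * (scal K V l * c) = scal K V (-1) * (scal K V l * c * d) := by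
    intro l c d hdc
    rw [← mul_assoc, ← scal_comm, mul_assoc, hdc, ← mul_assoc, scal_comm l]
    simp only [mul_assoc]
  have hnorm : ∀ c ∈ hypCentralizer N X Z, ∀ d ∈ hypCentralizer N X Z,
      d * c = scal K V (-1) * (c * d) →
      ∃ l, scal K V l * c * (scal K V l * c) = scal K V (-1) := by
    intro c hc d hd hdc
    obtain ⟨l, -, hl | hl⟩ := exists_sq_eq hR (mem_hypCentralizer.1 hc).1
    · exact (hinv (Subgroup.mul_mem _ (hscal l) hc) hd (hanti l hdc) hl).elim
    · exact ⟨l, hl⟩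
  obtain ⟨f, hf, hfe⟩ := h.exists_anticommuting hpm hcent he hne
  -- A square root i of -1 would turn an element of square -1 into one of square 1.
  have hsq : ∀ i : Kˣ, i * i ≠ -1 := by
    intro i hi
    obtain ⟨l, hl⟩ := hnorm e he f hf hfe
    refine hinv (Subgroup.mul_mem _ (hscal i) (Subgroup.mul_mem _ (hscal l) he)) hf
      (hanti i (hanti l hfe)) ?_
    rw [mul_assoc, ← mul_assoc _ (scal K V i), ← scal_comm i, mul_assoc, hl, ← mul_assoc,
      ← map_mul, hi, scal_neg_one_mul_self]
  refine ⟨hsq, ?_⟩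
  obtain ⟨l, hcc⟩ := hnorm e he f hf hfe
  obtain ⟨l', hdd⟩ := hnorm f hf e he (neg_mul_comm_of hfe)
  set c := scal K V l * e with hc_def
  set d := scal K V l' * f with hd_def
  have hc : c ∈ hypCentralizer N X Z := Subgroup.mul_mem _ (hscal l) he
  have hd : d ∈ hypCentralizer N X Z := Subgroup.mul_mem _ (hscal l') hf
  have hcd : c * d = scal K V (-1) * (d * c) :=
    hanti l' (neg_mul_comm_of (hanti l hfe))
  have hdc := neg_mul_comm_of hcd
  obtain ⟨hcN, hcX, hcZ⟩ := mem_hypCentralizer.1 hc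
  obtain ⟨hdN, hdX, hdZ⟩ := mem_hypCentralizer.1 hd
  -- A non-scalar n could be scaled to p with p² = -1. Then (c p)² = c² p² = 1, although d
  -- anticommutes with c p.
  have hscalar : ∀ n ∈ hypCentralizer N X Z, n * c = c * n → n * d = d * n →
      ∃ l, n = scal K V l := by
    intro n hn hnc hnd
    by_contra! hnn
    obtain ⟨g, hg, hgn⟩ := h.exists_anticommuting hpm hcent hn hnn
    obtain ⟨μ, hμ⟩ := hnorm n hn g hg hgn
    set p := scal K V μ * n with hp
    have hpm' : p ∈ hypCentralizer N X Z := Subgroup.mul_mem _ (hscal μ) hn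
    have hpc : p * c = c * p := by
      rw [hp, mul_assoc, hnc, ← mul_assoc, scal_comm]; simp only [mul_assoc]
    have hpd : p * d = d * p := by
      rw [hp, mul_assoc, hnd, ← mul_assoc, scal_comm]; simp only [mul_assoc]
    refine hinv (Subgroup.mul_mem _ hc hpm') hd ?_ ?_
    · rw [← mul_assoc, hdc, mul_assoc (c), hpd]; simp only [mul_assoc]
    · rw [mul_assoc, ← mul_assoc p, hpc, mul_assoc c, hμ, ← mul_assoc, hcc, scal_neg_one_mul_self]
  have hgen : ∀ P : Subgroup (GLin K V), (∀ a, X a ∈ P) → (∀ b, Z b ∈ P) → c ∈ P → d ∈ P →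
      ∀ n ∈ N, ∃ l, scal K V l * n ∈ P := by
    intro P hXP hZP hcP hdP n hn
    obtain ⟨a, b, hX, hZ⟩ := h.exists_commuting hpm hn
    have hq : X a * Z b ∈ P := P.mul_mem (hXP a) (hZP b)
    have hnC : X a * Z b * n ∈ hypCentralizer N X Z := mem_hypCentralizer.2
      ⟨N.mul_mem (N.mul_mem (h.mem_left a) (h.mem_right b)) hn, hX, hZ⟩
    set q := X a * Z b * n with hq_def
    clear_value q
    -- One of 1, c, d, c d corrects the signs of q against both c and d, after which q is scalar. So
    -- the system together with c and d generates `N` modulo scalars.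
    have hadj : ∃ p ∈ P, ∃ l, p * q = scal K V l := by
      have hstep : ∀ q ∈ hypCentralizer N X Z, q * c = c * q →
          ∃ p ∈ P, ∃ l, p * q = scal K V l := by
        intro q hqC hqc
        rcases hpm q (mem_hypCentralizer.1 hqC).1 d hdN with h1 | h1
        · obtain ⟨l, hl⟩ := hscalar q hqC hqc h1
          exact ⟨1, P.one_mem, l, by rw [one_mul, hl]⟩
        · obtain ⟨l, hl⟩ := hscalar (c * q) (Subgroup.mul_mem _ hc hqC)
            (by rw [mul_assoc, hqc]) (by
              rw [mul_assoc, h1, ← mul_assoc, ← scal_comm, ← mul_assoc d, hdc]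
              simp only [mul_assoc])
          exact ⟨c, hcP, l, hl⟩
      rcases hpm q (mem_hypCentralizer.1 hnC).1 c hcN with h1 | h1
      · exact hstep q hnC h1
      · obtain ⟨p, hp, l, hl⟩ := hstep (d * q) (Subgroup.mul_mem _ hd hnC) (by
          rw [mul_assoc, h1, ← mul_assoc, ← scal_comm, ← mul_assoc c, hcd]
          simp only [mul_assoc])
        exact ⟨p * d, P.mul_mem hp hdP, l, by rw [mul_assoc, hl]⟩
    obtain ⟨p, hp, l, hl⟩ := hadj
    refine ⟨l⁻¹, ?_⟩
    have h1 : scal K V l⁻¹ * n = (p * (X a * Z b))⁻¹ := by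
      rw [eq_inv_iff_mul_eq_one, mul_assoc, ← mul_one (scal K V l⁻¹ * _), map_inv]
      rw [hq_def] at hl
      have h3 : n = (p * (X a * Z b))⁻¹ * scal K V l := by rw [← hl]; group
      rw [h3]
      rw [← scal_comm]
      group
    rw [h1]
    exact P.inv_mem (P.mul_mem hp hq)
  have hνR := (neg_one_ne_one_and_mem hR).2
  have hν1 : scal K V (-1) ≠ 1 := fun h' => (neg_one_ne_one_and_mem hR).1
    (scal_injective (h'.trans (map_one _).symm))
  have hcR : c ∈ R := mem_of_mul_self hR hsq hcN (Or.inr hcc)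
  have hdR : d ∈ R := mem_of_mul_self hR hsq hdN (Or.inr hdd)
  have hXR : ∀ a, X a ∈ R := fun a =>
    mem_of_mul_self hR hsq (h.mem_left a) (Or.inl (h.left_mul_self a))
  have hZR : ∀ b, Z b ∈ R := fun b =>
    mem_of_mul_self hR hsq (h.mem_right b) (Or.inl (h.right_mul_self b))
  let H : Fin m → Subgroup (GLin K V) := fun i =>
    Subgroup.closure {X (Pi.single i 1) * Z (Pi.single i 1), X (Pi.single i 1)}
  let Q : Subgroup (GLin K V) := Subgroup.closure {c, d}
  have hXH : ∀ i, X (Pi.single i 1) ∈ H i := fun i => Subgroup.subset_closure (by simp)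
  have hZH : ∀ i, Z (Pi.single i 1) ∈ H i := fun i => by
    have h1 : X (Pi.single i 1) * (X (Pi.single i 1) * Z (Pi.single i 1)) ∈ H i :=
      Subgroup.mul_mem _ (hXH i) (Subgroup.subset_closure (by simp))
    rwa [← mul_assoc, h.left_mul_self, one_mul] at h1
  have hcQ : c ∈ Q := Subgroup.subset_closure (by simp)
  have hdQ : d ∈ Q := Subgroup.subset_closure (by simp)
  refine ⟨m, H, Q, fun i => ?_, ?_, fun i j hij => commute_closure ?_,
    fun i => commute_closure ?_, le_antisymm ?_ ?_⟩
  · have hzx : Z (Pi.single i 1) * X (Pi.single i 1) =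
        scal K V (-1) * (X (Pi.single i 1) * Z (Pi.single i 1)) := by
      rw [h.comm]; simp
    have hsq2 : (X (Pi.single i 1) * Z (Pi.single i 1)) ^ 2 = scal K V (-1) := by
      rw [sq, mul_assoc, ← mul_assoc (Z _), hzx, mul_assoc (scal K V (-1)), mul_assoc (X _) (Z _),
        h.right_mul_self, mul_one, scal_comm, ← mul_assoc, h.left_mul_self, one_mul]
    refine nonempty_equiv_dihedral ?_ (hsq2 ▸ hν1) (h.left_mul_self _) ?_
    · rw [show 4 = 2 * 2 by norm_num, pow_mul, hsq2, sq, scal_neg_one_mul_self]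
    · rw [mul_inv_rev, ← mul_assoc, h.left_mul_self, one_mul,
        inv_eq_of_mul_eq_one_left (h.left_mul_self _),
        inv_eq_of_mul_eq_one_left (h.right_mul_self _)]
  · refine nonempty_equiv_quaternion (ρ := c) (s := d) ?_ (by rw [sq, hcc]; exact hν1)
      (by rw [hdd, sq, hcc]) ?_
    · rw [show 4 = 2 * 2 by norm_num, pow_mul, sq c, hcc, sq, scal_neg_one_mul_self]
    · rw [hdc, mul_assoc, mul_assoc, mul_inv_cancel, mul_one, eq_inv_iff_mul_eq_one, mul_assoc,
        hcc, scal_neg_one_mul_self]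
  · have hdot : (Pi.single i 1 : WSpace m) ⬝ᵥ Pi.single j 1 = 0 := by
      rw [single_one_dotProduct, Pi.single_eq_of_ne hij]
    have hdot' : (Pi.single j 1 : WSpace m) ⬝ᵥ Pi.single i 1 = 0 := by
      rw [dotProduct_comm, hdot]
    have hzx : Z (Pi.single i 1) * X (Pi.single j 1) = X (Pi.single j 1) * Z (Pi.single i 1) := by
      rw [h.comm, hdot, sgn_zero, map_one, one_mul]
    have hxz : Z (Pi.single j 1) * X (Pi.single i 1) = X (Pi.single i 1) * Z (Pi.single j 1) := by
      rw [h.comm, hdot', sgn_zero, map_one, one_mul]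
    have c1 : Commute (X (Pi.single i 1)) (X (Pi.single j 1)) := h.left_comm _ _
    have c2 : Commute (X (Pi.single i 1)) (Z (Pi.single j 1)) := hxz.symm
    have c3 : Commute (Z (Pi.single i 1)) (X (Pi.single j 1)) := hzx
    have c4 : Commute (Z (Pi.single i 1)) (Z (Pi.single j 1)) := h.right_comm _ _
    rintro x (rfl | rfl) y (rfl | rfl)
    · exact ((c1.mul_right c2).mul_left (c3.mul_right c4)).eq
    · exact (c1.mul_left c3).eq
    · exact (c1.mul_right c2).eq
    · exact c1.eq
  · have c1 : ∀ a, Commute (X a) c := fun a => (hcX a).symm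
    have c2 : ∀ a, Commute (X a) d := fun a => (hdX a).symm
    have c3 : ∀ a, Commute (Z a) c := fun a => (hcZ a).symm
    have c4 : ∀ a, Commute (Z a) d := fun a => (hdZ a).symm
    rintro x (rfl | rfl) y (rfl | rfl)
    · exact ((c1 _).mul_left (c3 _)).eq
    · exact ((c2 _).mul_left (c4 _)).eq
    · exact (c1 _).eq
    · exact (c2 _).eq
  · refine sup_le (iSup_le fun i => ?_) ?_
    · rw [Subgroup.closure_le]
      rintro x (rfl | rfl)
      · exact R.mul_mem (hXR _) (hZR _)
      · exact hXR _
    · rw [Subgroup.closure_le]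
      rintro x (rfl | rfl)
      · exact hcR
      · exact hdR
  · set P := (⨆ i, H i) ⊔ Q with hP
    have hHP : ∀ i, H i ≤ P := fun i => (le_iSup H i).trans le_sup_left
    have hYP : ∀ Y : WSpace m → GLin K V, Y 0 = 1 → (∀ a a', Y (a + a') = Y a * Y a') →
        (∀ i, Y (Pi.single i 1) ∈ P) → ∀ a, Y a ∈ P := by
      intro Y hY0 hYadd hYi a
      let S : AddSubmonoid (WSpace m) :=
        { carrier := {a | Y a ∈ P}
          zero_mem' := by simp only [Set.mem_ofPred_eq, hY0]; exact P.one_mem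
          add_mem' := fun {a b} ha hb => by
            simp only [Set.mem_ofPred_eq, hYadd] at *
            exact P.mul_mem ha hb }
      have : a ∈ S := by
        rw [← Finset.univ_sum_single a]
        refine S.sum_mem fun i _ => ?_
        rcases zmod_two_cases (a i) with h0 | h0
        · rw [h0, Pi.single_zero]; exact S.zero_mem
        · rw [h0]; exact hYi i
      exact this
    have hνP : scal K V (-1) ∈ P := by
      rw [← hcc]
      exact P.mul_mem (le_sup_right (a := ⨆ i, H i) hcQ) (le_sup_right (a := ⨆ i, H i) hcQ)
    have hPR : P ≤ R := by
      refine sup_le (iSup_le fun i => ?_) ?_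
      · rw [Subgroup.closure_le]
        rintro x (rfl | rfl)
        · exact R.mul_mem (hXR _) (hZR _)
        · exact hXR _
      · rw [Subgroup.closure_le]
        rintro x (rfl | rfl)
        · exact hcR
        · exact hdR
    intro r hr
    obtain ⟨μ, hμ⟩ := hgen P
      (hYP X h.left_zero h.left_add fun i => hHP i (hXH i))
      (hYP Z h.right_zero h.right_add fun i => hHP i (hZH i))
      (le_sup_right (a := ⨆ i, H i) hcQ) (le_sup_right (a := ⨆ i, H i) hdQ) r
      (hR.sup_eq ▸ (le_sup_left : R ≤ R ⊔ scalarSubgroup K V) hr)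
    have hμR : scal K V μ ∈ R := (R.mul_mem_cancel_right hr).1 (hPR hμ)
    have hμP : scal K V μ ∈ P := by
      rcases eq_of_mem_inf hR hμR with rfl | rfl
      · rw [map_one]; exact P.one_mem
      · exact hνP
    exact (P.mul_mem_cancel_left hμP).1 hμ

end Step

/-- Hyperbolic systems are enlarged up to rank k. A failure below rank k produces the
dihedral-quaternion structure together with -1 being a non-square, that is q ≡ 3 mod 4. -/
theorem exists_isPauliBasis [Finite K] {k : ℕ} (hdim : Module.finrank K V = 2 ^ k)
    {G : Subgroup (GLin K V)} (hG : IsSymplecticType 2 G N) (hR : IsExtraspecialPart 2 N R)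
    (hmon : IsMonomialType 2 (Nat.card K) R) :
    ∃ u : Module.Basis (WSpace k) K V, IsPauliBasis N u := by
  have hnt : Nontrivial V := hG.absIrred.1
  have h2 := two_ne_zero_of_extraspecial hR
  have hpm : ∀ a ∈ N, ∀ b ∈ N, a * b = b * a ∨ a * b = scal K V (-1) * (b * a) :=
    fun a ha b hb => commute_or_anticommute hG.quotient_comm hG.quotient_pow ha hb
  have hex : ∀ m, m ≤ k → ∃ X Z : WSpace m → GLin K V, IsHyperbolic N X Z := by
    intro m
    induction m with
    | zero =>
      intro _
      refine ⟨fun _ => 1, fun _ => 1, fun _ => N.one_mem, fun _ => N.one_mem,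
        fun _ _ => (one_mul 1).symm, fun _ _ => (one_mul 1).symm, fun b a => ?_⟩
      rw [Subsingleton.elim b 0, zero_dotProduct, sgn_zero, map_one, one_mul, one_mul]
    | succ m ih =>
      intro hm
      obtain ⟨X, Z, h⟩ := ih (by omega)
      by_contra hno
      obtain ⟨c, hcN, hcX, hcZ, hc⟩ := h.exists_nonscalar h2 hG.absIrred hpm
        (by rw [hdim]; exact Nat.pow_lt_pow_right (by norm_num) (by omega))
      obtain ⟨hsq, hdq⟩ := h.isDihedralQuaternionProduct hR hG.scalar_le hpm hno
        (mem_hypCentralizer.2 ⟨hcN, hcX, hcZ⟩) hc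
      refine hmon ⟨rfl, ?_, hdq⟩
      have := Fintype.ofFinite K
      have hns : ¬ IsSquare (-1 : K) := by
        rintro ⟨i, hi⟩
        have hi0 : i ≠ 0 := by
          rintro rfl
          simp at hi
        exact hsq (Units.mk0 i hi0) (by ext; simpa using hi.symm)
      rw [FiniteField.isSquare_neg_one_iff, not_not] at hns
      rw [Nat.card_eq_fintype_card]
      exact hns
  obtain ⟨X, Z, h⟩ := hex k le_rfl
  exact h.exists_isPauliBasis h2 hG.scalar_le hpm hdim

end Pauli

/-! ### Starting pairs in the generic case. -/

namespace Pauli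

variable {K V : Type*} [Field K] [AddCommGroup V] [Module K V] {k : ℕ}

section Enumeration

variable {τ : Fin 4 → WSpace k} (hτ : IsPlaneEnumeration τ)

include hτ

lemma enum_mem (i : Fin 4) : τ i ∈ plane k := by
  rw [← hτ.2.2]
  exact Finset.mem_image_of_mem _ (Finset.mem_univ _)

lemma enum_exists {w : WSpace k} (hw : w ∈ plane k) : ∃ i, τ i = w := by
  rw [← hτ.2.2] at hw
  obtain ⟨i, -, hi⟩ := Finset.mem_image.1 hw
  exact ⟨i, hi⟩

lemma enum_ne_zero {i : Fin 4} (hi : i ≠ 0) : τ i ≠ 0 := fun h =>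
  hi (hτ.2.1 (h.trans hτ.1.symm))

lemma enum_add (hk : 2 ≤ k) : τ 1 + τ 2 = τ 3 := by
  obtain ⟨i, hi⟩ := enum_exists hτ (add_mem_plane hk (enum_mem hτ 1) (enum_mem hτ 2))
  have h0 : i ≠ 0 := by
    rintro rfl
    rw [hτ.1, eq_comm, eq_comm, eq_add_iff, add_zero] at hi
    exact absurd (hτ.2.1 hi) (by decide)
  have h1 : i ≠ 1 := by
    rintro rfl
    exact enum_ne_zero hτ (i := 2) (by decide) (by simpa using hi)
  have h2 : i ≠ 2 := by
    rintro rfl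
    exact enum_ne_zero hτ (i := 1) (by decide) (by simpa using hi)
  have h3 : i = 3 := by
    clear hi
    revert i; decide
  rw [← hi, h3]

end Enumeration

/-- The vector of the plane with prescribed coordinates. -/
noncomputable def comb (u : Module.Basis (WSpace k) K V) (τ : Fin 4 → WSpace k) (y : Fin 4 → K) : V :=
  ∑ i, y i • u (τ i)

lemma comb_mem {τ : Fin 4 → WSpace k} (hτ : IsPlaneEnumeration τ)
    (u : Module.Basis (WSpace k) K V) (y : Fin 4 → K) : comb u τ y ∈ planeSpan u :=
  Submodule.sum_mem _ fun i _ => Submodule.smul_mem _ _ (basis_mem_planeSpan u (enum_mem hτ i))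

lemma repr_comb {τ : Fin 4 → WSpace k} (hτ : IsPlaneEnumeration τ)
    (u : Module.Basis (WSpace k) K V) (y : Fin 4 → K) (i : Fin 4) :
    u.repr (comb u τ y) (τ i) = y i := by
  rw [comb, map_sum, Finsupp.finsetSum_apply, Finset.sum_eq_single i]
  · simp
  · intro j _ hj
    simp [hτ.2.1.eq_iff, hj]
  · simp

lemma startingPair_of {G : Subgroup (GLin K V)} {τ : Fin 4 → WSpace k}
    (hk : 2 ≤ k) (hτ : IsPlaneEnumeration τ) (u : Module.Basis (WSpace k) K V) {x y : Fin 4 → K}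
    (i₀ : Fin 4) (hi₀ : y i₀ = 0) (hi : ∀ i, i ≠ i₀ → y i ≠ 0)
    (h : ∀ g ∈ G, g (comb u τ x) = comb u τ x → g (comb u τ y) = comb u τ y →
      (planeSpan u).map (g : V →ₗ[K] V) = planeSpan u → ∀ i, g (u (τ i)) = u (τ i)) :
    IsStartingPair G u (comb u τ x) (comb u τ y) := by
  classical
  refine ⟨comb_mem hτ u x, comb_mem hτ u y, ?_, ?_⟩
  · have hs : (u.repr (comb u τ y)).support = (plane k).erase (τ i₀) := by
      ext w
      rw [Finsupp.mem_support_iff, Finset.mem_erase]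
      by_cases hw : w ∈ plane k
      · obtain ⟨i, rfl⟩ := enum_exists hτ hw
        rw [repr_comb hτ, hτ.2.1.ne_iff]
        exact ⟨fun h' => ⟨fun h'' => h' (h'' ▸ hi₀), hw⟩, fun h' => hi i h'.1⟩
      · simp [hw, (mem_planeSpan_iff u _).1 (comb_mem hτ u y) w hw]
    rw [hs, Finset.card_erase_of_mem (enum_mem hτ i₀), card_plane hk]
  · intro g hg hmap w hw
    obtain ⟨hgG, hgx, hgy⟩ := mem_inf_vectorCentralizer.1 hg
    have h1 := h g hgG hgx hgy hmap
    have hle : planeSpan u ≤ LinearMap.eqLocus (g : V →ₗ[K] V) LinearMap.id := by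
      rw [planeSpan, Submodule.span_le]
      rintro _ ⟨x, hx, rfl⟩
      obtain ⟨i, rfl⟩ := enum_exists hτ hx
      exact h1 i
    exact hle hw

/-- Since a + a = 0, the coefficient rule at w = a compares c 0 = 1 with (c a)² up to sign. Hence
coefficients are fourth roots of unity. -/
lemma IsMonomial.coeff_sq {u : Module.Basis (WSpace k) K V} {g : GLin K V}
    {π : Equiv.Perm (WSpace k)} {c : WSpace k → Kˣ} (h : IsMonomial u g π c) (a : WSpace k) :
    ∃ s : ZMod 2, c a * c a = sgn K s := by
  obtain ⟨b, hb⟩ := h.coeff_add a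
  have := hb a
  rw [add_self_eq_zero, h.coeff_zero] at this
  exact ⟨b ⬝ᵥ a, by rw [← sgn_inv, eq_inv_iff_mul_eq_one, this]⟩

lemma IsMonomial.coeff_pow_four {u : Module.Basis (WSpace k) K V} {g : GLin K V}
    {π : Equiv.Perm (WSpace k)} {c : WSpace k → Kˣ} (h : IsMonomial u g π c) (a : WSpace k) :
    c a ^ 4 = 1 := by
  obtain ⟨s, hs⟩ := h.coeff_sq a
  rw [show 4 = 2 * 2 by norm_num, pow_mul, sq (c a), hs, sq, sgn_mul_self]

variable {G N : Subgroup (GLin K V)}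

/-- Fourth powers of the coordinates of y₀ are invariant under g, and 1, α⁴, α⁻⁴ are distinct
because α⁸ ≠ 1. So g fixes each label, and then each coefficient is 1. -/
lemma startingPair_generic (hk : 2 ≤ k) (h2 : (2 : K) ≠ 0)
    (hN : ∀ g ∈ G, ∀ a ∈ N, g * a * g⁻¹ ∈ N)
    {u : Module.Basis (WSpace k) K V} (hu : IsPauliBasis N u) {τ : Fin 4 → WSpace k}
    (hτ : IsPlaneEnumeration τ) {α : Kˣ} (hα : α ^ 8 ≠ 1) :
    IsStartingPair G u (u (τ 0)) (u (τ 1) + α • u (τ 2) + α⁻¹ • u (τ 3)) := by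
  have hx : u (τ 0) = comb u τ ![1, 0, 0, 0] := by
    simp [comb, Fin.sum_univ_four]
  have hy : u (τ 1) + α • u (τ 2) + α⁻¹ • u (τ 3) = comb u τ ![0, 1, α, (α⁻¹ : Kˣ)] := by
    simp [comb, Fin.sum_univ_four, Units.smul_def]
  rw [hx, hy]
  refine startingPair_of hk hτ u 0 rfl ?_ ?_
  · intro i hi
    fin_cases i
    · exact absurd rfl hi
    · exact one_ne_zero
    · exact α.ne_zero
    · exact (α⁻¹).ne_zero
  intro g hg hgx hgy _
  rw [← hx, hτ.1] at hgx
  obtain ⟨π, c, hm⟩ := exists_isMonomial hN h2 hu hg hgx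
  have h4 : α ^ 4 ≠ 1 := fun h => hα (by
    rw [show 8 = 4 * 2 by norm_num, pow_mul, h, one_pow])
  have h8 : α ^ 4 ≠ (α⁻¹) ^ 4 := fun h => hα (by
    rw [inv_pow, eq_inv_iff_mul_eq_one, ← pow_add] at h
    exact h)
  have h4' : (α⁻¹) ^ 4 ≠ 1 := fun h => h4 (by rwa [inv_pow, inv_eq_one] at h)
  let γ : Fin 4 → Kˣ := ![1, 1, α, α⁻¹]
  have hγ : ∀ i : Fin 4, i ≠ 0 → (![0, 1, (α : K), (α⁻¹ : Kˣ)] : Fin 4 → K) i = γ i := by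
    intro i hi
    fin_cases i
    · exact absurd rfl hi
    all_goals simp [γ]
  have hγinj : ∀ i j : Fin 4, i ≠ 0 → j ≠ 0 → γ i ^ 4 = γ j ^ 4 → i = j := by
    intro i j hi hj hij
    fin_cases i <;> fin_cases j <;> first
      | rfl
      | exact absurd rfl hi
      | exact absurd rfl hj
      | (simp only [γ] at hij
         first
          | exact absurd hij h4
          | exact absurd hij.symm h4
          | exact absurd hij h8
          | exact absurd hij.symm h8
          | exact absurd hij h4'
          | exact absurd hij.symm h4'
          | (exfalso; simp at hij; first | exact h4 hij | exact h4 hij.symm))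
  have key : ∀ i : Fin 4, i ≠ 0 → π (τ i) = τ i ∧ c (τ i) = 1 := by
    intro i hi
    have h1 := hm.repr_apply (comb u τ ![0, 1, α, (α⁻¹ : Kˣ)]) (τ i)
    rw [hgy, repr_comb hτ, hγ i hi] at h1
    have hmem : π (τ i) ∈ plane k := by
      by_contra hne
      rw [(mem_planeSpan_iff u _).1 (comb_mem hτ u _) _ hne] at h1
      exact mul_ne_zero (Units.ne_zero _) (Units.ne_zero _) h1.symm
    obtain ⟨j, hj⟩ := enum_exists hτ hmem
    have hj0 : j ≠ 0 := by
      rintro rfl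
      rw [hτ.1, ← hm.map_zero] at hj
      exact enum_ne_zero hτ hi (π.injective hj.symm)
    rw [← hj, repr_comb hτ, hγ j hj0] at h1
    have h3 : γ j = c (τ i) * γ i := Units.ext (by simpa using h1)
    have hij : j = i := hγinj j i hj0 hi (by
      rw [h3, mul_pow, hm.coeff_pow_four, one_mul])
    subst hij
    exact ⟨hj.symm, mul_eq_right.1 h3.symm⟩
  intro i
  by_cases hi : i = 0
  · rw [hi, hτ.1, hgx]
  · rw [hm.apply, (key i hi).1, (key i hi).2, one_smul]

/-- Otherwise the order q - 1 of a generator divides 8, so q is 2, 3, 5 or 9, and q = 2 is excluded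
by the characteristic. -/
lemma exists_pow_eight_ne_one [Finite K] (h2 : (2 : K) ≠ 0) (h3 : Nat.card K ≠ 3)
    (h5 : Nat.card K ≠ 5) (h9 : Nat.card K ≠ 9) : ∃ α : Kˣ, α ^ 8 ≠ 1 := by
  have := Fintype.ofFinite K
  obtain ⟨α, hα⟩ := IsCyclic.exists_generator (α := Kˣ)
  refine ⟨α, fun h => ?_⟩
  have ho : orderOf α = Nat.card K - 1 := by
    rw [orderOf_eq_card_of_forall_mem_zpowers hα, Nat.card_units]
  have hd := orderOf_dvd_of_pow_eq_one h
  rw [ho] at hd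
  have hle := Nat.le_of_dvd (by norm_num) hd
  have h1 : 1 < Nat.card K := Finite.one_lt_card
  have hne2 : Nat.card K ≠ 2 := by
    intro hc
    apply h2
    have h0 : ((Nat.card K : ℕ) : K) = 0 := by
      rw [Nat.card_eq_fintype_card]; exact Nat.cast_card_eq_zero K
    rw [hc] at h0
    exact_mod_cast h0
  generalize Nat.card K = q at *
  have hq : q ≤ 9 := by omega
  interval_cases q <;> omega

end Pauli

/-! ### Rigid pairs: reduction to a finite computation. -/

namespace Pauli

variable {K V : Type*} [Field K] [AddCommGroup V] [Module K V] {k : ℕ}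

/-- The exponents of the sign character on the plane with prescribed values at two points. -/
def signVec (β₁ β₂ : ZMod 2) : Fin 4 → ZMod 2 := ![0, β₁, β₂, β₁ + β₂]

/-- The action of a Pauli transformation on the coordinates of the plane. -/
def pauliAct {L : Type*} [CommRing L] (l : L) (j : Fin 4) (β₁ β₂ : ZMod 2) (y : Fin 4 → L) :
    Fin 4 → L :=
  fun i => l * (if signVec β₁ β₂ (i ^^^ j) = 0 then 1 else -1) * y (i ^^^ j)

/-- The combination of `x, y` and their images `x', y'` with coefficients `c`. -/
def fourComb {L : Type*} [CommRing L] (c x y x' y' : Fin 4 → L) : Fin 4 → L :=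
  fun i => c 0 * x i + c 1 * y i + c 2 * x' i + c 3 * y' i

/-- Pauli involutions satisfying, at `x` and `y`, the linear relations with coefficients `c, d`
are unique. -/
def IsRigid {L : Type*} [CommRing L] (x y c d : Fin 4 → L) : Prop :=
  ∀ (l : L) (j : Fin 4) (β₁ β₂ : ZMod 2),
    (∀ i, pauliAct l j β₁ β₂ (pauliAct l j β₁ β₂ y) i = y i) →
    ∀ (l' : L) (j' : Fin 4) (β₁' β₂' : ZMod 2),
    (∀ i, pauliAct l' j' β₁' β₂' (pauliAct l' j' β₁' β₂' y) i = y i) →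
    (∀ i, pauliAct l' j' β₁' β₂' x i =
      fourComb c x y (pauliAct l j β₁ β₂ x) (pauliAct l j β₁ β₂ y) i) →
    (∀ i, pauliAct l' j' β₁' β₂' y i =
      fourComb d x y (pauliAct l j β₁ β₂ x) (pauliAct l j β₁ β₂ y) i) →
    l = 1 ∧ j = 0 ∧ β₁ = 1 ∧ β₂ = 1

set_option synthInstance.maxSize 1000 in
set_option synthInstance.maxHeartbeats 200000 in
instance {L : Type*} [CommRing L] [Fintype L] [DecidableEq L] (x y c d : Fin 4 → L) :
    Decidable (IsRigid x y c d) := by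
  unfold IsRigid; infer_instance

/-- The vectors `x, y` and their images under a fixed sign change `T` form a basis of the plane,
and another sign change is related to `T` by linear relations that determine `T`. -/
structure IsRigidPair {L : Type*} [CommRing L] (x y c d : Fin 4 → L) (P : Fin 4 → Fin 4 → L) :
    Prop where
  rigid : IsRigid x y c d
  left : ∀ i, pauliAct 1 0 1 0 x i = fourComb c x y (pauliAct 1 0 1 1 x) (pauliAct 1 0 1 1 y) i
  right : ∀ i, pauliAct 1 0 1 0 y i = fourComb d x y (pauliAct 1 0 1 1 x) (pauliAct 1 0 1 1 y) i
  single : ∀ m i, fourComb (P m) x y (pauliAct 1 0 1 1 x) (pauliAct 1 0 1 1 y) i =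
    if i = m then 1 else 0

section Transport

variable {L M : Type*} [CommRing L] [CommRing M]

lemma map_pauliAct (e : L ≃+* M) (l : L) (j : Fin 4) (β₁ β₂ : ZMod 2) (y : Fin 4 → L) :
    pauliAct (e l) j β₁ β₂ (fun i => e (y i)) = fun i => e (pauliAct l j β₁ β₂ y i) := by
  funext i
  simp only [pauliAct, map_mul]
  split_ifs <;> simp

lemma map_fourComb (e : L ≃+* M) (c x y x' y' : Fin 4 → L) :
    fourComb (fun i => e (c i)) (fun i => e (x i)) (fun i => e (y i)) (fun i => e (x' i))
      (fun i => e (y' i)) = fun i => e (fourComb c x y x' y' i) := by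
  funext i
  simp only [fourComb, map_add, map_mul]

/-- This carries a computation in an explicit model of the finite field over to `K`. -/
lemma IsRigidPair.map (e : L ≃+* M) {x y c d : Fin 4 → L} {P : Fin 4 → Fin 4 → L}
    (h : IsRigidPair x y c d P) :
    IsRigidPair (fun i => e (x i)) (fun i => e (y i)) (fun i => e (c i)) (fun i => e (d i))
      (fun m i => e (P m i)) := by
  constructor
  · intro l j β₁ β₂ h1 l' j' β₁' β₂' h2 h3 h4
    obtain ⟨l, rfl⟩ := e.surjective l
    obtain ⟨l', rfl⟩ := e.surjective l'
    simp only [map_pauliAct, map_fourComb, e.injective.eq_iff] at h1 h2 h3 h4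
    obtain ⟨h5, h6⟩ := h.rigid l j β₁ β₂ h1 l' j' β₁' β₂' h2 h3 h4
    exact ⟨by rw [h5, map_one], h6⟩
  · intro i
    rw [← map_one e]
    simp only [map_pauliAct, map_fourComb, e.injective.eq_iff]
    exact h.left i
  · intro i
    rw [← map_one e]
    simp only [map_pauliAct, map_fourComb, e.injective.eq_iff]
    exact h.right i
  · intro m i
    have h1 := congrArg e (h.single m i)
    rw [← map_one e]
    simp only [map_pauliAct, map_fourComb]
    rw [h1]
    split_ifs <;> simp

end Transport

section Enumeration

variable {τ : Fin 4 → WSpace k} (hτ : IsPlaneEnumeration τ)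

lemma exists_dot_eq_one_zero {p q : WSpace k} (hp : p ≠ 0) (hpq : p ≠ q) :
    ∃ b : WSpace k, b ⬝ᵥ p = 1 ∧ b ⬝ᵥ q = 0 := by
  obtain ⟨b, hb⟩ := exists_dot_ne hpq
  obtain ⟨b', hb'⟩ := exists_dot_ne hp
  rw [dotProduct_zero] at hb'
  have hb1 : b' ⬝ᵥ p = 1 := (zmod_two_cases _).resolve_left hb'
  rcases zmod_two_cases (b ⬝ᵥ q) with h | h
  · exact ⟨b, (zmod_two_cases _).resolve_left (h ▸ hb), h⟩
  · have h' : b ⬝ᵥ p = 0 := (zmod_two_cases _).resolve_right (h ▸ hb)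
    rcases zmod_two_cases (b' ⬝ᵥ q) with h1 | h1
    · exact ⟨b', hb1, h1⟩
    · exact ⟨b + b', by rw [add_dotProduct, h', hb1, zero_add],
        by rw [add_dotProduct, h, h1]; decide⟩

include hτ in
-- The plane is a Klein four-group with τ 0 = 0, so addition of labels is bitwise exclusive or on
-- the indices.
lemma enum_add_eq (hk : 2 ≤ k) (i j : Fin 4) : τ j + τ i = τ (i ^^^ j) := by
  have h3 := enum_add hτ hk
  have h0 := hτ.1
  fin_cases i <;> fin_cases j <;>
    simp only [Fin.mk_zero, Fin.mk_one, Fin.reduceFinMk, Fin.isValue, h0, zero_add,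
      add_zero, add_self_eq_zero, ← h3, Fin.reduceXor]
  · exact add_comm _ _
  · rw [add_comm, add_add_cancel]
  · rw [add_comm (τ 1), add_comm, add_add_cancel]
  · exact add_add_cancel _ _
  · rw [add_comm (τ 1), add_add_cancel]

include hτ in
lemma pauli_comb (hk : 2 ≤ k) (u : Module.Basis (WSpace k) K V) (l : Kˣ) (j : Fin 4)
    (b : WSpace k) (y : Fin 4 → K) :
    pauli u l (τ j) b (comb u τ y) =
      comb u τ (pauliAct (l : K) j (b ⬝ᵥ τ 1) (b ⬝ᵥ τ 2) y) := by
  have hs : ∀ i, ((sgn K (b ⬝ᵥ τ i) : Kˣ) : K) =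
      if signVec (b ⬝ᵥ τ 1) (b ⬝ᵥ τ 2) i = 0 then 1 else -1 := by
    intro i
    have h : signVec (b ⬝ᵥ τ 1) (b ⬝ᵥ τ 2) i = b ⬝ᵥ τ i := by
      fin_cases i
      · simp [signVec, hτ.1]
      · rfl
      · rfl
      · simp [signVec, ← enum_add hτ hk]
    rw [h]
    rcases zmod_two_cases (b ⬝ᵥ τ i) with h | h <;> simp [h]
  have hx : ∀ i : Fin 4, i ^^^ j ^^^ j = i := by revert j; decide
  rw [comb, comb, map_sum]
  refine Finset.sum_bij' (fun i _ => i ^^^ j) (fun i _ => i ^^^ j) (fun _ _ => Finset.mem_univ _)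
    (fun _ _ => Finset.mem_univ _) (fun i _ => hx i) (fun i _ => hx i) fun i _ => ?_
  rw [map_smul, pauli_apply, enum_add_eq hτ hk, Units.smul_def, smul_smul, pauliAct, hx, ← hs,
    Units.val_mul, mul_comm]

include hτ in
lemma comb_injective (u : Module.Basis (WSpace k) K V) : Function.Injective (comb u τ) := by
  intro y y' h
  funext i
  rw [← repr_comb hτ u y, h, repr_comb hτ]

lemma comb_fourComb (τ : Fin 4 → WSpace k) (u : Module.Basis (WSpace k) K V)
    (c x y x' y' : Fin 4 → K) :
    comb u τ (fourComb c x y x' y') =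
      c 0 • comb u τ x + c 1 • comb u τ y + c 2 • comb u τ x' + c 3 • comb u τ y' := by
  simp only [comb, fourComb, add_smul, mul_smul, Finset.sum_add_distrib, Finset.smul_sum]

end Enumeration

variable {G N : Subgroup (GLin K V)}

/-- The conjugate fixes g u_0, a non-zero vector of V'. Its translation part a thus moves a label of
the plane to a label of the plane. -/
lemma exists_conj_pauli_of_map_planeSpan (hk : 2 ≤ k) (hN : ∀ g ∈ G, ∀ a ∈ N, g * a * g⁻¹ ∈ N)
    {u : Module.Basis (WSpace k) K V} (hu : IsPauliBasis N u) {g : GLin K V} (hg : g ∈ G)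
    (hmap : (planeSpan u).map (g : V →ₗ[K] V) = planeSpan u) (b : WSpace k) :
    ∃ l a b', a ∈ plane k ∧ g * pauli u 1 0 b = pauli u l a b' * g := by
  obtain ⟨l, a, b', h⟩ := exists_conj_pauli hN hu hg 1 0 b
  refine ⟨l, a, b', ?_, h⟩
  have hmem : ∀ v ∈ planeSpan u, g v ∈ planeSpan u := fun v hv => by
    rw [← hmap]; exact ⟨v, hv, rfl⟩
  have h0 := hmem _ (basis_mem_planeSpan u zero_mem_plane)
  have hfix : pauli u l a b' (g (u 0)) = g (u 0) := by
    have := LinearEquiv.congr_fun h (u 0)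
    rw [LinearEquiv.mul_apply, LinearEquiv.mul_apply, pauli_apply] at this
    simpa using this.symm
  have hne : ∃ w, u.repr (g (u 0)) w ≠ 0 := by
    by_contra! hw
    have : g (u 0) = 0 := u.ext_elem fun w => by rw [hw, map_zero, Finsupp.zero_apply]
    exact u.ne_zero 0 ((LinearEquiv.map_eq_zero_iff g).1 this)
  obtain ⟨w, hw⟩ := hne
  have hwp : w ∈ plane k := by
    by_contra hwp
    exact hw ((mem_planeSpan_iff u _).1 h0 _ hwp)
  have hawp : a + w ∈ plane k := by
    by_contra hawp
    have h1 := repr_pauli u l a b' (g (u 0)) w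
    rw [hfix, (mem_planeSpan_iff u _).1 h0 _ hawp] at h1
    exact mul_ne_zero (Units.ne_zero _) hw h1.symm
  have := add_mem_plane hk hwp hawp
  rwa [add_comm a w, add_add_cancel] at this

/-- Applying g to the relations expressing T'x and T'y in the basis x, y, Tx, Ty gives the same
relations for the conjugates of T and T'. Rigidity says that the conjugate of T agrees with T on V',
so g fixes x, y, Tx, Ty and hence V'. -/
lemma startingPair_of_isRigidPair (hk : 2 ≤ k) (hN : ∀ g ∈ G, ∀ a ∈ N, g * a * g⁻¹ ∈ N)
    {u : Module.Basis (WSpace k) K V} (hu : IsPauliBasis N u) {τ : Fin 4 → WSpace k}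
    (hτ : IsPlaneEnumeration τ) {x y c d : Fin 4 → K} {P : Fin 4 → Fin 4 → K}
    (h : IsRigidPair x y c d P) (i₀ : Fin 4) (hi₀ : y i₀ = 0) (hi : ∀ i, i ≠ i₀ → y i ≠ 0) :
    IsStartingPair G u (comb u τ x) (comb u τ y) := by
  refine startingPair_of hk hτ u i₀ hi₀ hi fun g hg hx hy hmap => ?_
  obtain ⟨b₁, h11, h10⟩ := exists_dot_eq_one_zero (enum_ne_zero hτ (i := 1) (by decide))
    (hτ.2.1.ne (show (1 : Fin 4) ≠ 2 by decide))
  obtain ⟨b₂, h22, h21⟩ := exists_dot_eq_one_zero (enum_ne_zero hτ (i := 2) (by decide))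
    (hτ.2.1.ne (show (2 : Fin 4) ≠ 1 by decide))
  have hconj : ∀ b, ∃ (l : K) (j : Fin 4) (β₁ β₂ : ZMod 2), ∀ z, g (comb u τ z) = comb u τ z →
      g (comb u τ (pauliAct 1 0 (b ⬝ᵥ τ 1) (b ⬝ᵥ τ 2) z)) =
        comb u τ (pauliAct l j β₁ β₂ z) ∧
      comb u τ (pauliAct l j β₁ β₂ (pauliAct l j β₁ β₂ z)) = comb u τ z := by
    intro b
    obtain ⟨l, a, b', ha, h⟩ := exists_conj_pauli_of_map_planeSpan hk hN hu hg hmap b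
    obtain ⟨j, rfl⟩ := enum_exists hτ ha
    refine ⟨l, j, b' ⬝ᵥ τ 1, b' ⬝ᵥ τ 2, fun z hz => ?_⟩
    have h1 : ∀ v, g (pauli u 1 0 b v) = pauli u l (τ j) b' (g v) := LinearEquiv.congr_fun h
    have h2 : comb u τ (pauliAct 1 0 (b ⬝ᵥ τ 1) (b ⬝ᵥ τ 2) z) = pauli u 1 0 b (comb u τ z) := by
      have := pauli_comb hτ hk u 1 0 b z
      rw [hτ.1, Units.val_one] at this
      exact this.symm
    refine ⟨by rw [h2, h1, hz, pauli_comb hτ hk], ?_⟩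
    rw [← pauli_comb hτ hk, ← pauli_comb hτ hk]
    nth_rewrite 1 [← hz]
    rw [← h1, ← h1, ← LinearEquiv.mul_apply (pauli u 1 0 b), pauli_mul]
    simp [add_self_eq_zero, pauli_one, hz]
  -- T has sign exponents (0,1,1,0) on the plane and T' has (0,1,0,1).
  obtain ⟨l, j, β₁, β₂, hT⟩ := hconj (b₁ + b₂)
  obtain ⟨l', j', β₁', β₂', hT'⟩ := hconj b₁
  simp only [add_dotProduct, h11, h10, h22, h21, zero_add, add_zero] at hT hT'
  have hrel : ∀ (e z : Fin 4 → K), g (comb u τ z) = comb u τ z →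
      pauliAct 1 0 1 0 z = fourComb e x y (pauliAct 1 0 1 1 x) (pauliAct 1 0 1 1 y) →
      ∀ i, pauliAct l' j' β₁' β₂' z i =
        fourComb e x y (pauliAct l j β₁ β₂ x) (pauliAct l j β₁ β₂ y) i := by
    intro e z hz he
    refine congrFun (comb_injective hτ u ?_)
    rw [← (hT' z hz).1, he]
    simp only [comb_fourComb, map_add, map_smul, hx, hy, (hT x hx).1, (hT y hy).1]
  obtain ⟨rfl, rfl, rfl, rfl⟩ := h.rigid l j β₁ β₂ (congrFun (comb_injective hτ u (hT y hy).2))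
    l' j' β₁' β₂' (congrFun (comb_injective hτ u (hT' y hy).2))
    (hrel c x hx (funext h.left)) (hrel d y hy (funext h.right))
  intro m
  have hm : u (τ m) = comb u τ (fourComb (P m) x y (pauliAct 1 0 1 1 x) (pauliAct 1 0 1 1 y)) := by
    rw [funext (h.single m)]
    simp [comb]
  rw [hm]
  simp only [comb_fourComb, map_add, map_smul, hx, hy, (hT x hx).1, (hT y hy).1]

end Pauli

/-! ### Starting pairs for q = 5 and q = 9. -/

namespace Pauli

variable {K V : Type*} [Field K] [AddCommGroup V] [Module K V] {k : ℕ}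
  {G N : Subgroup (GLin K V)}

lemma isRigidPair_five : IsRigidPair (L := ZMod 5) ![1, 1, 2, 0] ![0, 1, 1, 2] ![2, 3, 4, 2]
    ![1, 3, 4, 1] ![![3, 0, 3, 0], ![2, 1, 3, 4], ![3, 2, 2, 3], ![0, 4, 0, 4]] := by
  constructor <;> decide +kernel

lemma startingPair_five (hk : 2 ≤ k) (hN : ∀ g ∈ G, ∀ a ∈ N, g * a * g⁻¹ ∈ N)
    {u : Module.Basis (WSpace k) K V} (hu : IsPauliBasis N u) {τ : Fin 4 → WSpace k}
    (hτ : IsPlaneEnumeration τ) (hK : Nat.card K = 5) :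
    IsStartingPair G u (u (τ 0) + u (τ 1) + (2 : K) • u (τ 2))
      (u (τ 1) + u (τ 2) + (2 : K) • u (τ 3)) := by
  have : Finite K := Nat.finite_of_card_ne_zero (by omega)
  have := Fintype.ofFinite K
  let e : ZMod 5 ≃+* K := ZMod.ringEquivOfPrime K (by norm_num)
    (by rw [← Nat.card_eq_fintype_card, hK])
  have h := startingPair_of_isRigidPair hk hN hu hτ (isRigidPair_five.map e) 0 (by simp) (by
    intro i hi
    rw [map_ne_zero_iff _ e.injective]
    have h : ∀ i : Fin 4, i ≠ 0 → (![0, 1, 1, 2] : Fin 4 → ZMod 5) i ≠ 0 := by decide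
    exact h i hi)
  have h2 : e 2 = 2 := map_ofNat e 2
  convert h using 1 <;> simp [comb, Fin.sum_univ_four, h2]

instance quadraticAlgebraFintype {R : Type*} [Fintype R] (a b : R) :
    Fintype (QuadraticAlgebra R a b) :=
  Fintype.ofEquiv _ (QuadraticAlgebra.equivProd a b).symm

/-- The model of the field is 𝔽₃[ω] with ω² = 1 + bω; the two values of b cover every generator of
its multiplicative group. -/
lemma isRigidPair_nine {b : ZMod 3} (hb : b ≠ 0) :
    IsRigidPair (L := QuadraticAlgebra (ZMod 3) 1 b) ![1, 0, 1, 1] ![0, 1, 1, ⟨0, 1⟩]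
      ![1, ⟨b, -1⟩, 0, ⟨b, -1⟩] ![1, -1, -1, 0]
      ![![-1, ⟨-b, 1⟩, -1, ⟨-b, 1⟩], ![1, -1, -1, 1], ![-1, 0, 1, 0],
        ![0, ⟨b, -1⟩, 0, ⟨b, -1⟩]] := by
  have h : b = 1 ∨ b = 2 := by revert b; decide
  rcases h with rfl | rfl <;> constructor <;> decide +kernel

lemma startingPair_nine (hk : 2 ≤ k) (hN : ∀ g ∈ G, ∀ a ∈ N, g * a * g⁻¹ ∈ N)
    {u : Module.Basis (WSpace k) K V} (hu : IsPauliBasis N u) {τ : Fin 4 → WSpace k}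
    (hτ : IsPlaneEnumeration τ) (hK : Nat.card K = 9) {α : Kˣ}
    (hα : Subgroup.zpowers α = ⊤) :
    IsStartingPair G u (u (τ 0) + u (τ 2) + u (τ 3)) (u (τ 1) + u (τ 2) + α • u (τ 3)) := by
  have : Finite K := Nat.finite_of_card_ne_zero (by omega)
  have := Fintype.ofFinite K
  have : CharP K 3 := by
    obtain ⟨p, hp, n, hp', hn⟩ := FiniteField.card' K
    rw [← Nat.card_eq_fintype_card, hK] at hn
    have h3 : p = 3 := ((Nat.prime_dvd_prime_iff_eq hp' Nat.prime_three).1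
      (hp'.dvd_of_dvd_pow (show p ∣ 3 ^ 2 from ⟨p ^ ((n : ℕ) - 1), by
        rw [← pow_succ', Nat.sub_add_cancel n.pos]; exact hn⟩)))
    exact h3 ▸ hp
  let _ : Algebra (ZMod 3) K := ZMod.algebra K 3
  have h30 : (3 : K) = 0 := by exact_mod_cast CharP.cast_eq_zero K 3
  have hord : orderOf α = 8 := by
    rw [orderOf_eq_card_of_forall_mem_zpowers fun x => hα ▸ Subgroup.mem_top x, Nat.card_units, hK]
  have h4 : (α : K) ^ 4 = -1 := by
    have h8 : (α : K) ^ 8 = 1 := by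
      have := pow_orderOf_eq_one α
      rw [hord] at this
      rw [← Units.val_pow_eq_pow_val, this, Units.val_one]
    have hne : (α : K) ^ 4 ≠ 1 := by
      intro h
      have h' : α ^ 4 = 1 := Units.ext (by simpa using h)
      have := orderOf_dvd_of_pow_eq_one h'
      rw [hord] at this
      exact absurd this (by decide)
    have : ((α : K) ^ 4 - 1) * ((α : K) ^ 4 + 1) = 0 := by linear_combination h8
    exact eq_neg_of_add_eq_zero_left
      ((mul_eq_zero.1 this).resolve_left (sub_ne_zero.2 hne))
  -- In characteristic three α⁴ + 1 = (α² - α - 1)(α² + α - 1), so a generator satisfies α² = 1 ± α.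
  obtain ⟨b, hb, hαb⟩ : ∃ b : ZMod 3, b ≠ 0 ∧
      (α : K) * α = (1 : ZMod 3) • (1 : K) + b • (α : K) := by
    have : ((α : K) ^ 2 - 1 - α) * ((α : K) ^ 2 - 1 + α) = 0 := by
      linear_combination h4 - (α : K) ^ 2 * h30
    rcases mul_eq_zero.1 this with h | h
    · exact ⟨1, by decide, by rw [one_smul, one_smul]; linear_combination h⟩
    · exact ⟨-1, by decide, by rw [one_smul, neg_smul, one_smul]; linear_combination h⟩
  let f : QuadraticAlgebra (ZMod 3) 1 b →ₐ[ZMod 3] K := QuadraticAlgebra.lift ⟨α, hαb⟩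
  have hf : ∀ x y, f ⟨x, y⟩ = x • (1 : K) + y • (α : K) := fun x y => rfl
  have hfα : f ⟨0, 1⟩ = α := by rw [hf, zero_smul, one_smul, zero_add]
  have hsurj : Function.Surjective f := by
    intro x
    by_cases hx : x = 0
    · exact ⟨0, by rw [map_zero, hx]⟩
    · obtain ⟨n, hn⟩ := (Submonoid.mem_powers_iff _ _).1
        ((mem_powers_iff_mem_zpowers (x := α) (y := Units.mk0 x hx)).2 (hα ▸ Subgroup.mem_top _))
      exact ⟨⟨0, 1⟩ ^ n, by rw [map_pow, hfα, ← Units.val_pow_eq_pow_val, hn, Units.val_mk0]⟩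
  have hbij : Function.Bijective f := hsurj.bijective_of_nat_card_le (by
    rw [hK, Nat.card_congr (QuadraticAlgebra.equivProd _ _), Nat.card_prod, Nat.card_zmod])
  let e : QuadraticAlgebra (ZMod 3) 1 b ≃+* K := RingEquiv.ofBijective f hbij
  have heα : e ⟨0, 1⟩ = α := hfα
  have h := startingPair_of_isRigidPair hk hN hu hτ ((isRigidPair_nine hb).map e) 0 (by simp) (by
    intro i hi
    rw [map_ne_zero_iff _ e.injective]
    fin_cases i
    · exact absurd rfl hi
    all_goals simp [QuadraticAlgebra.ext_iff])
  convert h using 1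
  · simp [comb, Fin.sum_univ_four]
  · simp [comb, Fin.sum_univ_four, heα, Units.smul_def]

end Pauli

/-! ### Changing the Pauli basis. -/

namespace Pauli

variable {K V : Type*} [Field K] [AddCommGroup V] [Module K V] {k : ℕ}
  {G N : Subgroup (GLin K V)}

section NewBases

lemma IsPauliBasis.map {u : Module.Basis (WSpace k) K V} (hu : IsPauliBasis N u) {T : GLin K V}
    (hT : ∀ a, a ∈ N ↔ T * a * T⁻¹ ∈ N) : IsPauliBasis N (u.map T) := by
  have hp : ∀ l a b, T * pauli u l a b * T⁻¹ = pauli (u.map T) l a b := by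
    intro l a b
    rw [mul_inv_eq_iff_eq_mul]
    apply basis_ext u
    intro w
    rw [LinearEquiv.mul_apply, LinearEquiv.mul_apply, pauli_apply, ← Module.Basis.map_apply u T w,
      pauli_apply, Module.Basis.map_apply, Units.smul_def, Units.smul_def, map_smul]
  intro g
  have hg : T * (T⁻¹ * g * T) * T⁻¹ = g := by group
  rw [← hg, ← hT, hu]
  refine exists_congr fun l => exists_congr fun a => exists_congr fun b => ?_
  rw [hg, ← hp, eq_mul_inv_iff_mul_eq, ← inv_mul_eq_iff_eq_mul, mul_assoc]

lemma IsPauliBasis.reindex (h2 : (2 : K) ≠ 0) {u : Module.Basis (WSpace k) K V}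
    (hu : IsPauliBasis N u) (ρ : WSpace k ≃+ WSpace k) :
    IsPauliBasis N (u.reindex ρ.symm.toEquiv) := by
  have happ : ∀ w, u.reindex ρ.symm.toEquiv w = u (ρ w) := fun w => by simp
  have hdual : ∀ (σ : WSpace k ≃+ WSpace k) (b : WSpace k), ∃ b' : WSpace k,
      ∀ w, b' ⬝ᵥ w = b ⬝ᵥ σ w := by
    intro σ b
    obtain ⟨b', hb'⟩ := exists_sgn_dot (K := K) (fun w => sgn K (b ⬝ᵥ σ w)) (fun a w => by
      rw [map_add, dotProduct_add, sgn_add])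
    exact ⟨b', fun w => sgn_injective h2 (hb' w).symm⟩
  have hp : ∀ l a b b', (∀ w, b ⬝ᵥ w = b' ⬝ᵥ ρ w) →
      pauli (u.reindex ρ.symm.toEquiv) l a b = pauli u l (ρ a) b' := by
    intro l a b b' hb
    apply basis_ext (u.reindex ρ.symm.toEquiv)
    intro w
    rw [pauli_apply, happ, happ, pauli_apply, map_add, hb]
  intro g
  rw [hu]
  constructor
  · rintro ⟨l, a, b, rfl⟩
    obtain ⟨b', hb'⟩ := hdual ρ b
    exact ⟨l, ρ.symm a, b', by rw [hp l _ b' b hb', ρ.apply_symm_apply]⟩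
  · rintro ⟨l, a, b, rfl⟩
    obtain ⟨b', hb'⟩ := hdual ρ.symm b
    exact ⟨l, ρ a, b', hp l a b b' fun w => by rw [hb', ρ.symm_apply_apply]⟩

lemma pauli_pauli (u : Module.Basis (WSpace k) K V) (l l' : Kˣ) (a b a' b' : WSpace k) (v : V) :
    pauli u l a b (pauli u l' a' b' v) =
      sgn K (b ⬝ᵥ a' + b' ⬝ᵥ a) • pauli u l' a' b' (pauli u l a b v) := by
  rw [← scal_apply, ← LinearEquiv.mul_apply, ← LinearEquiv.mul_apply, ← LinearEquiv.mul_apply,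
    pauli_mul, mul_assoc (scal K V _), pauli_mul, ← pauli_scal u, pauli_mul]
  congr 2
  · rw [zero_dotProduct, sgn_zero, mul_one, sgn_add, mul_comm l, mul_comm (_ * _) (_ * _ * _),
      mul_mul_mul_comm]
    simp [mul_assoc]
  · rw [zero_add, add_comm]
  · rw [zero_add, add_comm]

/-- In characteristic three, the sum of two anticommuting Pauli involutions is a transformation
that normalizes the Pauli group. -/
lemma exists_hadamard (h3 : (3 : K) = 0) {u : Module.Basis (WSpace k) K V}
    (hu : IsPauliBasis N u) {a b : WSpace k} (hab : b ⬝ᵥ a = 1) :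
    ∃ T : GLin K V, (∀ v, T v = pauli u 1 a 0 v + pauli u 1 0 b v) ∧
      ∀ g, g ∈ N ↔ T * g * T⁻¹ ∈ N := by
  set A := pauli u 1 a 0 with hA
  set B := pauli u 1 0 b with hB
  have hAA : ∀ v, A (A v) = v := fun v => by
    rw [← LinearEquiv.mul_apply, hA, pauli_mul]
    simp [add_self_eq_zero, pauli_one]
  have hBB : ∀ v, B (B v) = v := fun v => by
    rw [← LinearEquiv.mul_apply, hB, pauli_mul]
    simp [add_self_eq_zero, pauli_one]
  have hBA : ∀ v, B (A v) = -A (B v) := fun v => by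
    rw [hA, hB, pauli_pauli]
    simp [hab]
  have hv3 : ∀ v : V, v + v + v = 0 := fun v => by
    have : (3 : K) • v = 0 := by rw [h3, zero_smul]
    rw [← this]; module
  let f : V →ₗ[K] V := (A : V →ₗ[K] V) + (B : V →ₗ[K] V)
  have hf : ∀ v, f v = A v + B v := fun v => rfl
  -- The cross terms cancel, so (A + B)² = A² + B² = 2, which is -1 in characteristic three.
  have hff : ∀ v, f (f v) = -v := fun v => by
    rw [hf, hf, map_add, map_add, hAA, hBB, hBA, eq_neg_iff_add_eq_zero, ← hv3 v]
    abel
  let T : GLin K V := LinearEquiv.ofLinearMap f (-f)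
    (LinearMap.ext fun v => by simp [hff]) (LinearMap.ext fun v => by simp [hff])
  have hT : ∀ v, T v = A v + B v := fun v => rfl
  have hTT : ∀ v, T (T v) = -v := hff
  have hTi : T⁻¹ = T * scal K V (-1) := by
    rw [inv_eq_iff_mul_eq_one]
    ext v
    simp [LinearEquiv.mul_apply, hTT]
  have hAN : A ∈ N := (hu _).2 ⟨_, _, _, hA⟩
  have hBN : B ∈ N := (hu _).2 ⟨_, _, _, hB⟩
  have hsN : ∀ l, scal K V l ∈ N := fun l => (hu _).2 ⟨l, 0, 0, (pauli_scal u l).symm⟩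
  have key : ∀ g ∈ N, T * g * T⁻¹ ∈ N := by
    intro g hg
    obtain ⟨l, p, q, rfl⟩ := (hu g).1 hg
    set P := pauli u l p q with hP
    have hAP : ∀ v, A (P v) = sgn K (q ⬝ᵥ a) • P (A v) := fun v => by
      rw [hA, hP, pauli_pauli]
      simp
    have hBP : ∀ v, B (P v) = sgn K (b ⬝ᵥ p) • P (B v) := fun v => by
      rw [hB, hP, pauli_pauli]
      simp
    -- If P has the same sign with A and B, it commutes with T up to sign. Otherwise TPT⁻¹ is
    -- ±P(AB), because AB(A + B) = A - B.
    by_cases h : q ⬝ᵥ a = b ⬝ᵥ p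
    · have : T * P * T⁻¹ = scal K V (sgn K (b ⬝ᵥ p)) * P := by
        rw [mul_inv_eq_iff_eq_mul]
        ext v
        rw [LinearEquiv.mul_apply, hT, hAP, hBP, h, LinearEquiv.mul_apply, LinearEquiv.mul_apply,
          scal_apply, hT, map_add, smul_add]
      rw [this]
      exact N.mul_mem (hsN _) hg
    · have : T * P * T⁻¹ = scal K V (sgn K (q ⬝ᵥ a)) * (P * (A * B)) := by
        have hs : sgn K (b ⬝ᵥ p) = -sgn K (q ⬝ᵥ a) := by
          rcases zmod_two_cases (q ⬝ᵥ a) with h1 | h1 <;>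
            rcases zmod_two_cases (b ⬝ᵥ p) with h4 | h4 <;> simp_all
        rw [mul_inv_eq_iff_eq_mul]
        ext v
        simp only [LinearEquiv.mul_apply, scal_apply, hT, hAP, hBP, hs, map_add, hBA, map_neg, hAA,
          hBB]
        rw [add_comm, Units.neg_smul]
      rw [this]
      exact N.mul_mem (hsN _) (N.mul_mem hg (N.mul_mem hAN hBN))
  refine ⟨T, hT, fun g => ⟨key g, fun h => ?_⟩⟩
  have h1 := key _ h
  have h4 : T * (T * g * T⁻¹) * T⁻¹ = g := by
    rw [hTi]
    ext v
    simp [LinearEquiv.mul_apply, hTT]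
  rwa [h4] at h1

end NewBases

end Pauli

/-! ### Starting pairs for q = 3. -/

namespace Pauli

variable {K V : Type*} [Field K] [AddCommGroup V] [Module K V] {k : ℕ}
  {G N : Subgroup (GLin K V)}

/-- In a group of order prime to three, an element whose cube fixes `v` fixes `v`. -/
lemma fixed_of_cube_fixed (hG : (Nat.card G).Coprime 3) {f : GLin K V} (hf : f ∈ G) {v : V}
    (h : f (f (f v)) = v) : f v = v := by
  have h3 : Function.IsPeriodicPt f 3 v := h
  have hm : Function.IsPeriodicPt f (Nat.card G) v := by
    have h1 : f ^ Nat.card G = 1 := by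
      have := congrArg Subtype.val (pow_card_eq_one' (x := (⟨f, hf⟩ : G)))
      exact this
    have h2 : ∀ n : ℕ, (f : V → V)^[n] v = (f ^ n) v := by
      intro n
      induction n with
      | zero => rfl
      | succ n ih => rw [Function.iterate_succ_apply', ih, pow_succ', LinearEquiv.mul_apply]
    rw [Function.IsPeriodicPt, Function.IsFixedPt, h2, h1]
    rfl
  have := hm.gcd h3
  rw [hG] at this
  exact this

lemma eq_one_or_neg_one (hK : Nat.card K = 3) (c : Kˣ) : c = 1 ∨ c = -1 := by
  have : Finite K := Nat.finite_of_card_ne_zero (by omega)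
  have h : c ^ 2 = 1 := by
    have h1 := pow_card_eq_one' (x := c)
    rwa [Nat.card_units, hK] at h1
  rw [sq, ← Units.val_inj, Units.val_mul, Units.val_one, mul_self_eq_one_iff] at h
  exact h.imp Units.ext fun h1 => Units.ext (by rw [h1, Units.val_neg, Units.val_one])

/-- The group `G` contains a diagonal transformation of the plane with determinant not one. -/
def HasTwist (G : Subgroup (GLin K V)) (u : Module.Basis (WSpace k) K V) (τ : Fin 4 → WSpace k) :
    Prop :=
  ∃ g ∈ G, ∃ c : Fin 4 → Kˣ, (∀ i, g (u (τ i)) = c i • u (τ i)) ∧ c 0 * c 1 * c 2 * c 3 ≠ 1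

section Enumeration

variable {τ : Fin 4 → WSpace k} (hτ : IsPlaneEnumeration τ)

include hτ

lemma exists_dual : ∃ b₁ b₂ : WSpace k, b₁ ⬝ᵥ τ 1 = 1 ∧ b₁ ⬝ᵥ τ 2 = 0 ∧ b₂ ⬝ᵥ τ 1 = 0 ∧
    b₂ ⬝ᵥ τ 2 = 1 := by
  obtain ⟨b₁, h11, h10⟩ := exists_dot_eq_one_zero (enum_ne_zero hτ (i := 1) (by decide))
    (hτ.2.1.ne (show (1 : Fin 4) ≠ 2 by decide))
  obtain ⟨b₂, h22, h21⟩ := exists_dot_eq_one_zero (enum_ne_zero hτ (i := 2) (by decide))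
    (hτ.2.1.ne (show (2 : Fin 4) ≠ 1 by decide))
  exact ⟨b₁, b₂, h11, h10, h21, h22⟩

/-- A Pauli sign change can prescribe the signs at τ 0, τ 1, τ 2. The product of all four signs is
not affected, so the remaining sign at τ 3 is -1. -/
lemma HasTwist.normalize (hk : 2 ≤ k) (hK : Nat.card K = 3) (hNG : N ≤ G)
    {u : Module.Basis (WSpace k) K V} (hu : IsPauliBasis N u) (h : HasTwist G u τ) :
    ∃ g ∈ G, g (u (τ 0)) = u (τ 0) ∧ g (u (τ 1)) = u (τ 1) ∧ g (u (τ 2)) = u (τ 2) ∧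
      g (u (τ 3)) = -u (τ 3) := by
  obtain ⟨g, hg, c, hc, hne⟩ := h
  obtain ⟨b₁, b₂, h11, h12, h21, h22⟩ := exists_dual hτ
  have hsgn : ∀ c : Kˣ, ∃ s, c = sgn K s := fun c => by
    rcases eq_one_or_neg_one hK c with rfl | rfl
    · exact ⟨0, sgn_zero.symm⟩
    · exact ⟨1, sgn_one.symm⟩
  choose s hs using fun i => hsgn (c i)
  have hne' : s 0 + s 1 + s 2 + s 3 = 1 := by
    refine (zmod_two_cases _).resolve_left fun h => hne ?_
    rw [hs, hs, hs, hs, ← sgn_add, ← sgn_add, ← sgn_add, h, sgn_zero]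
  let p := pauli u (sgn K (s 0)) 0 ((s 0 + s 1) • b₁ + (s 0 + s 2) • b₂)
  have hp : p ∈ G := hNG ((hu _).2 ⟨_, _, _, rfl⟩)
  have hpg : ∀ i, (p * g) (u (τ i)) =
      sgn K (s 0 + s i + ((s 0 + s 1) * (b₁ ⬝ᵥ τ i) + (s 0 + s 2) * (b₂ ⬝ᵥ τ i))) • u (τ i) := by
    intro i
    rw [LinearEquiv.mul_apply, hc, Units.smul_def, map_smul, ← Units.smul_def, pauli_apply,
      smul_smul, zero_add, hs, add_dotProduct, smul_dotProduct, smul_dotProduct, smul_eq_mul,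
      smul_eq_mul]
    simp only [sgn_add]
    congr 1
    ac_rfl
  refine ⟨p * g, G.mul_mem hp hg, ?_, ?_, ?_, ?_⟩
  · rw [hpg, hτ.1]
    simp [CharTwo.add_self_eq_zero]
  · rw [hpg, h11, h21]
    simp [CharTwo.add_self_eq_zero]
  · rw [hpg, h12, h22]
    simp [CharTwo.add_self_eq_zero]
  · rw [hpg, ← enum_add hτ hk, dotProduct_add, dotProduct_add, h11, h21, h12, h22]
    have : s 0 + s 3 + ((s 0 + s 1) * (1 + 0) + (s 0 + s 2) * (0 + 1)) = 1 := by
      linear_combination hne' + CharTwo.add_self_eq_zero (s 0)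
    rw [this, sgn_one]
    simp

lemma exists_isPauliBasis_not_hasTwist (hk : 2 ≤ k) (hK : Nat.card K = 3)
    (hG : (Nat.card G).Coprime 3) (hNG : N ≤ G)
    {u : Module.Basis (WSpace k) K V} (hu : IsPauliBasis N u) :
    ∃ u' : Module.Basis (WSpace k) K V, IsPauliBasis N u' ∧ ¬ HasTwist G u' τ := by
  by_contra! hall
  have : Finite K := Nat.finite_of_card_ne_zero (by omega)
  have := Fintype.ofFinite K
  have h3 : (3 : K) = 0 := by
    have : ((Nat.card K : ℕ) : K) = 0 := by
      rw [Nat.card_eq_fintype_card]; exact Nat.cast_card_eq_zero K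
    rw [hK] at this
    exact_mod_cast this
  have hv3 : ∀ v : V, (3 : K) • v = 0 := fun v => by rw [h3, zero_smul]
  obtain ⟨b₁, b₂, h11, h12, h21, h22⟩ := exists_dual hτ
  obtain ⟨T₁, hT₁, hn₁⟩ := exists_hadamard h3 hu h11
  obtain ⟨T₂, hT₂, hn₂⟩ := exists_hadamard h3 hu h22
  have hu' : IsPauliBasis N ((u.map T₂).map T₁) := (hu.map hn₂).map hn₁
  obtain ⟨g₀, hg₀, e0, e1, e2, e3⟩ := (hall u hu).normalize hτ hk hK hNG hu
  obtain ⟨g₁, hg₁, f0, f1, f2, f3⟩ := (hall _ hu').normalize hτ hk hK hNG hu'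
  have hadd := enum_add_eq hτ hk
  have hT : ∀ i, (u.map T₂).map T₁ (τ i) = u (τ (i ^^^ 2 ^^^ 1)) +
      sgn K (b₁ ⬝ᵥ τ (i ^^^ 2)) • u (τ (i ^^^ 2)) + sgn K (b₂ ⬝ᵥ τ i) • u (τ (i ^^^ 1)) +
      sgn K (b₂ ⬝ᵥ τ i + b₁ ⬝ᵥ τ i) • u (τ i) := by
    intro i
    simp only [Module.Basis.map_apply, hT₁, hT₂, pauli_apply, hadd, map_add, zero_add, one_mul,
      zero_dotProduct, sgn_zero, one_smul, Units.smul_def, map_smul, sgn_add, mul_smul]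
    abel
  have h13 : b₁ ⬝ᵥ τ 3 = 1 := by rw [← enum_add hτ hk, dotProduct_add, h11, h12, add_zero]
  have h23 : b₂ ⬝ᵥ τ 3 = 1 := by rw [← enum_add hτ hk, dotProduct_add, h21, h22, zero_add]
  have h10 : b₁ ⬝ᵥ τ 0 = 0 := by rw [hτ.1, dotProduct_zero]
  have h20 : b₂ ⬝ᵥ τ 0 = 0 := by rw [hτ.1, dotProduct_zero]
  have t0 := hT 0
  have t1 := hT 1
  have t2 := hT 2
  have t3 := hT 3
  simp only [Fin.reduceXor, Fin.isValue, h10, h20, h11, h12, h21, h22, h13, h23, zero_add, add_zero,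
    sgn_zero, sgn_one, one_smul, Units.neg_smul, CharTwo.add_self_eq_zero] at t0 t1 t2 t3
  generalize (u.map T₂).map T₁ (τ 0) = w0 at *
  generalize (u.map T₂).map T₁ (τ 1) = w1 at *
  generalize (u.map T₂).map T₁ (τ 2) = w2 at *
  generalize (u.map T₂).map T₁ (τ 3) = w3 at *
  have hne : w0 ≠ -u (τ 0) := by
    intro h
    rw [t0] at h
    have h4 : comb u τ ![1, 1, 1, 1] = comb u τ ![-1, 0, 0, 0] := by
      simp only [comb, Fin.sum_univ_four]
      simp only [Matrix.cons_val, one_smul, zero_smul, neg_smul, add_zero]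
      rw [← h]
      abel
    exact one_ne_zero (α := K) (congrFun (comb_injective hτ u h4) 1)
  generalize u (τ 0) = v0 at *
  generalize u (τ 1) = v1 at *
  generalize u (τ 2) = v2 at *
  generalize u (τ 3) = v3 at *
  have s0 : v0 = w0 + w1 + w2 + w3 := by
    linear_combination (norm := module) -t0 - t1 - t2 - t3 - hv3 v0
  have s3 : v3 = w0 - w1 - w2 + w3 := by
    linear_combination (norm := module) -t0 + t1 + t2 - t3 - hv3 v3
  have g1v0 : g₁ v0 = v0 + w3 := by
    nth_rewrite 1 [s0]
    rw [map_add, map_add, map_add, f0, f1, f2, f3]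
    linear_combination (norm := module) -s0 - hv3 w3
  have g1v3 : g₁ v3 = v3 + w3 := by
    nth_rewrite 1 [s3]
    rw [map_add, map_sub, map_sub, f0, f1, f2, f3]
    linear_combination (norm := module) -s3 - hv3 w3
  have g0w0 : g₀ w0 = w0 + v3 := by
    nth_rewrite 1 [t0]
    rw [map_add, map_add, map_add, e0, e1, e2, e3]
    linear_combination (norm := module) -t0 - hv3 v3
  have g0w3 : g₀ w3 = w3 + v3 := by
    nth_rewrite 1 [t3]
    simp only [map_add, map_neg, e0, e1, e2, e3]
    linear_combination (norm := module) -t3 - hv3 v3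
  have c1 : g₀ (g₁ v0) = -w0 := by
    rw [g1v0, map_add, e0, g0w3]
    linear_combination (norm := module) t0 + t3 + hv3 v0 + hv3 v3
  have c3 : g₀ (g₁ (g₀ (g₁ (g₀ (g₁ v0))))) = v0 := by
    rw [c1, map_neg, f0, map_neg, g0w0, map_neg, map_add, f0, g1v3]
    have : -(w0 + (v3 + w3)) = v0 := by
      linear_combination (norm := module) -t0 - t3 - hv3 v0 - hv3 v3
    rw [this, e0]
  have := fixed_of_cube_fixed hG (G.mul_mem hg₀ hg₁) (v := v0) c3
  rw [LinearEquiv.mul_apply, c1] at this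
  exact hne (by rw [← this, neg_neg])

/-- A linear permutation of the labels that permutes the non-zero vectors of the plane
cyclically. -/
lemma exists_rotation (hk : 2 ≤ k) : ∃ ρ : WSpace k ≃+ WSpace k, ρ (τ 1) = τ 2 ∧ ρ (τ 2) = τ 3 ∧
    ρ (τ 3) = τ 1 := by
  obtain ⟨b₁, b₂, h11, h12, h21, h22⟩ := exists_dual hτ
  have h3 := enum_add hτ hk
  let f : WSpace k →+ WSpace k :=
    -- The vector τ 3 is added along the functional dual to τ 1, and τ 1 along the one dual to τ 2;
    -- since τ 1 + τ 3 = τ 2, this rotates the plane, and its cube is the identity.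
    { toFun := fun w => w + ((b₁ ⬝ᵥ w) • τ 3 + (b₂ ⬝ᵥ w) • τ 1)
      map_zero' := by simp
      map_add' := fun a w => by
        rw [dotProduct_add, dotProduct_add, add_smul, add_smul]
        abel }
  have hf : ∀ w, f w = w + ((b₁ ⬝ᵥ w) • τ 3 + (b₂ ⬝ᵥ w) • τ 1) := fun w => rfl
  have f1 : f (τ 1) = τ 2 := by
    rw [hf, h11, h21, one_smul, zero_smul, add_zero, ← h3, add_add_cancel]
  have f2 : f (τ 2) = τ 3 := by
    rw [hf, h12, h22, one_smul, zero_smul, zero_add, ← h3, add_comm]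
  have f3 : f (τ 3) = τ 1 := by
    rw [← h3, map_add, f1, f2, ← h3, add_comm (τ 1), add_add_cancel]
  have hsmul : ∀ (c : ZMod 2) w, f (c • w) = c • f w := fun c w => by
    rcases zmod_two_cases c with rfl | rfl <;> simp
  have hfff : ∀ w, f (f (f w)) = w := by
    intro w
    have : f (f (f w)) = f (f w) + ((b₁ ⬝ᵥ w) • f (f (τ 3)) + (b₂ ⬝ᵥ w) • f (f (τ 1))) := by
      nth_rewrite 3 [hf]
      rw [map_add, map_add, map_add, map_add, hsmul, hsmul, hsmul, hsmul]
    rw [this, f3, f1, f2]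
    nth_rewrite 2 [hf]
    rw [map_add, map_add, hsmul, hsmul, f3, f1, hf, ← h3]
    generalize b₁ ⬝ᵥ w = p
    generalize b₂ ⬝ᵥ w = q
    rcases zmod_two_cases p with rfl | rfl <;> rcases zmod_two_cases q with rfl | rfl <;>
      funext i <;> simp <;> grind
  exact ⟨{ f with invFun := fun w => f (f w), left_inv := hfff, right_inv := hfff }, f1, f2, f3⟩

/-- The twist condition involves only the product of the four coefficients, so it survives
relabelling within the plane. -/
lemma HasTwist.of_reindex {u : Module.Basis (WSpace k) K V}
    {ρ : WSpace k ≃+ WSpace k} (h1 : ρ (τ 1) = τ 2) (h2 : ρ (τ 2) = τ 3) (h3 : ρ (τ 3) = τ 1)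
    (h : HasTwist G (u.reindex ρ.symm.toEquiv) τ) : HasTwist G u τ := by
  obtain ⟨g, hg, c, hc, hne⟩ := h
  have happ : ∀ w, u.reindex ρ.symm.toEquiv w = u (ρ w) := fun w => by simp
  simp only [happ] at hc
  refine ⟨g, hg, ![c 0, c 3, c 1, c 2], ?_, ?_⟩
  · intro i
    fin_cases i
    · simpa [hτ.1] using hc 0
    · simpa [h3] using hc 3
    · simpa [h1] using hc 1
    · simpa [h2] using hc 2
  · convert hne using 1
    simp only [Matrix.cons_val]
    ac_rfl

/-- After a suitable choice of the basis there are no elements of `G` that are diagonal on the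
plane with determinant not one, or that fix `u (τ 0)` and interchange `u (τ 2)` and `u (τ 3)`. -/
lemma exists_isPauliBasis_rigid (hk : 2 ≤ k) (hK : Nat.card K = 3)
    (hG : (Nat.card G).Coprime 3) (hNG : N ≤ G) (h2 : (2 : K) ≠ 0)
    (hN : ∀ g ∈ G, ∀ a ∈ N, g * a * g⁻¹ ∈ N)
    {u : Module.Basis (WSpace k) K V} (hu : IsPauliBasis N u) :
    ∃ u' : Module.Basis (WSpace k) K V, IsPauliBasis N u' ∧ ¬ HasTwist G u' τ ∧
      ∀ g ∈ G, g (u' 0) = u' 0 → g (u' (τ 2)) = u' (τ 3) → g (u' (τ 3)) ≠ u' (τ 2) := by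
  obtain ⟨u, hu, htw⟩ := exists_isPauliBasis_not_hasTwist hτ hk hK hG hNG hu
  obtain ⟨ρ, h12, h23, h31⟩ := exists_rotation hτ hk
  by_contra! hall
  -- The swaps found in the basis and in its rotation are different transpositions of the lines of τ
  -- 1, τ 2, τ 3, so their product f is a 3-cycle on these lines.
  obtain ⟨g₀, hg₀, e0, e2, e3⟩ := hall u hu htw
  obtain ⟨g₁, hg₁, f0, f2, f3⟩ := hall _ (hu.reindex h2 ρ)
    fun h => htw (HasTwist.of_reindex hτ h12 h23 h31 h)
  have happ : ∀ w, u.reindex ρ.symm.toEquiv w = u (ρ w) := fun w => by simp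
  rw [happ, map_zero] at f0
  rw [happ, happ, h23, h31] at f2 f3
  have hfix : ∀ g ∈ G, g (u 0) = u 0 → ∀ i j, g (u (τ i)) = u (τ j) →
      g (u (τ j)) = u (τ i) → ∃ c : Kˣ, g (u (τ (i ^^^ j))) = c • u (τ (i ^^^ j)) := by
    intro g hg h0 i j hi hj
    obtain ⟨π, c, hm⟩ := exists_isMonomial hN h2 hu hg h0
    have hi' := (smul_basis_inj u ((hm.apply _).symm.trans (hi.trans (one_smul Kˣ _).symm))).2
    have hj' := (smul_basis_inj u ((hm.apply _).symm.trans (hj.trans (one_smul Kˣ _).symm))).2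
    refine ⟨c (τ (i ^^^ j)), ?_⟩
    rw [hm.apply]
    nth_rewrite 2 [← enum_add_eq hτ hk]
    rw [hm.map_add, hi', hj', add_comm, enum_add_eq hτ hk]
  obtain ⟨c, hc⟩ := hfix g₀ hg₀ e0 2 3 e2 e3
  obtain ⟨d, hd⟩ := hfix g₁ hg₁ f0 3 1 f2 f3
  rw [show (2 ^^^ 3 : Fin 4) = 1 by decide] at hc
  rw [show (3 ^^^ 1 : Fin 4) = 2 by decide] at hd
  set f := g₀ * g₁ with hf
  have k1 : f (u (τ 1)) = u (τ 2) := by rw [hf, LinearEquiv.mul_apply, f3, e3]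
  have k2 : f (u (τ 2)) = d • u (τ 3) := by
    rw [hf, LinearEquiv.mul_apply, hd, Units.smul_def, map_smul, e2, Units.smul_def]
  have k3 : f (u (τ 3)) = c • u (τ 1) := by rw [hf, LinearEquiv.mul_apply, f2, hc]
  have hsm : ∀ (c : Kˣ) v, f (c • v) = c • f v := fun c v => by
    rw [Units.smul_def, map_smul, Units.smul_def]
  have hsq : ∀ c : Kˣ, c * c = 1 := fun c => by
    rcases eq_one_or_neg_one hK c with rfl | rfl <;> simp
  -- The square of f is used because f³ may still multiply u (τ 1) by -1, whereas f⁶ fixes it.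
  have := fixed_of_cube_fixed hG (G.mul_mem (G.mul_mem hg₀ hg₁) (G.mul_mem hg₀ hg₁))
    (v := u (τ 1)) (by
      rw [← hf]
      simp only [LinearEquiv.mul_apply, k1, k2, k3, hsm, smul_smul]
      rw [mul_assoc (d * c), hsq, one_smul])
  rw [← hf, LinearEquiv.mul_apply, k1, k2] at this
  exact absurd (hτ.2.1 (smul_basis_inj u (this.trans (one_smul Kˣ _).symm)).2) (by decide)

omit hτ

/-- Such a g is monomial and permutes the labels τ 2 and τ 3 with coefficients 1. Without the swap
it fixes both, hence also their sum τ 1, and the coefficient there is 1 because there is no twist.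
-/
lemma startingPair_three (hk : 2 ≤ k) (h2 : (2 : K) ≠ 0)
    (hN : ∀ g ∈ G, ∀ a ∈ N, g * a * g⁻¹ ∈ N)
    {u : Module.Basis (WSpace k) K V} (hu : IsPauliBasis N u) (hτ : IsPlaneEnumeration τ)
    (htw : ¬ HasTwist G u τ)
    (hsw : ∀ g ∈ G, g (u 0) = u 0 → g (u (τ 2)) = u (τ 3) → g (u (τ 3)) ≠ u (τ 2)) :
    IsStartingPair G u (u (τ 0)) (u (τ 0) + u (τ 2) + u (τ 3)) := by
  have hx : u (τ 0) = comb u τ ![1, 0, 0, 0] := by simp [comb, Fin.sum_univ_four]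
  have hy : u (τ 0) + u (τ 2) + u (τ 3) = comb u τ ![1, 0, 1, 1] := by
    simp [comb, Fin.sum_univ_four]
  rw [hy, hx]
  refine startingPair_of hk hτ u 1 rfl ?_ ?_
  · intro i hi
    fin_cases i
    · exact one_ne_zero
    · exact absurd rfl hi
    · exact one_ne_zero
    · exact one_ne_zero
  intro g hg hgx hgy _
  rw [← hx, hτ.1] at hgx
  obtain ⟨π, c, hm⟩ := exists_isMonomial hN h2 hu hg hgx
  have h23 : ∀ i, i ≠ 0 → (![1, 0, 1, 1] : Fin 4 → K) i = 1 →
      (π (τ i) = τ 2 ∨ π (τ i) = τ 3) ∧ g (u (τ i)) = u (π (τ i)) := by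
    intro i hi h1
    have h := hm.repr_apply (comb u τ ![1, 0, 1, 1]) (τ i)
    rw [hgy, repr_comb hτ, h1, mul_one] at h
    have hmem : π (τ i) ∈ plane k := by
      by_contra hne
      rw [(mem_planeSpan_iff u _).1 (comb_mem hτ u _) _ hne] at h
      exact Units.ne_zero _ h.symm
    obtain ⟨j, hj⟩ := enum_exists hτ hmem
    have hj0 : j ≠ 0 := by
      rintro rfl
      rw [hτ.1, ← hm.map_zero] at hj
      exact enum_ne_zero hτ hi (π.injective hj.symm)
    rw [← hj, repr_comb hτ] at h
    rw [hm.apply, ← hj]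
    fin_cases j
    · exact absurd rfl hj0
    · exact absurd h.symm (Units.ne_zero _)
    · exact ⟨Or.inl rfl, by rw [(Units.ext h.symm : c (τ i) = 1), one_smul]⟩
    · exact ⟨Or.inr rfl, by rw [(Units.ext h.symm : c (τ i) = 1), one_smul]⟩
  obtain ⟨p2, q2⟩ := h23 2 (by decide) rfl
  obtain ⟨p3, q3⟩ := h23 3 (by decide) rfl
  have hne : π (τ 2) ≠ π (τ 3) := fun h =>
    absurd (hτ.2.1 (π.injective h)) (by decide)
  have hfix : π (τ 2) = τ 2 ∧ π (τ 3) = τ 3 := by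
    rcases p2 with p2 | p2 <;> rcases p3 with p3 | p3
    · exact absurd (p2.trans p3.symm) hne
    · exact ⟨p2, p3⟩
    · exact absurd (q3.trans (by rw [p3])) (hsw g hg hgx (q2.trans (by rw [p2])))
    · exact absurd (p2.trans p3.symm) hne
  rw [hfix.1] at q2
  rw [hfix.2] at q3
  have h1 : g (u (τ 1)) = c (τ 1) • u (τ 1) := by
    rw [hm.apply, show τ 1 = τ (2 ^^^ 3) from rfl, ← enum_add_eq hτ hk, hm.map_add, hfix.1, hfix.2]
  have hc : c (τ 1) = 1 := by
    by_contra hc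
    refine htw ⟨g, hg, ![1, c (τ 1), 1, 1], fun i => ?_, by simpa using hc⟩
    fin_cases i
    · simpa [hτ.1] using hgx
    · exact h1
    · simpa using q2
    · simpa using q3
  intro i
  fin_cases i
  · simpa [hτ.1] using hgx
  · simpa [hc] using h1
  · exact q2
  · exact q3

end Enumeration
end Pauli

/-! ### Assembly of the main theorem. -/

theorem theorem5p10 {K V : Type*} [Field K] [Finite K] [AddCommGroup V] [Module K V]
    (k : ℕ) (hk : 3 ≤ k) (hdim : Module.finrank K V = 2 ^ k)
    (G N R : Subgroup (GLin K V))
    (hcoprime : Nat.Coprime (Nat.card G) (Nat.card V))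
    (hG : IsSymplecticType 2 G N) (hR : IsExtraspecialPart 2 N R)
    (hmon : IsMonomialType 2 (Nat.card K) R) :
    -- adapted bases exist
    (∃ u : Module.Basis (WSpace k) K V, IsAdaptedBasis N u) ∧
    -- for `q ≠ 3`, the explicit vectors `x₀, y₀` can be used with every adapted basis
    (Nat.card K ≠ 3 →
      ∀ u : Module.Basis (WSpace k) K V, IsAdaptedBasis N u →
      ∀ τ : Fin 4 → WSpace k, IsPlaneEnumeration τ →
        (∃ x₀ y₀ : V, IsExplicitPair K (u (τ 0)) (u (τ 1)) (u (τ 2)) (u (τ 3)) x₀ y₀) ∧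
        ∀ x₀ y₀ : V, IsExplicitPair K (u (τ 0)) (u (τ 1)) (u (τ 2)) (u (τ 3)) x₀ y₀ →
          IsStartingPair G u x₀ y₀) ∧
    -- for `q = 3`, they can be used with a suitable adapted basis
    (Nat.card K = 3 →
      ∀ τ : Fin 4 → WSpace k, IsPlaneEnumeration τ →
      ∃ u : Module.Basis (WSpace k) K V, IsAdaptedBasis N u ∧
        ∀ x₀ y₀ : V, IsExplicitPair K (u (τ 0)) (u (τ 1)) (u (τ 2)) (u (τ 3)) x₀ y₀ →
          IsStartingPair G u x₀ y₀) ∧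
    -- the vectors `x = y₀` and `y = x₀ + v` form a base
    (∀ u : Module.Basis (WSpace k) K V, IsAdaptedBasis N u →
      ∀ x₀ y₀ : V, IsStartingPair G u x₀ y₀ →
        (∃ Ω₃ Ω₄ : Finset (WSpace k), IsBasePartition G u x₀ y₀ Ω₃ Ω₄) ∧
        ∀ Ω₃ Ω₄ : Finset (WSpace k), IsBasePartition G u x₀ y₀ Ω₃ Ω₄ →
        ∀ x y : V, x = y₀ → y = x₀ + baseTail u Ω₄ →
          vectorCentralizer G x ⊓ vectorCentralizer G y = ⊥) := by
  classical
  have : Nontrivial V := hG.absIrred.1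
  have h2 : (2 : K) ≠ 0 := Pauli.two_ne_zero_of_extraspecial hR
  have hN := hG.normal
  have hPauli : ∀ u : Module.Basis (WSpace k) K V, IsAdaptedBasis N u → Pauli.IsPauliBasis N u :=
    fun u hu => Pauli.IsAdaptedBasis.isPauliBasis hG.scalar_le hG.quotient_comm hu
  obtain ⟨u₀, hu₀⟩ := Pauli.exists_isPauliBasis hdim hG hR hmon
  have hk2 : 2 ≤ k := by omega
  refine ⟨⟨u₀, hu₀.isAdaptedBasis h2⟩, ?_, ?_, ?_⟩
  · intro h3 u hu τ hτ
    have hu := hPauli u hu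
    constructor
    · by_cases h5 : Nat.card K = 5
      · exact ⟨_, _, Or.inr (Or.inr (Or.inl ⟨h5, rfl, rfl⟩))⟩
      by_cases h9 : Nat.card K = 9
      · obtain ⟨α, hα⟩ := IsCyclic.exists_generator (α := Kˣ)
        exact ⟨_, _, Or.inr (Or.inr (Or.inr ⟨h9, α, (Subgroup.eq_top_iff' _).2 hα, rfl, rfl⟩))⟩
      · obtain ⟨α, hα⟩ := Pauli.exists_pow_eight_ne_one h2 h3 h5 h9
        exact ⟨_, _, Or.inl ⟨h3, h5, h9, α, hα, rfl, rfl⟩⟩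
    · rintro x₀ y₀ (⟨-, -, -, α, hα, rfl, rfl⟩ | ⟨h, -⟩ | ⟨h5, rfl, rfl⟩ | ⟨h9, α, hα, rfl, rfl⟩)
      · exact Pauli.startingPair_generic hk2 h2 hN hu hτ hα
      · exact absurd h h3
      · exact Pauli.startingPair_five hk2 hN hu hτ h5
      · exact Pauli.startingPair_nine hk2 hN hu hτ h9 hα
  · intro h3 τ hτ
    -- Here |V| is a power of 3 with exponent 2^k > 0, so coprimality means 3 ∤ |G|.
    have hG3 : (Nat.card G).Coprime 3 := by
      have : Module.Finite K V := Module.Finite.of_basis u₀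
      rw [Module.natCard_eq_pow_finrank (K := K) (V := V), h3, hdim] at hcoprime
      exact (Nat.coprime_pow_right_iff (by positivity) _ _).1 hcoprime
    obtain ⟨u, hu, htw, hsw⟩ := Pauli.exists_isPauliBasis_rigid hτ hk2 h3 hG3 hG.le h2 hN hu₀
    refine ⟨u, hu.isAdaptedBasis h2, ?_⟩
    rintro x₀ y₀ (⟨h, -⟩ | ⟨-, rfl, rfl⟩ | ⟨h, -⟩ | ⟨h, -⟩)
    · exact absurd h3 h
    · exact Pauli.startingPair_three hk2 h2 hN hu hτ htw hsw
    · omega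
    · omega
  · intro u hu x₀ y₀ hxy
    have hu := hPauli u hu
    refine ⟨Pauli.exists_basePartition hk h2 hN hu hxy, ?_⟩
    rintro Ω₃ Ω₄ hΩ x y rfl rfl
    exact Pauli.centralizer_base_eq_bot hk h2 hN hu hxy hΩ
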